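/- All manifolds are smooth, Hausdorff and second countable, without boundary; they need be neither compact nor connected. Let $M,N$ be oriented manifolds of the same dimension $n\ge 2$, and let $B\subset N$ be a (possibly empty) oriented embedded submanifold of codimension two. A smooth map $\kappa:M\to N$ is called a \emph{two-fold cover with branch locus $B$} if its set of critical values is $B$, it has degree two in the sense that each $y\in N\setminus B$ has exactly two preimages, at both of which $\kappa$ preserves orientation, and around every point of $\kappa^{-1}(B)$ there are oriented local coordinates $(x_1,\dots,x_n)$ of $M$ and $(y_1,\dots,y_n)$ of $N$ in which $$\kappa:(x_1,\dots,x_n)\longmapsto (y_1,\dots,y_n)=(x_1^2-x_2^2,\;2x_1x_2,\;x_3,\dots,x_n),$$ that is, $(z,\mathbf w)\mapsto(z^2,\mathbf w)$ with $z=x_1+ix_2$. For a smooth complex line bundle $L\to N$ and a smooth section $s$ of $L\otimes L$ that is transverse to the zero section put $$M_{L,s}=\{t\in L : t\otimes t=s\}\subset L .$$ We say that $s$ has zero locus $B$ if $B$ is the zero set of $s$ and the derivative of $s$ along $B$ maps the normal bundle of $B$ to $(L\otimes L)|_B$ preserving orientations. \textbf{Proposition.} Let $\kappa:M\to N$ be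 a two-fold cover with branch locus $B$. (1) There exist a smooth complex line bundle $L$ on $N$, a transverse section $s$ of $L\otimes L$ with zero locus $B$ (as an oriented submanifold), and a diffeomorphism over $N$ from $M$ onto the submanifold $M_{L,s}$ of $L$. (2) The pair $(L,s)$ is determined by $M$ up to canonical isomorphism: if $(L,s)$ and $(L',s')$ are pairs of a smooth complex line bundle and a transverse section of its square, both with zero locus $B$ as an oriented submanifold, and $f:M\to M_{L,s}$, $f':M\to M_{L',s'}$ are diffeomorphisms over $N$, then there is exactly one isomorphism $\Phi:L\to L'$ of smooth complex line bundles over $N$ such that $(\Phi\otimes\Phi)(s)=s'$ and $\Phi\circ f=f'$. -/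

import Mathlib

open Bundle Manifold Topology
open scoped ContDiff TensorProduct ComplexConjugate

universe u v w

/-- The Jacobian determinant, at the point `p`, of a map `f` between charted spaces of dimension
`n`, expressed in the charts `φ` (source) and `ψ` (target). -/
noncomputable def chartJacobian {n : ℕ} {M N : Type*} [TopologicalSpace M] [TopologicalSpace N]
    (φ : OpenPartialHomeomorph M (EuclideanSpace ℝ (Fin n)))
    (ψ : OpenPartialHomeomorph N (EuclideanSpace ℝ (Fin n))) (f : M → N) (p : M) : ℝ :=
  (fderiv ℝ (fun a => ψ (f (φ.symm a))) (φ p)).det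

/-- An oriented smooth manifold of dimension `n`: a smooth manifold whose given atlas is an
oriented atlas, i.e. all its coordinate changes have positive Jacobian determinant. -/
class IsOrientedManifold (n : ℕ) (N : Type*) [TopologicalSpace N]
    [ChartedSpace (EuclideanSpace ℝ (Fin n)) N] : Prop extends IsManifold (𝓡 n) ∞ N where
  jacobian_pos : ∀ φ ∈ atlas (EuclideanSpace ℝ (Fin n)) N,
    ∀ ψ ∈ atlas (EuclideanSpace ℝ (Fin n)) N, ∀ x ∈ φ.source ∩ ψ.source,
      0 < chartJacobian φ ψ id x

/-- Oriented local coordinates on `N`: smooth charts that are positively related to the charts of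
the given (oriented) atlas. -/
def IsOrientedChart {n : ℕ} {N : Type*} [TopologicalSpace N]
    [ChartedSpace (EuclideanSpace ℝ (Fin n)) N]
    (ψ : OpenPartialHomeomorph N (EuclideanSpace ℝ (Fin n))) : Prop :=
  ψ ∈ IsManifold.maximalAtlas (𝓡 n) ∞ N ∧
    ∀ φ ∈ atlas (EuclideanSpace ℝ (Fin n)) N, ∀ x ∈ φ.source ∩ ψ.source,
      0 < chartJacobian φ ψ id x

/-- For a chart `ψ = (y₀, y₁, y₂, …)` around `b` and a complex valued function `g`, the determinant
of the derivative of `g`, restricted to the plane spanned by `∂/∂y₀`, `∂/∂y₁` at `b`, as a map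
`ℝ² → ℂ = ℝ²`. -/
noncomputable def normalJacobian {m : ℕ} {N : Type*} [TopologicalSpace N]
    (ψ : OpenPartialHomeomorph N (EuclideanSpace ℝ (Fin (m + 2)))) (g : N → ℂ) (b : N) : ℝ :=
  let D := fderiv ℝ (fun a => g (ψ.symm a)) (ψ b)
  (conj (D (EuclideanSpace.single 0 1)) * D (EuclideanSpace.single 1 1)).im

/-- An oriented (embedded) submanifold of codimension two of an `(m + 2)`-dimensional manifold `N`.
It is given by a subset together with slice charts `ψ = (y₀, y₁, y₂, …)` of `N` covering it, in
which the subset is `{y₀ = y₁ = 0}`. The slice charts orient the normal bundle, by declaring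
`∂/∂y₀, ∂/∂y₁` to be a positive normal frame, and are required to agree on this. When `N` is
oriented, orienting the normal bundle is the same as orienting the submanifold itself (by the
convention "normal orientation followed by tangential orientation"; if `m = 0` this is a sign at
every point). -/
structure OrientedCodimTwoSubmanifold (m : ℕ) (N : Type*) [TopologicalSpace N]
    [ChartedSpace (EuclideanSpace ℝ (Fin (m + 2))) N] where
  carrier : Set N
  sliceCharts : Set (OpenPartialHomeomorph N (EuclideanSpace ℝ (Fin (m + 2))))
  smooth : ∀ ψ ∈ sliceCharts, ψ ∈ IsManifold.maximalAtlas (𝓡 (m + 2)) ∞ N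
  cover : ∀ b ∈ carrier, ∃ ψ ∈ sliceCharts, b ∈ ψ.source
  slice : ∀ ψ ∈ sliceCharts, ∀ x ∈ ψ.source, x ∈ carrier ↔ ψ x 0 = 0 ∧ ψ x 1 = 0
  oriented : ∀ ψ ∈ sliceCharts, ∀ ψ' ∈ sliceCharts, ∀ b ∈ carrier, b ∈ ψ.source → b ∈ ψ'.source →
    0 < normalJacobian ψ (fun x => (⟨ψ' x 0, ψ' x 1⟩ : ℂ)) b

/-- `κ : M → N` is a two-fold cover with branch locus `B`. -/
structure IsTwoFoldCover {m : ℕ} {M : Type*} {N : Type*} [TopologicalSpace M] [TopologicalSpace N]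
    [ChartedSpace (EuclideanSpace ℝ (Fin (m + 2))) M]
    [ChartedSpace (EuclideanSpace ℝ (Fin (m + 2))) N]
    (κ : M → N) (B : OrientedCodimTwoSubmanifold m N) : Prop where
  smooth : ContMDiff (𝓡 (m + 2)) (𝓡 (m + 2)) ∞ κ
  /-- The set of critical values is `B`. -/
  criticalValues : ∀ y : N, y ∈ B.carrier ↔
    ∃ p : M, κ p = y ∧ ¬ Function.Surjective (mfderiv (𝓡 (m + 2)) (𝓡 (m + 2)) κ p)
  /-- The degree is two: the fibre over a regular value has two elements, … -/
  fiber_card : ∀ y : N, y ∉ B.carrier → (κ ⁻¹' {y}).ncard = 2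
  /-- … and both of them count with sign `+1`. -/
  orientation : ∀ p : M, κ p ∉ B.carrier →
    0 < chartJacobian (chartAt (EuclideanSpace ℝ (Fin (m + 2))) p)
      (chartAt (EuclideanSpace ℝ (Fin (m + 2))) (κ p)) κ p
  /-- Along `B` there are oriented local coordinates `x` of `M` and `y` of `N` in which
  `y₀ + i y₁ = (x₀ + i x₁)²` and `yⱼ = xⱼ` for `j ≥ 2`. -/
  localModel : ∀ p : M, κ p ∈ B.carrier →
    ∃ (φ : OpenPartialHomeomorph M (EuclideanSpace ℝ (Fin (m + 2))))
      (ψ : OpenPartialHomeomorph N (EuclideanSpace ℝ (Fin (m + 2)))),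
      IsOrientedChart φ ∧ IsOrientedChart ψ ∧ p ∈ φ.source ∧
      ∀ q ∈ φ.source, κ q ∈ ψ.source ∧
        ψ (κ q) 0 = φ q 0 ^ 2 - φ q 1 ^ 2 ∧
        ψ (κ q) 1 = 2 * φ q 0 * φ q 1 ∧
        ∀ j : Fin m, ψ (κ q) j.succ.succ = φ q j.succ.succ

/-- A smooth complex line bundle over a smooth manifold `N` of dimension `n`: a fibre bundle with
model fibre `ℂ` and `ℂ`-linear trivializations, whose transition functions are smooth (as maps
from the real manifold `N`). The field `realVectorBundle` is implied by `complexVectorBundle`; it is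
what the notion of smoothness over a real manifold refers to. -/
structure ComplexLineBundle (n : ℕ) (N : Type u) [TopologicalSpace N]
    [ChartedSpace (EuclideanSpace ℝ (Fin n)) N] where
  Fiber : N → Type v
  [addCommGroup : ∀ x, AddCommGroup (Fiber x)]
  [module : ∀ x, Module ℂ (Fiber x)]
  [topologyFiber : ∀ x, TopologicalSpace (Fiber x)]
  [topologyTotal : TopologicalSpace (TotalSpace ℂ Fiber)]
  [fiberBundle : FiberBundle ℂ Fiber]
  [complexVectorBundle : VectorBundle ℂ ℂ Fiber]
  [realVectorBundle : VectorBundle ℝ ℂ Fiber]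
  [smooth : ContMDiffVectorBundle ∞ ℂ Fiber (𝓡 n)]

namespace ComplexLineBundle

attribute [instance] addCommGroup module topologyFiber topologyTotal fiberBundle
  complexVectorBundle realVectorBundle smooth

section

variable {n : ℕ} {N : Type u} [TopologicalSpace N] [ChartedSpace (EuclideanSpace ℝ (Fin n)) N]

/-- The total space of the line bundle `L`, a smooth manifold of (real) dimension `n + 2`. -/
abbrev Total (L : ComplexLineBundle.{u, v} n N) : Type (max u v) := TotalSpace ℂ L.Fiber

/-- The fibre of `L ⊗ L` at `x`. -/
abbrev SqFiber (L : ComplexLineBundle.{u, v} n N) (x : N) : Type v := L.Fiber x ⊗[ℂ] L.Fiber x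

/-- The local trivialization of `L ⊗ L` induced by a local trivialization `e` of `L`: over
`e.baseSet`, it is the linear isomorphism from the fibre at `x` to `ℂ` that sends `a ⊗ b` to
`e a * e b`. -/
noncomputable def sqCoord (L : ComplexLineBundle.{u, v} n N)
    (e : Trivialization ℂ (TotalSpace.proj : L.Total → N)) [MemTrivializationAtlas e] (x : N) :
    L.SqFiber x →ₗ[ℂ] ℂ :=
  LinearMap.mul' ℂ ℂ ∘ₗ TensorProduct.map (e.linearMapAt ℂ x) (e.linearMapAt ℂ x)

/-- A section of `L ⊗ L` is smooth if it is so in the local trivializations. -/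
def IsSmoothSqSection (L : ComplexLineBundle.{u, v} n N) (s : ∀ x, L.SqFiber x) : Prop :=
  ∀ (e : Trivialization ℂ (TotalSpace.proj : L.Total → N)) [MemTrivializationAtlas e],
    ContMDiffOn (𝓡 n) 𝓘(ℝ, ℂ) ∞ (fun x => L.sqCoord e x (s x)) e.baseSet

/-- A smooth section of `L ⊗ L` is transverse (to the zero section) if at each of its zeros its
derivative, in a local trivialization, is surjective. -/
def IsTransverseSqSection (L : ComplexLineBundle.{u, v} n N) (s : ∀ x, L.SqFiber x) : Prop :=
  L.IsSmoothSqSection s ∧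
    ∀ (e : Trivialization ℂ (TotalSpace.proj : L.Total → N)) [MemTrivializationAtlas e],
      ∀ x ∈ e.baseSet, s x = 0 →
        Function.Surjective (mfderiv (𝓡 n) 𝓘(ℝ, ℂ) (fun y => L.sqCoord e y (s y)) x)

/-- The subset `M_{L,s} = {t ∈ L : t² = s}` of the total space of `L`, where `t² = t ⊗ t`. -/
def branchedCover (L : ComplexLineBundle.{u, v} n N) (s : ∀ x, L.SqFiber x) : Set L.Total :=
  {t | t.2 ⊗ₜ[ℂ] t.2 = s t.1}

/-- `f` identifies `κ : M → N` with `M_{L,s} → N`: it is a diffeomorphism of `M` with the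
submanifold `M_{L,s}` of the total space of `L` (i.e. a smooth embedding with image `M_{L,s}`) over
`N`. -/
structure IsDiffeoOver {M : Type*} [TopologicalSpace M] [ChartedSpace (EuclideanSpace ℝ (Fin n)) M]
    (κ : M → N) (L : ComplexLineBundle.{u, v} n N) (s : ∀ x, L.SqFiber x) (f : M → L.Total) :
    Prop where
  isSmoothEmbedding : IsSmoothEmbedding (𝓡 n) ((𝓡 n).prod 𝓘(ℝ, ℂ)) ∞ f
  range_eq : Set.range f = L.branchedCover s
  proj_comp : ∀ p, (f p).proj = κ p

/-- The map of total spaces defined by a family of linear isomorphisms of the fibres. -/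
def totalMap {L : ComplexLineBundle.{u, v} n N} {L' : ComplexLineBundle.{u, w} n N}
    (Φ : ∀ x, L.Fiber x ≃ₗ[ℂ] L'.Fiber x) (t : L.Total) : L'.Total := ⟨t.1, Φ t.1 t.2⟩

/-- A family of complex linear isomorphisms of the fibres is an isomorphism of smooth line bundles
over `N` if it is smooth in both directions. -/
def IsSmoothIso {L : ComplexLineBundle.{u, v} n N} {L' : ComplexLineBundle.{u, w} n N}
    (Φ : ∀ x, L.Fiber x ≃ₗ[ℂ] L'.Fiber x) : Prop :=
  ContMDiff ((𝓡 n).prod 𝓘(ℝ, ℂ)) ((𝓡 n).prod 𝓘(ℝ, ℂ)) ∞ (totalMap Φ) ∧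
    ContMDiff ((𝓡 n).prod 𝓘(ℝ, ℂ)) ((𝓡 n).prod 𝓘(ℝ, ℂ)) ∞ (totalMap fun x => (Φ x).symm)

end

/-- The zero locus of the section `s` of `L ⊗ L` is `B`, as an oriented submanifold: the zero set is
`B`, and the derivative of `s`, which identifies the normal spaces of `B` with the fibres of
`L ⊗ L`, is compatible with the orientations. -/
def HasZeroLocus {m : ℕ} {N : Type u} [TopologicalSpace N]
    [ChartedSpace (EuclideanSpace ℝ (Fin (m + 2))) N] (L : ComplexLineBundle.{u, v} (m + 2) N)
    (s : ∀ x, L.SqFiber x) (B : OrientedCodimTwoSubmanifold m N) : Prop :=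
  (∀ x, s x = 0 ↔ x ∈ B.carrier) ∧
    ∀ (e : Trivialization ℂ (TotalSpace.proj : L.Total → N)) [MemTrivializationAtlas e],
      ∀ ψ ∈ B.sliceCharts, ∀ b ∈ B.carrier, b ∈ ψ.source → b ∈ e.baseSet →
        0 < normalJacobian ψ (fun x => L.sqCoord e x (s x)) b

end ComplexLineBundle

/-!
# Two-fold covers with branch locus and square roots of sections of line bundles

Locally over `N`, the fibre coordinate of `M_{L,s} ⊆ L` is a function `t` on the part of `M` over an
open set `U ⊆ N`, whose square descends to a smooth function `σ` on `U` (the coordinate of `s`) with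
oriented zero locus `B`, and which separates the points of the fibres of `κ`. Such functions are
called *branch roots* (`IsBranchRoot`). Both halves of the proposition follow from one fact about
them: the ratio of two branch roots descends to a smooth nonvanishing function on `N`
(`IsBranchRoot.exists_ratio`), and this function is unique, since `B` has dense complement.

Away from `B` the ratio is smooth because `κ` is a local diffeomorphism there, and it descends
because a root changes sign between the two sheets. Near `B` there are coordinates in which `κ` is
`(z, w) ↦ (z², w)`, and every branch root has to be compared with `z`. If `t² = σ(z², w)`, then
`∂σ/∂ζ ≠ 0`, because `σ` cuts out `B` with the same orientation as `ζ = z²` does, and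
differentiating with respect to `z` gives `t = z · (∂σ/∂ζ)(z², w) / (∂t/∂z)`. So `σ(z², w)` is
a smooth multiple of `z`, and therefore `σ` itself is a smooth multiple `ζ g` of `ζ`
(`exists_eq_fst_mul_of_foldMap`). Then `(t / z)² = g(z², w)` with `g ≠ 0`, and `t / z` is one of the
two smooth square roots of `g`, evaluated at `(z², w)` (`exists_eq_fst_mul_foldMap_of_sq`).
Divisibility by `ζ` uses Hadamard's lemma `σ = ζ a + ζ̄ b`: the Wirtinger derivatives `∂/∂z̄` show that `b`
vanishes for `ζ = 0`, so that the argument can be repeated with `b`, and `σ` is a multiple of `ζ` up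
to `ζ̄ᵏ b'`, whose quotient by `ζ` is of class `C^(k-2)`.

For the uniqueness of `(L, s)`, the isomorphism is multiplication by the ratio of the branch roots
given by `f` and `f'` in local trivializations (`ComplexLineBundle.existsUnique_isomorphism`).

For the existence, branch roots exist locally (`exists_isBranchRoot`): the coordinate `z` near `B`,
or its conjugate if `B` carries the opposite orientation, and `± 1` on the two sheets elsewhere. Their
ratios satisfy the cocycle condition and are the transition functions of `L`; the `σ` are the
coordinates of `s`, and the `t` are the fibre coordinates of `M → L` (`BranchRootAtlas`). This
map is an embedding since its image is locally a slice: near `B` it is the graph `ζ = τ²`, where `τ` is the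
fibre coordinate of `L`, and elsewhere the graph of a branch root on one of the sheets.
-/

/-! ### Smooth dependence of integrals on parameters -/

open MeasureTheory in
theorem hasFDerivAt_intervalIntegral_of_contDiff {H G : Type*} [NormedAddCommGroup H]
    [NormedSpace ℝ H] [FiniteDimensional ℝ H] [NormedAddCommGroup G] [NormedSpace ℝ G]
    [CompleteSpace G] {F : H × ℝ → G} (hF : ContDiff ℝ 1 F) (x : H) :
    HasFDerivAt (fun x => ∫ t in (0 : ℝ)..1, F (x, t))
      (∫ t in (0 : ℝ)..1, (fderiv ℝ F (x, t)).comp (ContinuousLinearMap.inl ℝ H ℝ)) x := by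
  have hF' : Continuous fun p : H × ℝ => (fderiv ℝ F p).comp (ContinuousLinearMap.inl ℝ H ℝ) :=
    (hF.continuous_fderiv one_ne_zero).clm_comp continuous_const
  obtain ⟨C, hC⟩ := ((isCompact_closedBall x 1).prod
    (isCompact_Icc (a := (0 : ℝ)) (b := 1))).exists_bound_of_continuousOn hF'.continuousOn
  refine (intervalIntegral.hasFDerivAt_integral_of_dominated_of_fderiv_le
    (F' := fun y t => (fderiv ℝ F (y, t)).comp (ContinuousLinearMap.inl ℝ H ℝ))
    (bound := fun _ => C) (Metric.ball_mem_nhds x one_pos) ?_ ?_ ?_ ?_ ?_ ?_)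
  · exact Filter.Eventually.of_forall fun y =>
      (hF.continuous.comp (by fun_prop : Continuous fun t : ℝ => (y, t))).aestronglyMeasurable
  · exact (hF.continuous.comp (by fun_prop : Continuous fun t : ℝ => (x, t))).intervalIntegrable _ _
  · exact (hF'.comp (by fun_prop : Continuous fun t : ℝ => (x, t))).aestronglyMeasurable
  · refine Filter.Eventually.of_forall fun t ht y hy =>
      hC (y, t) ⟨Metric.ball_subset_closedBall hy, ?_⟩
    rw [Set.uIoc_of_le zero_le_one] at ht
    exact ⟨ht.1.le, ht.2⟩
  · exact intervalIntegrable_const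
  · refine Filter.Eventually.of_forall fun t _ y _ => ?_
    have h1 : HasFDerivAt F (fderiv ℝ F (y, t)) (y, t) :=
      (hF.differentiable one_ne_zero _).hasFDerivAt
    have h2 : HasFDerivAt (fun y : H => (y, t)) (ContinuousLinearMap.inl ℝ H ℝ) y :=
      (hasFDerivAt_id y).prodMk (hasFDerivAt_const t y)
    exact h1.comp y h2

/-- Differentiation under the integral sign, iterated. -/
theorem contDiff_intervalIntegral_of_contDiff {H : Type u} [NormedAddCommGroup H]
    [NormedSpace ℝ H] [FiniteDimensional ℝ H] (n : ℕ) :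
    ∀ {G : Type u} [NormedAddCommGroup G] [NormedSpace ℝ G] [CompleteSpace G] {F : H × ℝ → G},
      ContDiff ℝ n F → ContDiff ℝ n fun x => ∫ t in (0 : ℝ)..1, F (x, t) := by
  induction n with
  | zero =>
    intro G _ _ _ F hF
    have hF : Continuous F := hF.continuous
    exact contDiff_zero.2 (intervalIntegral.continuous_parametric_intervalIntegral_of_continuous'
      (f := fun x t => F (x, t)) hF 0 1)
  | succ n ih =>
    intro G _ _ _ F hF
    have h1 : ContDiff ℝ 1 F := hF.of_le (by norm_cast; omega)
    refine contDiff_succ_iff_hasFDerivAt.2 ⟨_, ?_, hasFDerivAt_intervalIntegral_of_contDiff h1⟩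
    exact ih (F := fun p => (fderiv ℝ F p).comp (ContinuousLinearMap.inl ℝ H ℝ))
      ((hF.fderiv_right (by norm_cast)).clm_comp contDiff_const)

/-! ### Wirtinger derivatives -/

section Wirtinger

variable {W : Type} [NormedAddCommGroup W] [NormedSpace ℝ W]

/-- The Wirtinger derivative `∂f/∂z` of a function on `ℂ × W` in the first variable. -/
noncomputable def wirtinger (f : ℂ × W → ℂ) (p : ℂ × W) : ℂ :=
  (fderiv ℝ f p (1, 0) - Complex.I * fderiv ℝ f p (Complex.I, 0)) / 2

/-- The Wirtinger derivative `∂f/∂z̄` of a function on `ℂ × W` in the first variable. -/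
noncomputable def wirtingerBar (f : ℂ × W → ℂ) (p : ℂ × W) : ℂ :=
  (fderiv ℝ f p (1, 0) + Complex.I * fderiv ℝ f p (Complex.I, 0)) / 2

/-- The branched double cover `(z, w) ↦ (z², w)` of `ℂ × W`. -/
def foldMap (p : ℂ × W) : ℂ × W := (p.1 ^ 2, p.2)

omit [NormedAddCommGroup W] [NormedSpace ℝ W] in
@[simp] theorem foldMap_fst (p : ℂ × W) : (foldMap p).1 = p.1 ^ 2 := rfl
omit [NormedAddCommGroup W] [NormedSpace ℝ W] in
@[simp] theorem foldMap_snd (p : ℂ × W) : (foldMap p).2 = p.2 := rfl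

theorem dense_setOf_fst_ne_zero {W : Type} [TopologicalSpace W] :
    Dense {p : ℂ × W | p.1 ≠ 0} := by
  have : {p : ℂ × W | p.1 ≠ 0} = {z : ℂ | z ≠ 0} ×ˢ Set.univ := by ext; simp
  rw [this]
  exact (dense_compl_singleton (0 : ℂ)).prod dense_univ

theorem contDiff_foldMap : ContDiff ℝ ∞ (foldMap : ℂ × W → ℂ × W) := by
  unfold foldMap; fun_prop

theorem clm_apply_fst (L : ℂ × W →L[ℝ] ℂ) (v : ℂ) :
    L (v, 0) = v * ((L (1, 0) - Complex.I * L (Complex.I, 0)) / 2)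
      + conj v * ((L (1, 0) + Complex.I * L (Complex.I, 0)) / 2) := by
  have h : ((v, 0) : ℂ × W) = v.re • ((1, 0) : ℂ × W) + v.im • ((Complex.I, 0) : ℂ × W) := by
    ext <;> simp
  have e1 : v = v.re + v.im * Complex.I := (Complex.re_add_im v).symm
  have e2 : conj v = v.re - v.im * Complex.I := by
    apply Complex.ext <;> simp
  rw [h, map_add, map_smul, map_smul, e2]
  nth_rw 3 [e1]
  simp only [Complex.real_smul]
  linear_combination ((v.im : ℂ) * L (Complex.I, 0)) * Complex.I_sq

theorem fderiv_apply_fst (f : ℂ × W → ℂ) (p : ℂ × W) (v : ℂ) :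
    fderiv ℝ f p (v, 0) = v * wirtinger f p + conj v * wirtingerBar f p :=
  clm_apply_fst _ v

theorem contDiffOn_wirtinger {f : ℂ × W → ℂ} {U : Set (ℂ × W)} (hU : IsOpen U)
    (hf : ContDiffOn ℝ ∞ f U) : ContDiffOn ℝ ∞ (wirtinger f) U := by
  have h := hf.fderiv_of_isOpen hU (m := ∞) (by simp)
  unfold wirtinger
  exact ((h.clm_apply contDiffOn_const).sub
    (contDiffOn_const.mul (h.clm_apply contDiffOn_const))).div_const 2

theorem contDiff_wirtinger {f : ℂ × W → ℂ} (hf : ContDiff ℝ ∞ f) :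
    ContDiff ℝ ∞ (wirtinger f) :=
  contDiffOn_univ.1 (contDiffOn_wirtinger isOpen_univ hf.contDiffOn)

theorem contDiff_wirtingerBar {f : ℂ × W → ℂ} (hf : ContDiff ℝ ∞ f) :
    ContDiff ℝ ∞ (wirtingerBar f) := by
  have h := hf.fderiv_right (m := ∞) (by simp)
  unfold wirtingerBar
  exact ((h.clm_apply contDiff_const).add
    (contDiff_const.mul (h.clm_apply contDiff_const))).div_const 2

theorem wirtinger_mul {f g : ℂ × W → ℂ} {p : ℂ × W} (hf : DifferentiableAt ℝ f p)
    (hg : DifferentiableAt ℝ g p) :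
    wirtinger (fun p => f p * g p) p = wirtinger f p * g p + f p * wirtinger g p := by
  simp only [wirtinger, fderiv_fun_mul hf hg, add_apply,
    smul_apply, smul_eq_mul]
  ring

theorem wirtingerBar_mul {f g : ℂ × W → ℂ} {p : ℂ × W} (hf : DifferentiableAt ℝ f p)
    (hg : DifferentiableAt ℝ g p) :
    wirtingerBar (fun p => f p * g p) p = wirtingerBar f p * g p + f p * wirtingerBar g p := by
  simp only [wirtingerBar, fderiv_fun_mul hf hg, add_apply,
    smul_apply, smul_eq_mul]
  ring

theorem wirtinger_congr {f g : ℂ × W → ℂ} {p : ℂ × W} (h : f =ᶠ[𝓝 p] g) :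
    wirtinger f p = wirtinger g p := by
  rw [wirtinger, wirtinger, h.fderiv_eq]

theorem wirtinger_fst (p : ℂ × W) : wirtinger (fun p : ℂ × W => p.1) p = 1 := by
  simp [wirtinger, fderiv_fst]

theorem wirtingerBar_fst (p : ℂ × W) : wirtingerBar (fun p : ℂ × W => p.1) p = 0 := by
  simp [wirtingerBar, fderiv_fst]

theorem hasFDerivAt_conj_fst (p : ℂ × W) : HasFDerivAt (fun p : ℂ × W => conj p.1)
    ((Complex.conjCLE : ℂ →L[ℝ] ℂ).comp (ContinuousLinearMap.fst ℝ ℂ W)) p :=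
  ((Complex.conjCLE : ℂ →L[ℝ] ℂ).comp (ContinuousLinearMap.fst ℝ ℂ W)).hasFDerivAt

theorem wirtingerBar_conj_fst (p : ℂ × W) :
    wirtingerBar (fun p : ℂ × W => conj p.1) p = 1 := by
  simp [wirtingerBar, (hasFDerivAt_conj_fst p).fderiv]

theorem contDiff_conj_fst : ContDiff ℝ ∞ fun p : ℂ × W => conj p.1 :=
  ((Complex.conjCLE : ℂ →L[ℝ] ℂ).comp (ContinuousLinearMap.fst ℝ ℂ W)).contDiff

theorem wirtingerBar_conj_fst_pow (n : ℕ) (p : ℂ × W) :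
    wirtingerBar (fun p : ℂ × W => conj p.1 ^ (n + 1)) p = (n + 1) * conj p.1 ^ n := by
  have h : Differentiable ℝ fun p : ℂ × W => conj p.1 :=
    contDiff_conj_fst.differentiable (by simp)
  induction n with
  | zero => simpa using wirtingerBar_conj_fst p
  | succ n ih =>
    simp_rw [pow_succ _ (n + 1)]
    rw [wirtingerBar_mul (f := fun p : ℂ × W => conj p.1 ^ (n + 1)) ((h.pow _) p) (h p), ih,
      wirtingerBar_conj_fst]
    push_cast
    ring

theorem hasFDerivAt_foldMap (p : ℂ × W) : HasFDerivAt (foldMap : ℂ × W → ℂ × W)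
    (((2 * p.1) • ContinuousLinearMap.fst ℝ ℂ W).prod (ContinuousLinearMap.snd ℝ ℂ W)) p := by
  refine HasFDerivAt.prodMk ?_ hasFDerivAt_snd
  simpa using (hasFDerivAt_fst (𝕜 := ℝ) (p := p)).pow 2

theorem wirtinger_comp_foldMap {s : ℂ × W → ℂ} {p : ℂ × W}
    (hs : DifferentiableAt ℝ s (foldMap p)) :
    wirtinger (fun p => s (foldMap p)) p = 2 * p.1 * wirtinger s (foldMap p) := by
  have key : ∀ v : ℂ, fderiv ℝ (fun p => s (foldMap p)) p (v, 0)
      = fderiv ℝ s (foldMap p) (2 * p.1 * v, 0) := by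
    intro v
    have := (hs.hasFDerivAt.comp p (hasFDerivAt_foldMap p)).fderiv
    change fderiv ℝ (s ∘ foldMap) p (v, 0) = _
    rw [this]
    simp
  rw [wirtinger, key, key, fderiv_apply_fst, fderiv_apply_fst]
  simp only [map_mul, Complex.conj_I, map_one]
  linear_combination (-(p.1 * wirtinger s (foldMap p)) +
    conj 2 * conj p.1 / 2 * wirtingerBar s (foldMap p)) * Complex.I_sq

end Wirtinger

/-! ### Division by the normal coordinate -/

section Division

variable {W : Type} [NormedAddCommGroup W] [NormedSpace ℝ W]

/-- Hadamard's lemma in the direction of `ℂ`. -/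
theorem exists_contDiff_of_eq_zero [FiniteDimensional ℝ W] {s : ℂ × W → ℂ} (hs : ContDiff ℝ ∞ s)
    (h0 : ∀ w, s (0, w) = 0) :
    ∃ a b : ℂ × W → ℂ, ContDiff ℝ ∞ a ∧ ContDiff ℝ ∞ b ∧
      ∀ p, s p = p.1 * a p + conj p.1 * b p := by
  have hg : ContDiff ℝ ∞ fun q : (ℂ × W) × ℝ => ((q.2 : ℂ) * q.1.1, q.1.2) :=
    (((Complex.ofRealCLM.contDiff.comp contDiff_snd).mul
      (contDiff_fst.comp contDiff_fst))).prodMk (contDiff_snd.comp contDiff_fst)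
  have int {f : ℂ × W → ℂ} (hf : ContDiff ℝ ∞ f) :
      ContDiff ℝ ∞ fun p : ℂ × W => ∫ t in (0 : ℝ)..1, f (t * p.1, p.2) :=
    contDiff_infty.2 fun n => contDiff_intervalIntegral_of_contDiff n
      (F := fun q : (ℂ × W) × ℝ => f ((q.2 : ℂ) * q.1.1, q.1.2))
      ((hf.comp hg).of_le (by exact_mod_cast le_top))
  refine ⟨_, _, int (contDiff_wirtinger hs), int (contDiff_wirtingerBar hs), fun p => ?_⟩
  have hc : ∀ {f : ℂ × W → ℂ}, ContDiff ℝ ∞ f →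
      Continuous fun t : ℝ => f ((t : ℂ) * p.1, p.2) := fun hf =>
    hf.continuous.comp (by fun_prop)
  have hder : ∀ t : ℝ, HasDerivAt (fun t : ℝ => s ((t : ℂ) * p.1, p.2))
      (p.1 * wirtinger s (t * p.1, p.2) + conj p.1 * wirtingerBar s (t * p.1, p.2)) t := by
    intro t
    have h1 : HasDerivAt (fun t : ℝ => ((t : ℂ) * p.1, p.2)) (p.1, (0 : W)) t := by
      refine HasDerivAt.prodMk ?_ (hasDerivAt_const _ _)
      simpa using (Complex.ofRealCLM.hasDerivAt (x := t)).mul_const p.1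
    have h2 := ((hs.differentiable (by simp) _).hasFDerivAt).comp_hasDerivAt t h1
    rwa [fderiv_apply_fst] at h2
  have hftc := intervalIntegral.integral_eq_sub_of_hasDerivAt (a := 0) (b := 1)
    (fun t _ => hder t) ((((hc (contDiff_wirtinger hs)).const_mul _).add
      ((hc (contDiff_wirtingerBar hs)).const_mul _)).intervalIntegrable _ _)
  rw [intervalIntegral.integral_add, intervalIntegral.integral_const_mul,
    intervalIntegral.integral_const_mul] at hftc
  · simpa [h0] using hftc.symm
  · exact ((hc (contDiff_wirtinger hs)).const_mul _).intervalIntegrable _ _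
  · exact ((hc (contDiff_wirtingerBar hs)).const_mul _).intervalIntegrable _ _

theorem wirtingerBar_iterate_fst_mul {c : ℂ × W → ℂ} (hc : ContDiff ℝ ∞ c) (n : ℕ) :
    wirtingerBar^[n] (fun p => p.1 * c p) = fun p => p.1 * (wirtingerBar^[n] c) p := by
  induction n generalizing c with
  | zero => rfl
  | succ n ih =>
    rw [Function.iterate_succ_apply, Function.iterate_succ_apply,
      ← ih (contDiff_wirtingerBar hc)]
    congr 1
    funext p
    rw [wirtingerBar_mul differentiableAt_fst (hc.differentiable (by simp) p), wirtingerBar_fst]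
    ring

theorem wirtingerBar_iterate_conj_pow_mul {f : ℂ × W → ℂ} (hf : ContDiff ℝ ∞ f) (n : ℕ) (w : W) :
    (wirtingerBar^[n] fun p => conj p.1 ^ n * f p) (0, w) = n.factorial * f (0, w) := by
  induction n generalizing f with
  | zero => simp
  | succ n ih =>
    have h1 : wirtingerBar (fun p => conj p.1 ^ (n + 1) * f p) = fun p : ℂ × W =>
        conj p.1 ^ n * ((n + 1) * f p + conj p.1 * wirtingerBar f p) := by
      funext p
      rw [wirtingerBar_mul ((contDiff_conj_fst.pow _).differentiable (by simp) p)
        (hf.differentiable (by simp) p), wirtingerBar_conj_fst_pow]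
      ring
    rw [Function.iterate_succ_apply, h1, ih]
    · simp only [map_zero, zero_mul, add_zero, Nat.factorial_succ]
      push_cast
      ring
    · exact (contDiff_const.mul hf).add (contDiff_conj_fst.mul (contDiff_wirtingerBar hf))

/-- If the pullback of `b` to the double cover, multiplied by `z̄ⁿ`, is a smooth multiple of `z`,
then `b` vanishes on `{ζ = 0}`: apply `∂ⁿ/∂z̄ⁿ`. -/
theorem eq_zero_of_conj_pow_mul_foldMap {b c : ℂ × W → ℂ} (hb : ContDiff ℝ ∞ b)
    (hc : ContDiff ℝ ∞ c) {n : ℕ} (h : ∀ p, conj p.1 ^ n * b (foldMap p) = p.1 * c p) (w : W) :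
    b (0, w) = 0 := by
  have h1 := wirtingerBar_iterate_conj_pow_mul (hb.comp contDiff_foldMap) n w
  have h2 := congrFun (wirtingerBar_iterate_fst_mul hc n) (0, w)
  rw [show (fun p : ℂ × W => conj p.1 ^ n * (b ∘ foldMap) p) = fun p => p.1 * c p from funext h,
    h2] at h1
  have h3 := (mul_eq_zero.1 (h1.symm.trans (zero_mul _))).resolve_left
    (by exact_mod_cast n.factorial_ne_zero)
  simpa [foldMap] using h3

/-- To every finite order in `ζ̄`, the function `s` is divisible by `ζ`. -/
theorem exists_eq_fst_mul_add_conj_pow_mul [FiniteDimensional ℝ W] (k : ℕ) :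
    ∀ {s c : ℂ × W → ℂ} {n : ℕ}, ContDiff ℝ ∞ s → ContDiff ℝ ∞ c →
      (∀ p, conj p.1 ^ n * s (foldMap p) = p.1 * c p) →
      ∃ a b : ℂ × W → ℂ, ContDiff ℝ ∞ a ∧ ContDiff ℝ ∞ b ∧
        ∀ p, s p = p.1 * a p + conj p.1 ^ k * b p := by
  induction k with
  | zero =>
    intro s c n hs _ _
    exact ⟨0, s, contDiff_const, hs, fun p => by simp⟩
  | succ k ih =>
    intro s c n hs hc h
    obtain ⟨a, b, ha, hb, hab⟩ := exists_contDiff_of_eq_zero hs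
      (eq_zero_of_conj_pow_mul_foldMap hs hc h)
    have hc' : ContDiff ℝ ∞ fun p : ℂ × W => c p - conj p.1 ^ n * (p.1 * a (foldMap p)) :=
      hc.sub ((contDiff_conj_fst.pow n).mul (contDiff_fst.mul (ha.comp contDiff_foldMap)))
    obtain ⟨a', b', ha', hb', hab'⟩ := ih (n := n + 2) hb hc' fun p => by
      have := h p
      rw [hab] at this
      simp only [foldMap_fst, map_pow] at this
      linear_combination this
    refine ⟨fun p => a p + conj p.1 * a' p, b', ha.add (contDiff_conj_fst.mul ha'), hb',
      fun p => ?_⟩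
    rw [hab, hab']
    ring

/-- The functions `z̄ᵏ / zˡ` on the plane, with value `0` at the origin, are differentiable of order
about `k - l`. -/
theorem contDiff_conj_pow_div_pow (n : ℕ) : ∀ {k l : ℕ}, l + n + 1 ≤ k →
    ContDiff ℝ n fun z : ℂ => conj z ^ k / z ^ l := by
  have hnorm : ∀ {k l : ℕ}, l ≤ k → ∀ z : ℂ, z ≠ 0 → ‖conj z ^ k / z ^ l‖ = ‖z‖ ^ (k - l) := by
    intro k l h z hz
    rw [norm_div, norm_pow, norm_pow, RCLike.norm_conj, pow_sub₀ _ (norm_ne_zero_iff.2 hz) h]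
    rfl
  induction n with
  | zero =>
    intro k l h
    refine contDiff_zero.2 (continuous_iff_continuousAt.2 fun z => ?_)
    rcases eq_or_ne z 0 with rfl | hz
    · have h0 : Filter.Tendsto (fun z : ℂ => ‖z‖ ^ (k - l)) (𝓝 0) (𝓝 0) := by
        have : Continuous fun z : ℂ => ‖z‖ ^ (k - l) := by fun_prop
        simpa [show k - l ≠ 0 by omega] using this.tendsto 0
      rw [ContinuousAt, map_zero, zero_pow (by omega), zero_div]
      refine squeeze_zero_norm (fun z => ?_) h0
      rcases eq_or_ne z 0 with rfl | hz
      · simp [show k ≠ 0 by omega]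
      · exact (hnorm (by omega) z hz).le
    · exact (Complex.continuous_conj.continuousAt.pow k).div (continuousAt_id.pow l)
        (pow_ne_zero l hz)
  | succ n ih =>
    intro k l h
    obtain ⟨k, rfl⟩ : ∃ k', k = k' + 1 := ⟨k - 1, by omega⟩
    let D : ℂ → ℂ →L[ℝ] ℂ := fun z =>
      ((k + 1 : ℂ) * (conj z ^ k / z ^ l)) • (Complex.conjCLE : ℂ →L[ℝ] ℂ)
        - ((l : ℂ) * (conj z ^ (k + 1) / z ^ (l + 1))) • ContinuousLinearMap.id ℝ ℂ
    refine contDiff_succ_iff_hasFDerivAt.2 ⟨D, ?_, fun z => ?_⟩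
    · exact ((contDiff_const.mul (ih (by omega))).smul contDiff_const).sub
        ((contDiff_const.mul (ih (by omega))).smul contDiff_const)
    · rcases eq_or_ne z 0 with rfl | hz
      · have hD : D 0 = 0 := by
          ext v
          simp [D, show k ≠ 0 by omega]
        rw [hD, hasFDerivAt_iff_isLittleO_nhds_zero]
        simp only [zero_add, map_zero, zero_apply, sub_zero]
        rw [zero_pow (by omega : k + 1 ≠ 0), zero_div]
        simp only [sub_zero]
        refine Asymptotics.IsBigO.trans_isLittleO (g := fun z : ℂ => ‖z‖ ^ (k + 1 - l)) ?_ ?_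
        · refine Asymptotics.IsBigO.of_bound 1 (Filter.Eventually.of_forall fun z => ?_)
          rcases eq_or_ne z 0 with rfl | hz
          · simp
          · rw [hnorm (by omega) z hz]; simp
        · exact Asymptotics.isLittleO_norm_pow_id (by omega)
      · have h1 : HasFDerivAt (fun z : ℂ => conj z) (Complex.conjCLE : ℂ →L[ℝ] ℂ) z :=
          (Complex.conjCLE : ℂ →L[ℝ] ℂ).hasFDerivAt
        have h2 := ((hasDerivAt_pow l z).inv (pow_ne_zero l hz)).complexToReal_fderiv
        have h3 := (h1.pow (k + 1)).mul h2
        refine (h3.congr_fderiv ?_).congr_of_eventuallyEq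
          (Filter.Eventually.of_forall fun z => div_eq_mul_inv _ _)
        ext v
        rcases l with _ | l
        · simp [D, nsmul_eq_mul]
        · simp [D, nsmul_eq_mul]
          field_simp
          ring

/-- A smooth function on `ℂ × W` whose pullback under `(z, w) ↦ (z², w)` is a smooth multiple of `z`
is a smooth multiple of the first coordinate. -/
theorem exists_eq_fst_mul_of_foldMap [FiniteDimensional ℝ W] {s c : ℂ × W → ℂ}
    (hs : ContDiff ℝ ∞ s) (hc : ContDiff ℝ ∞ c) (h : ∀ p, s (foldMap p) = p.1 * c p) :
    ∃ g : ℂ × W → ℂ, ContDiff ℝ ∞ g ∧ ∀ p, s p = p.1 * g p := by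
  have key : ∀ n : ℕ, ∃ g : ℂ × W → ℂ, ContDiff ℝ n g ∧ ∀ p, s p = p.1 * g p := by
    intro n
    obtain ⟨a, b, ha, hb, hab⟩ := exists_eq_fst_mul_add_conj_pow_mul (n + 2) (n := 0) hs hc
      fun p => by rw [pow_zero, one_mul, h]
    refine ⟨fun p => a p + conj p.1 ^ (n + 2) / p.1 ^ 1 * b p,
      (ha.of_le (by exact_mod_cast le_top)).add (((contDiff_conj_pow_div_pow n (by omega)).comp
        contDiff_fst).mul (hb.of_le (by exact_mod_cast le_top))), fun p => ?_⟩
    rw [hab]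
    rcases eq_or_ne p.1 0 with h0 | h0
    · simp [h0]
    · field_simp
  obtain ⟨g, hg, hsg⟩ := key 0
  refine ⟨g, contDiff_infty.2 fun n => ?_, hsg⟩
  obtain ⟨g', hg', hsg'⟩ := key n
  -- two continuous quotients of `s` by the first coordinate agree
  rwa [Continuous.ext_on dense_setOf_fst_ne_zero hg.continuous hg'.continuous fun p hp =>
    mul_left_cancel₀ (show p.1 ≠ 0 from hp) ((hsg p).symm.trans (hsg' p))]

end Division

section LocalDivision

variable {W : Type} [NormedAddCommGroup W] [NormedSpace ℝ W] [FiniteDimensional ℝ W]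

/-- Local version of `exists_eq_fst_mul_of_foldMap`, by multiplication with a bump function. -/
theorem exists_eventually_eq_fst_mul_of_foldMap {w₀ : W} {U O : Set (ℂ × W)} (hU : IsOpen U)
    (hO : IsOpen O) (hO₀ : (0, w₀) ∈ O) {s c : ℂ × W → ℂ}
    (hs : ContDiffOn ℝ ∞ s U) (hc : ContDiffOn ℝ ∞ c O)
    (h : ∀ p ∈ O, foldMap p ∈ U ∧ s (foldMap p) = p.1 * c p) :
    ∃ g : ℂ × W → ℂ, ContDiff ℝ ∞ g ∧ ∀ᶠ p in 𝓝 (0, w₀), s p = p.1 * g p := by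
  have hU₀ : ((0, w₀) : ℂ × W) ∈ U := by simpa [foldMap] using (h _ hO₀).1
  obtain ⟨δ, hδ, hδO⟩ := Metric.isOpen_iff.1 hO _ hO₀
  obtain ⟨ε, hε, hεU⟩ := Metric.isOpen_iff.1 hU _ hU₀
  obtain ⟨r, hr, hrε⟩ := exists_between (show 0 < min ε (min δ (δ ^ 2)) by positivity)
  simp only [lt_min_iff] at hrε
  have hrO : ∀ p : ℂ × W, foldMap p ∈ Metric.closedBall (0, w₀) r → p ∈ O := by
    intro p hp
    apply hδO
    simp only [Metric.mem_closedBall, Prod.dist_eq, foldMap_fst, foldMap_snd, max_le_iff,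
      dist_zero_right, norm_pow, Metric.mem_ball, max_lt_iff] at hp ⊢
    exact ⟨lt_of_pow_lt_pow_left₀ 2 hδ.le (hp.1.trans_lt hrε.2.2), hp.2.trans_lt hrε.2.1⟩
  have hrU : Metric.closedBall ((0, w₀) : ℂ × W) r ⊆ U :=
    (Metric.closedBall_subset_ball hrε.1).trans hεU
  let χ : ContDiffBump ((0, w₀) : ℂ × W) := ⟨r / 2, r, by positivity, by linarith⟩
  have hχ : tsupport χ = Metric.closedBall ((0, w₀) : ℂ × W) r := χ.tsupport_eq
  have hχc : ContDiff ℝ ∞ fun p => (χ p : ℂ) := Complex.ofRealCLM.contDiff.comp χ.contDiff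
  have hs' : ContDiff ℝ ∞ fun p => (χ p : ℂ) * s p := by
    refine contDiff_iff_contDiffAt.2 fun p => ?_
    by_cases hp : p ∈ tsupport χ
    · exact hχc.contDiffAt.mul (hs.contDiffAt (hU.mem_nhds (hrU (hχ ▸ hp))))
    · refine contDiffAt_const (c := (0 : ℂ)) |>.congr_of_eventuallyEq ?_
      filter_upwards [notMem_tsupport_iff_eventuallyEq.1 hp] with q hq
      simp [hq]
  have hc' : ContDiff ℝ ∞ fun p => (χ (foldMap p) : ℂ) * c p := by
    refine contDiff_iff_contDiffAt.2 fun p => ?_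
    by_cases hp : foldMap p ∈ tsupport χ
    · exact (hχc.comp contDiff_foldMap).contDiffAt.mul
        (hc.contDiffAt (hO.mem_nhds (hrO p (hχ ▸ hp))))
    · refine contDiffAt_const (c := (0 : ℂ)) |>.congr_of_eventuallyEq ?_
      filter_upwards [contDiff_foldMap.continuous.continuousAt.eventually
        (notMem_tsupport_iff_eventuallyEq.1 hp)] with q hq
      simp [hq]
  obtain ⟨g, hg, hsg⟩ := exists_eq_fst_mul_of_foldMap hs' hc' fun p => by
    by_cases hp : foldMap p ∈ tsupport χ
    · rw [(h p (hrO p (hχ ▸ hp))).2]; ring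
    · simp [image_eq_zero_of_notMem_tsupport hp]
  refine ⟨g, hg, ?_⟩
  filter_upwards [χ.eventuallyEq_one] with p hp
  rw [← hsg]
  simp [hp]

/-- A smooth branch of the square root near a nonzero value. -/
theorem exists_contDiffOn_sqrt {X : Type*} [NormedAddCommGroup X] [NormedSpace ℝ X] {g : X → ℂ}
    (hg : ContDiff ℝ ∞ g) {x₀ : X} {c : ℂ} (hc : c ≠ 0) (hgc : g x₀ = c ^ 2) :
    ∃ V : Set X, IsOpen V ∧ x₀ ∈ V ∧ ∃ ρ : X → ℂ, ContDiffOn ℝ ∞ ρ V ∧ ρ x₀ = c ∧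
      ∀ x ∈ V, ρ x ≠ 0 ∧ ρ x ^ 2 = g x := by
  refine ⟨(fun x => g x / c ^ 2) ⁻¹' Complex.slitPlane,
    Complex.isOpen_slitPlane.preimage (hg.continuous.div_const _), ?_,
    fun x => c * Complex.exp (Complex.log (g x / c ^ 2) / 2), ?_, ?_, fun x hx => ⟨?_, ?_⟩⟩
  · simp [hgc, hc]
  · intro x hx
    refine ContDiffAt.contDiffWithinAt ?_
    have h1 : ContDiffAt ℝ ∞ Complex.log (g x / c ^ 2) :=
      (Complex.contDiffAt_log hx).restrict_scalars ℝ
    have h2 : ContDiffAt ℝ ∞ (fun x => Complex.log (g x / c ^ 2)) x :=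
      h1.comp (f := fun x => g x / c ^ 2) x (hg.contDiffAt.div_const _)
    exact contDiffAt_const.mul (Complex.contDiff_exp.contDiffAt.comp x (h2.div_const 2))
  · simp [hgc, hc]
  · exact mul_ne_zero hc (Complex.exp_ne_zero _)
  · have hx0 : g x / c ^ 2 ≠ 0 := Complex.slitPlane_ne_zero hx
    rw [mul_pow, ← Complex.exp_nat_mul]
    simp only [Nat.cast_ofNat, mul_div_cancel₀ _ (two_ne_zero' ℂ)]
    rw [Complex.exp_log hx0]
    field_simp

/-- If the square of `h` is the pullback under `(z, w) ↦ (z², w)` of a smooth function `s` with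
`∂s/∂ζ ≠ 0`, then `h` is `z` times the pullback of a smooth nonvanishing function.
Differentiating `h² = s(z², w)` gives `h = z · (∂s/∂ζ)(z², w) / (∂h/∂z)`, so that `s` is
divisible by `ζ`, and the quotient has a smooth square root. -/
theorem exists_eq_fst_mul_foldMap_of_sq {w₀ : W} {U O : Set (ℂ × W)} (hU : IsOpen U)
    (hO : IsOpen O) (hO₀ : (0, w₀) ∈ O) {s h : ℂ × W → ℂ}
    (hs : ContDiffOn ℝ ∞ s U) (hh : ContDiffOn ℝ ∞ h O)
    (hsh : ∀ p ∈ O, foldMap p ∈ U ∧ s (foldMap p) = h p ^ 2) (h₀ : h (0, w₀) = 0)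
    (ha : wirtinger s (0, w₀) ≠ 0) :
    ∃ V : Set (ℂ × W), IsOpen V ∧ (0, w₀) ∈ V ∧ ∃ ρ : ℂ × W → ℂ, ContDiffOn ℝ ∞ ρ V ∧
      (∀ p ∈ V, ρ p ≠ 0) ∧ ∀ᶠ p in 𝓝 (0, w₀), h p = p.1 * ρ (foldMap p) := by
  have hfold0 : foldMap ((0, w₀) : ℂ × W) = (0, w₀) := by simp [foldMap]
  have dif {f : ℂ × W → ℂ} {A : Set (ℂ × W)} (hA : IsOpen A) (hf : ContDiffOn ℝ ∞ f A)
      {p : ℂ × W} (hp : p ∈ A) : DifferentiableAt ℝ f p :=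
    (hf.contDiffAt (hA.mem_nhds hp)).differentiableAt (by simp)
  have hws := contDiffOn_wirtinger hU hs
  have hwh := contDiffOn_wirtinger hO hh
  have hwsf : ContDiffOn ℝ ∞ (fun p => wirtinger s (foldMap p)) O :=
    hws.comp contDiff_foldMap.contDiffOn fun p hp => (hsh p hp).1
  -- the derivative of `h² = s ∘ foldMap`
  have e1 : ∀ p ∈ O, p.1 * wirtinger s (foldMap p) = h p * wirtinger h p := by
    intro p hp
    have h1 : (fun p => s (foldMap p)) =ᶠ[𝓝 p] fun p => h p * h p := by
      filter_upwards [hO.mem_nhds hp] with q hq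
      rw [(hsh q hq).2, sq]
    have h2 : wirtinger (fun p => s (foldMap p)) p = wirtinger (fun p => h p * h p) p :=
      wirtinger_congr h1
    rw [wirtinger_comp_foldMap (dif hU hs (hsh p hp).1), wirtinger_mul (dif hO hh hp)
      (dif hO hh hp)] at h2
    linear_combination h2 / 2
  have e2 : wirtinger s (0, w₀) = wirtinger h (0, w₀) ^ 2 := by
    have h1 : (fun p => p.1 * wirtinger s (foldMap p)) =ᶠ[𝓝 (0, w₀)]
        fun p => h p * wirtinger h p := by
      filter_upwards [hO.mem_nhds hO₀] with q hq using e1 q hq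
    have h2 : wirtinger (fun p => p.1 * wirtinger s (foldMap p)) (0, w₀)
        = wirtinger (fun p => h p * wirtinger h p) (0, w₀) := wirtinger_congr h1
    rw [wirtinger_mul differentiableAt_fst (dif hO hwsf hO₀),
      wirtinger_mul (dif hO hh hO₀) (dif hO hwh hO₀), wirtinger_fst, h₀, hfold0] at h2
    linear_combination h2
  have hwh0 : wirtinger h (0, w₀) ≠ 0 := fun h => ha (by rw [e2, h]; ring)
  obtain ⟨O', hO'O, hO', hO'₀⟩ : ∃ O' ⊆ O, IsOpen O' ∧
      (0, w₀) ∈ O' ∧ ∀ p ∈ O', wirtinger h p ≠ 0 := by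
    refine ⟨O ∩ wirtinger h ⁻¹' {0}ᶜ, Set.inter_subset_left,
      hwh.continuousOn.isOpen_inter_preimage hO isOpen_compl_singleton, ⟨hO₀, hwh0⟩,
      fun p hp => hp.2⟩
  let G : ℂ × W → ℂ := fun p => wirtinger s (foldMap p) * (wirtinger h p)⁻¹
  have hG : ContDiffOn ℝ ∞ G O' := (hwsf.mono hO'O).mul ((hwh.mono hO'O).inv hO'₀.2)
  have hG0 : G (0, w₀) ≠ 0 := mul_ne_zero (by rwa [hfold0]) (inv_ne_zero hwh0)
  have hhG : ∀ p ∈ O', h p = p.1 * G p := fun p hp => by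
    have := e1 p (hO'O hp)
    have h0 := hO'₀.2 p hp
    simp only [G]
    field_simp
    exact this.symm
  obtain ⟨g, hg, hsg⟩ := exists_eventually_eq_fst_mul_of_foldMap hU hO' hO'₀.1 hs
    (hG.mul (hh.mono hO'O)) fun p hp => ⟨(hsh p (hO'O hp)).1, by
      rw [(hsh p (hO'O hp)).2, sq]; nth_rw 1 [hhG p hp]; ring⟩
  have hfc : Filter.Tendsto foldMap (𝓝 ((0, w₀) : ℂ × W)) (𝓝 (0, w₀)) := by
    have := (contDiff_foldMap (W := W)).continuous.tendsto (0, w₀)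
    rwa [hfold0] at this
  have hgG : ∀ᶠ p in 𝓝 ((0, w₀) : ℂ × W), g (foldMap p) = G p ^ 2 := by
    obtain ⟨A, hA, hAo, hA0⟩ := eventually_nhds_iff.1
      ((hfc.eventually hsg).and (hO'.mem_nhds hO'₀.1))
    filter_upwards [hAo.mem_nhds hA0] with p hp
    -- the identity holds where `p.1 ≠ 0`, and both sides are continuous
    have hcl : p ∈ closure (A ∩ {p : ℂ × W | p.1 ≠ 0}) := 
      dense_setOf_fst_ne_zero.open_subset_closure_inter hAo hp
    have hne : (𝓝[A ∩ {p : ℂ × W | p.1 ≠ 0}] p).NeBot := mem_closure_iff_nhdsWithin_neBot.1 hcl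
    refine tendsto_nhds_unique_of_eventuallyEq (l := 𝓝[A ∩ {p : ℂ × W | p.1 ≠ 0}] p)
      (((hg.continuous.comp contDiff_foldMap.continuous).tendsto p).mono_left nhdsWithin_le_nhds)
      (((hG.continuousOn.continuousAt (hO'.mem_nhds (hA p hp).2)).pow 2).mono_left
        nhdsWithin_le_nhds) ?_
    filter_upwards [self_mem_nhdsWithin] with q hq
    have h1 := (hA q hq.1).1
    rw [(hsh q (hO'O (hA q hq.1).2)).2, hhG q (hA q hq.1).2, foldMap_fst] at h1
    have hq2 : q.1 ^ 2 ≠ 0 := pow_ne_zero 2 hq.2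
    have h2 : q.1 ^ 2 * g (foldMap q) = q.1 ^ 2 * G q ^ 2 := by linear_combination -h1
    exact mul_left_cancel₀ hq2 h2
  obtain ⟨V, hV, hV0, ρ, hρ, hρ0, hρg⟩ := exists_contDiffOn_sqrt hg hG0
    (by simpa [hfold0] using hgG.self_of_nhds)
  refine ⟨V, hV, hV0, ρ, hρ, fun p hp => (hρg p hp).1, ?_⟩
  have hlim : Filter.Tendsto (fun p => G p + ρ (foldMap p)) (𝓝 (0, w₀))
      (𝓝 (G (0, w₀) + G (0, w₀))) := by
    refine (hG.continuousOn.continuousAt (hO'.mem_nhds hO'₀.1)).tendsto.add ?_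
    have := (hρ.continuousOn.continuousAt (hV.mem_nhds hV0)).tendsto.comp hfc
    rwa [hρ0] at this
  have hne := hlim.eventually_ne (show G (0, w₀) + G (0, w₀) ≠ 0 by
    rw [← two_mul]; exact mul_ne_zero two_ne_zero hG0)
  filter_upwards [hgG, hfc.eventually (hV.mem_nhds hV0), hO'.mem_nhds hO'₀.1, hne] with
    p h1 h2 h3 h4
  rw [hhG p h3]
  congr 1
  have h5 : (G p - ρ (foldMap p)) * (G p + ρ (foldMap p)) = 0 := by
    linear_combination -h1 - (hρg _ h2).2
  exact sub_eq_zero.1 ((mul_eq_zero.1 h5).resolve_right h4)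

end LocalDivision

/-! ### Partial diffeomorphisms -/

section PartialDiffeo

variable {E₁ H₁ X₁ E₂ H₂ X₂ E₃ H₃ X₃ : Type*}
  [NormedAddCommGroup E₁] [NormedSpace ℝ E₁] [TopologicalSpace H₁] [TopologicalSpace X₁]
  [ChartedSpace H₁ X₁] [NormedAddCommGroup E₂] [NormedSpace ℝ E₂] [TopologicalSpace H₂]
  [TopologicalSpace X₂] [ChartedSpace H₂ X₂] [NormedAddCommGroup E₃] [NormedSpace ℝ E₃]
  [TopologicalSpace H₃] [TopologicalSpace X₃] [ChartedSpace H₃ X₃]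
  {I₁ : ModelWithCorners ℝ E₁ H₁} {I₂ : ModelWithCorners ℝ E₂ H₂} {I₃ : ModelWithCorners ℝ E₃ H₃}

/-- A partial homeomorphism between manifolds that is smooth in both directions. -/
def IsPartialDiffeo (I₁ : ModelWithCorners ℝ E₁ H₁) (I₂ : ModelWithCorners ℝ E₂ H₂)
    (e : OpenPartialHomeomorph X₁ X₂) : Prop :=
  ContMDiffOn I₁ I₂ ∞ e e.source ∧ ContMDiffOn I₂ I₁ ∞ e.symm e.target

namespace IsPartialDiffeo

theorem symm {e : OpenPartialHomeomorph X₁ X₂} (h : IsPartialDiffeo I₁ I₂ e) :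
    IsPartialDiffeo I₂ I₁ e.symm := ⟨h.2, h.1⟩

theorem trans {e : OpenPartialHomeomorph X₁ X₂} {e' : OpenPartialHomeomorph X₂ X₃}
    (h : IsPartialDiffeo I₁ I₂ e) (h' : IsPartialDiffeo I₂ I₃ e') :
    IsPartialDiffeo I₁ I₃ (e.trans e') := by
  refine ⟨h'.1.comp (h.1.mono ?_) ?_, h.2.comp (h'.2.mono ?_) ?_⟩
  · rw [OpenPartialHomeomorph.trans_source]; exact Set.inter_subset_left
  · rw [OpenPartialHomeomorph.trans_source]; exact Set.inter_subset_right
  · rw [OpenPartialHomeomorph.trans_target]; exact Set.inter_subset_left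
  · rw [OpenPartialHomeomorph.trans_target]; exact Set.inter_subset_right

theorem restrOpen {e : OpenPartialHomeomorph X₁ X₂} (h : IsPartialDiffeo I₁ I₂ e) {s : Set X₁}
    (hs : IsOpen s) : IsPartialDiffeo I₁ I₂ (e.restrOpen s hs) :=
  ⟨h.1.mono Set.inter_subset_left, h.2.mono (by
    intro x hx
    simp [OpenPartialHomeomorph.restrOpen] at hx
    exact hx.1)⟩

theorem ofSet {s : Set X₁} (hs : IsOpen s) :
    IsPartialDiffeo I₁ I₁ (OpenPartialHomeomorph.ofSet s hs) :=
  ⟨contMDiffOn_id, contMDiffOn_id⟩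

theorem contMDiffAt {e : OpenPartialHomeomorph X₁ X₂} (h : IsPartialDiffeo I₁ I₂ e) {x : X₁}
    (hx : x ∈ e.source) : ContMDiffAt I₁ I₂ ∞ e x :=
  h.1.contMDiffAt (e.open_source.mem_nhds hx)

theorem mdifferentiable {e : OpenPartialHomeomorph X₁ X₂} (h : IsPartialDiffeo I₁ I₂ e) :
    e.MDifferentiable I₁ I₂ :=
  ⟨h.1.mdifferentiableOn (by simp), h.2.mdifferentiableOn (by simp)⟩

theorem of_homeomorph {e : E₁ ≃ₜ E₂} (h : ContDiff ℝ ∞ e) (h' : ContDiff ℝ ∞ e.symm) :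
    IsPartialDiffeo 𝓘(ℝ, E₁) 𝓘(ℝ, E₂) e.toOpenPartialHomeomorph :=
  ⟨h.contMDiff.contMDiffOn, h'.contMDiff.contMDiffOn⟩

theorem of_continuousLinearEquiv (e : E₁ ≃L[ℝ] E₂) :
    IsPartialDiffeo 𝓘(ℝ, E₁) 𝓘(ℝ, E₂) e.toHomeomorph.toOpenPartialHomeomorph :=
  of_homeomorph e.contDiff e.symm.contDiff

end IsPartialDiffeo

/-- The inverse function theorem, as a partial diffeomorphism. -/
theorem exists_isPartialDiffeo_of_det_ne_zero {E : Type*} [NormedAddCommGroup E] [NormedSpace ℝ E]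
    [FiniteDimensional ℝ E] {F : E → E} {O : Set E} (hO : IsOpen O) (hF : ContDiffOn ℝ ∞ F O)
    {x : E} (hx : x ∈ O) (hdet : (fderiv ℝ F x).det ≠ 0) :
    ∃ g : OpenPartialHomeomorph E E, IsPartialDiffeo 𝓘(ℝ, E) 𝓘(ℝ, E) g ∧ x ∈ g.source ∧
      g.source ⊆ O ∧ ⇑g = F := by
  have : CompleteSpace E := FiniteDimensional.complete ℝ E
  let O' : Set E := O ∩ (fun y => (fderiv ℝ F y).det) ⁻¹' {0}ᶜ
  have hO' : IsOpen O' :=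
    (ContinuousLinearMap.continuous_det.comp_continuousOn
      (hF.continuousOn_fderiv_of_isOpen hO (by simp))).isOpen_inter_preimage hO
      isOpen_compl_singleton
  have hdet' : ∀ y ∈ O', (fderiv ℝ F y).det ≠ 0 := fun y hy => hy.2
  have hd : ∀ (y : E) (hy : y ∈ O'), HasFDerivAt F
      (((fderiv ℝ F y).toContinuousLinearEquivOfDetNeZero (hdet' y hy) : E ≃L[ℝ] E) : E →L[ℝ] E) y :=
    fun y hy => by
      rw [ContinuousLinearMap.coe_toContinuousLinearEquivOfDetNeZero]
      exact ((hF.contDiffAt (hO.mem_nhds hy.1)).differentiableAt (by simp)).hasFDerivAt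
  have hx' : x ∈ O' := ⟨hx, hdet⟩
  have hcx := hF.contDiffAt (hO.mem_nhds hx)
  let g₀ := hcx.toOpenPartialHomeomorph F (hd x hx') (by simp)
  refine ⟨g₀.restrOpen O' hO', ⟨?_, ?_⟩,
    ⟨hcx.mem_toOpenPartialHomeomorph_source (hd x hx') (by simp), hx'⟩, fun y hy => hy.2.1, rfl⟩
  · exact (hF.mono fun y hy => hy.2.1).contMDiffOn
  · refine ContDiffOn.contMDiffOn fun y hy => ContDiffAt.contDiffWithinAt ?_
    have hy' := (g₀.restrOpen O' hO').map_target hy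
    exact (g₀.restrOpen O' hO').contDiffAt_symm hy (hd _ hy'.2)
      (hF.contDiffAt (hO.mem_nhds hy'.2.1))

end PartialDiffeo

/-! ### Splitting off two coordinates -/

section Split

variable {m : ℕ}

/-- The linear isomorphism `(x₀, x₁, x₂, …) ↦ (x₀ + i x₁, (x₂, …))`. -/
noncomputable def splitCoord (m : ℕ) :
    EuclideanSpace ℝ (Fin (m + 2)) ≃L[ℝ] ℂ × EuclideanSpace ℝ (Fin m) :=
  LinearEquiv.toContinuousLinearEquiv
    { toFun := fun x => (⟨x 0, x 1⟩, WithLp.toLp 2 fun j => x j.succ.succ)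
      map_add' := fun x y => rfl
      map_smul' := fun c x => Prod.ext (Complex.ext
        (by rw [RingHom.id_apply, Prod.smul_fst, Complex.smul_re]; rfl)
        (by rw [RingHom.id_apply, Prod.smul_fst, Complex.smul_im]; rfl)) rfl
      invFun := fun p => WithLp.toLp 2 (Fin.cons p.1.re (Fin.cons p.1.im p.2))
      left_inv := fun x => by
        ext j
        refine Fin.cases ?_ (fun j => Fin.cases ?_ (fun j => ?_) j) j <;> rfl
      right_inv := fun p => by
        refine Prod.ext (Complex.ext ?_ ?_) ?_
        · rfl
        · rfl
        · rfl }

theorem splitCoord_apply (x : EuclideanSpace ℝ (Fin (m + 2))) :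
    splitCoord m x = (⟨x 0, x 1⟩, WithLp.toLp 2 fun j => x j.succ.succ) := rfl

theorem splitCoord_fst_eq_zero (x : EuclideanSpace ℝ (Fin (m + 2))) :
    (splitCoord m x).1 = 0 ↔ x 0 = 0 ∧ x 1 = 0 := by
  simp [splitCoord_apply, Complex.ext_iff]

end Split

/-! ### Normal Jacobians -/

section NormalJacobian

variable {m : ℕ} {N : Type*} [TopologicalSpace N] [ChartedSpace (EuclideanSpace ℝ (Fin (m + 2))) N]
  [IsManifold (𝓡 (m + 2)) ∞ N]

omit [IsManifold (𝓡 (m + 2)) ∞ N] in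
theorem ContMDiffAt.contDiffAt_comp_symm {E : Type*} [NormedAddCommGroup E] [NormedSpace ℝ E]
    {G : Type*} [NormedAddCommGroup G] [NormedSpace ℝ G] {σ : N → G}
    {Ψ : OpenPartialHomeomorph N E} (hΨ : IsPartialDiffeo (𝓡 (m + 2)) 𝓘(ℝ, E) Ψ) {b : N}
    (hb : b ∈ Ψ.source) (hσ : ContMDiffAt (𝓡 (m + 2)) 𝓘(ℝ, G) ∞ σ b) :
    ContDiffAt ℝ ∞ (fun a => σ (Ψ.symm a)) (Ψ b) := by
  have h1 : ContMDiffAt 𝓘(ℝ, E) (𝓡 (m + 2)) ∞ Ψ.symm (Ψ b) := hΨ.symm.contMDiffAt (Ψ.map_source hb)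
  rw [← contMDiffAt_iff_contDiffAt]
  exact ContMDiffAt.comp (g := σ) (Ψ b) (by rwa [Ψ.left_inv hb]) h1

/-- The normal Jacobian of a function `σ` that vanishes on the slice `{ζ = 0}` of a chart
`Ψ = (ζ, w)` is the normal Jacobian of `ζ`, multiplied by the determinant `|∂σ/∂ζ|² - |∂σ/∂ζ̄|²`. -/
theorem normalJacobian_eq_mul {Ψ : OpenPartialHomeomorph N (ℂ × EuclideanSpace ℝ (Fin m))}
    (hΨ : IsPartialDiffeo (𝓡 (m + 2)) 𝓘(ℝ, ℂ × EuclideanSpace ℝ (Fin m)) Ψ) {b : N}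
    (hb : b ∈ Ψ.source) (hb₀ : (Ψ b).1 = 0) {σ : N → ℂ}
    (hσ : ContMDiffAt (𝓡 (m + 2)) 𝓘(ℝ, ℂ) ∞ σ b) (hσ₀ : ∀ᶠ x in 𝓝 b, (Ψ x).1 = 0 → σ x = 0)
    {ψ : OpenPartialHomeomorph N (EuclideanSpace ℝ (Fin (m + 2)))}
    (hψ : ψ ∈ IsManifold.maximalAtlas (𝓡 (m + 2)) ∞ N) (hbψ : b ∈ ψ.source) :
    normalJacobian ψ σ b =
      (Complex.normSq (wirtinger (fun a => σ (Ψ.symm a)) (Ψ b)) -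
        Complex.normSq (wirtingerBar (fun a => σ (Ψ.symm a)) (Ψ b))) *
      normalJacobian ψ (fun x => (Ψ x).1) b := by
  set S : ℂ × EuclideanSpace ℝ (Fin m) → ℂ := fun a => σ (Ψ.symm a) with hS
  have hψ' : IsPartialDiffeo (𝓡 (m + 2)) (𝓡 (m + 2)) ψ :=
    (IsManifold.mem_maximalAtlas_iff_contMDiffOn ψ).1 hψ
  have hSd : DifferentiableAt ℝ S (Ψ b) :=
    (ContMDiffAt.contDiffAt_comp_symm hΨ hb hσ).differentiableAt (by simp)
  have hTd : DifferentiableAt ℝ (fun a => Ψ (ψ.symm a)) (ψ b) :=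
    (ContMDiffAt.contDiffAt_comp_symm hψ' hbψ (hΨ.contMDiffAt hb)).differentiableAt (by simp)
  set T := fderiv ℝ (fun a => Ψ (ψ.symm a)) (ψ b) with hT
  -- the derivative of `S` vanishes in the directions of the slice
  have hker : ∀ w, fderiv ℝ S (Ψ b) (0, w) = 0 := by
    intro w
    have hline : HasDerivAt (fun t : ℝ => Ψ b + t • ((0 : ℂ), w)) (0, w) 0 := by
      simpa using ((hasDerivAt_id (0 : ℝ)).smul_const ((0 : ℂ), w)).const_add (Ψ b)
    have h1 : HasDerivAt (fun t : ℝ => S (Ψ b + t • ((0 : ℂ), w))) (fderiv ℝ S (Ψ b) (0, w)) 0 := by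
      refine HasFDerivAt.comp_hasDerivAt (l := S) (l' := fderiv ℝ S (Ψ b)) (0 : ℝ) ?_ hline
      simpa using hSd.hasFDerivAt
    have h2 : ∀ᶠ t : ℝ in 𝓝 0, S (Ψ b + t • ((0 : ℂ), w)) = 0 := by
      have hc : Filter.Tendsto (fun t : ℝ => Ψ b + t • ((0 : ℂ), w)) (𝓝 0) (𝓝 (Ψ b)) := by
        simpa using hline.continuousAt.tendsto
      have h3 : ∀ᶠ a in 𝓝 (Ψ b), a.1 = 0 → S a = 0 := by
        filter_upwards [(Ψ.tendsto_symm hb).eventually hσ₀,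
          Ψ.open_target.mem_nhds (Ψ.map_source hb)] with a ha hat h0
        exact ha (by rwa [Ψ.right_inv hat])
      filter_upwards [hc.eventually h3] with t ht
      exact ht (by simp [hb₀])
    exact h1.unique ((hasDerivAt_const (0 : ℝ) (0 : ℂ)).congr_of_eventuallyEq h2)
  have e1 : fderiv ℝ (fun a => (Ψ (ψ.symm a)).1) (ψ b) =
      (ContinuousLinearMap.fst ℝ ℂ _).comp T := (hasFDerivAt_fst.comp (ψ b) hTd.hasFDerivAt).fderiv
  have e2 : fderiv ℝ (fun a => σ (ψ.symm a)) (ψ b) = (fderiv ℝ S (Ψ b)).comp T := by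
    have h1 : HasFDerivAt (fun a => S (Ψ (ψ.symm a))) ((fderiv ℝ S (Ψ b)).comp T) (ψ b) := by
      refine HasFDerivAt.comp (g := S) (ψ b) ?_ hTd.hasFDerivAt
      rw [ψ.left_inv hbψ]
      exact hSd.hasFDerivAt
    refine (h1.congr_of_eventuallyEq ?_).fderiv
    filter_upwards [(ψ.tendsto_symm hbψ).eventually (Ψ.open_source.mem_nhds hb)] with a ha
    rw [hS]
    simp only
    rw [Ψ.left_inv ha]
  have e3 : ∀ v, fderiv ℝ S (Ψ b) (T v) =
      (T v).1 * wirtinger S (Ψ b) + conj (T v).1 * wirtingerBar S (Ψ b) := by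
    intro v
    have : T v = ((T v).1, 0) + (0, (T v).2) := by simp
    rw [this, map_add, hker, add_zero, fderiv_apply_fst]
    simp
  simp only [normalJacobian, e1, e2, ContinuousLinearMap.comp_apply, e3,
    ContinuousLinearMap.coe_fst']
  generalize (T _).1 = x
  generalize (T _).1 = y
  generalize wirtinger S (Ψ b) = a
  generalize wirtingerBar S (Ψ b) = c
  simp only [Complex.normSq_apply, Complex.mul_im, Complex.mul_re, Complex.add_re, Complex.add_im,
    Complex.conj_re, Complex.conj_im, map_add, map_mul]
  ring

end NormalJacobian

section SliceCharts

variable {m : ℕ} {N : Type*} [TopologicalSpace N] [ChartedSpace (EuclideanSpace ℝ (Fin (m + 2))) N]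

omit [ChartedSpace (EuclideanSpace ℝ (Fin (m + 2))) N] in
theorem normalJacobian_slice (ψ : OpenPartialHomeomorph N (EuclideanSpace ℝ (Fin (m + 2)))) {b : N}
    (hb : b ∈ ψ.source) : normalJacobian ψ (fun x => (⟨ψ x 0, ψ x 1⟩ : ℂ)) b = 1 := by
  have h : HasFDerivAt (fun a => (⟨ψ (ψ.symm a) 0, ψ (ψ.symm a) 1⟩ : ℂ))
      ((ContinuousLinearMap.fst ℝ ℂ (EuclideanSpace ℝ (Fin m))).comp
        (splitCoord m).toContinuousLinearMap) (ψ b) := by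
    refine (ContinuousLinearMap.hasFDerivAt _).congr_of_eventuallyEq ?_
    filter_upwards [ψ.open_target.mem_nhds (ψ.map_source hb)] with a ha
    rw [ψ.right_inv ha]
    rfl
  simp [normalJacobian, h.fderiv, splitCoord_apply]

omit [ChartedSpace (EuclideanSpace ℝ (Fin (m + 2))) N] in
theorem normalJacobian_conj (ψ : OpenPartialHomeomorph N (EuclideanSpace ℝ (Fin (m + 2))))
    (g : N → ℂ) (b : N) : normalJacobian ψ (fun x => conj (g x)) b = -normalJacobian ψ g b := by
  have h : fderiv ℝ (fun a => conj (g (ψ.symm a))) (ψ b) =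
      (Complex.conjCLE : ℂ →L[ℝ] ℂ).comp (fderiv ℝ (fun a => g (ψ.symm a)) (ψ b)) :=
    Complex.conjCLE.comp_fderiv (f := fun a => g (ψ.symm a))
  simp only [normalJacobian, h, ContinuousLinearMap.comp_apply]
  simp
  ring

variable [IsManifold (𝓡 (m + 2)) ∞ N]

/-- A chart in which `ψ` is the first coordinates `(x₀ + i x₁, (x₂, …))`. -/
theorem isPartialDiffeo_trans_splitCoord
    {ψ : OpenPartialHomeomorph N (EuclideanSpace ℝ (Fin (m + 2)))}
    (hψ : ψ ∈ IsManifold.maximalAtlas (𝓡 (m + 2)) ∞ N) :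
    IsPartialDiffeo (𝓡 (m + 2)) 𝓘(ℝ, ℂ × EuclideanSpace ℝ (Fin m))
      (ψ.trans (splitCoord m).toHomeomorph.toOpenPartialHomeomorph) :=
  IsPartialDiffeo.trans (I₂ := 𝓡 (m + 2)) ((IsManifold.mem_maximalAtlas_iff_contMDiffOn ψ).1 hψ)
    (IsPartialDiffeo.of_continuousLinearEquiv _)

theorem eventually_normalJacobian_pos
    {ψ : OpenPartialHomeomorph N (EuclideanSpace ℝ (Fin (m + 2)))}
    (hψ : ψ ∈ IsManifold.maximalAtlas (𝓡 (m + 2)) ∞ N) {b : N} (hb : b ∈ ψ.source) {g : N → ℂ}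
    (hg : ContMDiffAt (𝓡 (m + 2)) 𝓘(ℝ, ℂ) ∞ g b) (h : 0 < normalJacobian ψ g b) :
    ∀ᶠ x in 𝓝 b, 0 < normalJacobian ψ g x := by
  have hψ' : IsPartialDiffeo (𝓡 (m + 2)) (𝓡 (m + 2)) ψ :=
    (IsManifold.mem_maximalAtlas_iff_contMDiffOn ψ).1 hψ
  have h1 : ContinuousAt (fderiv ℝ fun a => g (ψ.symm a)) (ψ b) :=
    ((ContMDiffAt.contDiffAt_comp_symm hψ' hb hg).fderiv_right (m := ∞) (by simp)).continuousAt
  have h2 : ContinuousAt (fun x => fderiv ℝ (fun a => g (ψ.symm a)) (ψ x)) b :=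
    ContinuousAt.comp (g := fderiv ℝ fun a => g (ψ.symm a)) h1 (ψ.continuousAt hb)
  have h3 : ContinuousAt (fun x => normalJacobian ψ g x) b := by
    have hv := fun v : EuclideanSpace ℝ (Fin (m + 2)) => h2.clm_apply (continuousAt_const (y := v))
    exact Complex.continuous_im.continuousAt.comp
      ((Complex.continuous_conj.continuousAt.comp (hv _)).mul (hv _))
  exact h3.eventually (lt_mem_nhds h)

namespace OrientedCodimTwoSubmanifold

variable (B : OrientedCodimTwoSubmanifold m N)

omit [IsManifold (𝓡 (m + 2)) ∞ N] in
theorem dense_compl_carrier : Dense B.carrierᶜ := by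
  intro b
  by_cases hb : b ∈ B.carrier
  swap
  · exact subset_closure hb
  obtain ⟨ψ, hψ, hbψ⟩ := B.cover b hb
  let e : EuclideanSpace ℝ (Fin (m + 2)) := EuclideanSpace.single 0 1
  have hc : Filter.Tendsto (fun t : ℝ => ψ b + t • e) (𝓝 0) (𝓝 (ψ b)) := by
    have : Continuous fun t : ℝ => ψ b + t • e := by fun_prop
    simpa using this.tendsto 0
  have hlim : Filter.Tendsto (fun t : ℝ => ψ.symm (ψ b + t • e)) (𝓝[≠] 0) (𝓝 b) :=
    ((ψ.tendsto_symm hbψ).comp hc).mono_left nhdsWithin_le_nhds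
  refine mem_closure_of_tendsto hlim ?_
  filter_upwards [nhdsWithin_le_nhds (hc.eventually (ψ.open_target.mem_nhds (ψ.map_source hbψ))),
    self_mem_nhdsWithin] with t ht ht0 hmem
  have h0 := ((B.slice ψ hψ _ (ψ.map_target ht)).1 hmem).1
  rw [ψ.right_inv ht] at h0
  have h1 := ((B.slice ψ hψ b hbψ).1 hb).1
  apply ht0
  simpa [e, h1] using h0

/-- If `B` is the zero set of the first coordinate `ζ` of a chart, then this coordinate is a local
coordinate of the normal bundle. -/
theorem normalJacobian_fst_ne_zero {Ψ : OpenPartialHomeomorph N (ℂ × EuclideanSpace ℝ (Fin m))}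
    (hΨ : IsPartialDiffeo (𝓡 (m + 2)) 𝓘(ℝ, ℂ × EuclideanSpace ℝ (Fin m)) Ψ)
    (hB : ∀ x ∈ Ψ.source, x ∈ B.carrier ↔ (Ψ x).1 = 0) {b : N} (hb : b ∈ B.carrier)
    (hbΨ : b ∈ Ψ.source) {ψ} (hψ : ψ ∈ B.sliceCharts) (hbψ : b ∈ ψ.source) :
    normalJacobian ψ (fun x => (Ψ x).1) b ≠ 0 := by
  have hη : ContMDiffAt (𝓡 (m + 2)) 𝓘(ℝ, ℂ) ∞ (fun x => (⟨ψ x 0, ψ x 1⟩ : ℂ)) b :=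
    (contDiff_fst.contMDiff.contMDiffAt).comp b
      ((isPartialDiffeo_trans_splitCoord (B.smooth ψ hψ)).contMDiffAt (x := b) (by simpa using hbψ))
  have h := normalJacobian_eq_mul hΨ hbΨ ((hB b hbΨ).1 hb) hη ?_ (B.smooth ψ hψ) hbψ
  · rw [normalJacobian_slice ψ hbψ] at h
    intro h0
    simp [h0] at h
  · filter_upwards [Ψ.open_source.mem_nhds hbΨ, ψ.open_source.mem_nhds hbψ] with x hx hx' hx0
    have := (B.slice ψ hψ x hx').1 ((hB x hx).2 hx0)
    simp [this, Complex.ext_iff]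

/-- Near a point of `B`, the sign of the normal Jacobian depends neither on the point nor on the
slice chart. -/
theorem eventually_normalJacobian_pos {σ : N → ℂ} {b : N} {ψ} (hψ : ψ ∈ B.sliceCharts)
    (hbψ : b ∈ ψ.source) (hσ : ∀ᶠ x in 𝓝 b, ContMDiffAt (𝓡 (m + 2)) 𝓘(ℝ, ℂ) ∞ σ x)
    (hσB : ∀ᶠ x in 𝓝 b, x ∈ B.carrier → σ x = 0) (hpos : 0 < normalJacobian ψ σ b) :
    ∀ᶠ x in 𝓝 b, x ∈ B.carrier → ∀ ψ' ∈ B.sliceCharts, x ∈ ψ'.source →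
      0 < normalJacobian ψ' σ x := by
  filter_upwards [_root_.eventually_normalJacobian_pos (B.smooth ψ hψ) hbψ hσ.self_of_nhds hpos,
    hσ, ψ.open_source.mem_nhds hbψ, hσB.eventually_nhds] with x hx hσx hxψ hσBx hxB ψ' hψ' hxψ'
  have hΨ := isPartialDiffeo_trans_splitCoord (B.smooth ψ hψ)
  have hxΨ : x ∈ (ψ.trans (splitCoord m).toHomeomorph.toOpenPartialHomeomorph).source := by
    simpa using hxψ
  have h0 : ((ψ.trans (splitCoord m).toHomeomorph.toOpenPartialHomeomorph) x).1 = 0 :=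
    (splitCoord_fst_eq_zero _).2 ((B.slice ψ hψ x hxψ).1 hxB)
  have hσ0 : ∀ᶠ y in 𝓝 x,
      ((ψ.trans (splitCoord m).toHomeomorph.toOpenPartialHomeomorph) y).1 = 0 → σ y = 0 := by
    filter_upwards [hσBx, ψ.open_source.mem_nhds hxψ] with y hy hyψ hy0
    exact hy ((B.slice ψ hψ y hyψ).2 ((splitCoord_fst_eq_zero _).1 hy0))
  have e1 := normalJacobian_eq_mul hΨ hxΨ h0 hσx hσ0 (B.smooth ψ hψ) hxψ
  have e2 := normalJacobian_eq_mul hΨ hxΨ h0 hσx hσ0 (B.smooth ψ' hψ') hxψ'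
  have e3 : 0 < normalJacobian ψ' (fun x =>
      ((ψ.trans (splitCoord m).toHomeomorph.toOpenPartialHomeomorph) x).1) x :=
    B.oriented ψ' hψ' ψ hψ x hxB hxψ' hxψ
  have e4 : normalJacobian ψ (fun x =>
      ((ψ.trans (splitCoord m).toHomeomorph.toOpenPartialHomeomorph) x).1) x = 1 :=
    normalJacobian_slice ψ hxψ
  rw [e4, mul_one] at e1
  rw [e2, ← e1]
  exact mul_pos hx e3

end OrientedCodimTwoSubmanifold

end SliceCharts

/-! ### The local structure of a two-fold cover -/

theorem isOpenMap_foldMap {W : Type} [TopologicalSpace W] :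
    IsOpenMap (foldMap : ℂ × W → ℂ × W) := by
  have h : IsOpenMap fun z : ℂ => z ^ 2 := by
    rcases AnalyticOnNhd.is_constant_or_isOpenMap (g := fun z : ℂ => z ^ 2)
      (fun z _ => by fun_prop) with ⟨w, hw⟩ | h
    · have := (hw 0).trans (hw 1).symm
      norm_num at this
    · exact h
  exact h.prodMap IsOpenMap.id

namespace IsTwoFoldCover

variable {m : ℕ} {M N : Type*} [TopologicalSpace M] [TopologicalSpace N]
  [ChartedSpace (EuclideanSpace ℝ (Fin (m + 2))) M]
  [ChartedSpace (EuclideanSpace ℝ (Fin (m + 2))) N]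
  {κ : M → N} {B : OrientedCodimTwoSubmanifold m N}

theorem surjective (hκ : IsTwoFoldCover κ B) : Function.Surjective κ := by
  intro y
  by_cases hy : y ∈ B.carrier
  · obtain ⟨p, hp, -⟩ := (hκ.criticalValues y).1 hy
    exact ⟨p, hp⟩
  · have : (κ ⁻¹' {y}).Nonempty := Set.nonempty_of_ncard_ne_zero (by rw [hκ.fiber_card y hy]; simp)
    exact this

theorem exists_pair (hκ : IsTwoFoldCover κ B) {y : N} (hy : y ∉ B.carrier) :
    ∃ p q, p ≠ q ∧ κ p = y ∧ κ q = y ∧ ∀ r, κ r = y → r = p ∨ r = q := by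
  obtain ⟨p, q, hpq, h⟩ := Set.ncard_eq_two.1 (hκ.fiber_card y hy)
  have h' : ∀ r, κ r = y ↔ r = p ∨ r = q := fun r => by
    simpa using Set.ext_iff.1 h r
  exact ⟨p, q, hpq, (h' p).2 (Or.inl rfl), (h' q).2 (Or.inr rfl), fun r => (h' r).1⟩

theorem eq_or_eq_of_ne (hκ : IsTwoFoldCover κ B) {p q r : M} (hp : κ p ∉ B.carrier) (hpq : p ≠ q)
    (hq : κ q = κ p) (hr : κ r = κ p) : r = p ∨ r = q := by
  obtain ⟨a, b, -, -, -, h⟩ := hκ.exists_pair hp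
  rcases h p rfl with rfl | rfl <;> rcases h q hq with rfl | rfl <;>
    rcases h r hr with rfl | rfl <;>
    simp_all

variable [IsManifold (𝓡 (m + 2)) ∞ M] [IsManifold (𝓡 (m + 2)) ∞ N]

/-- Outside of the branch locus, `κ` is a local diffeomorphism. -/
theorem exists_isPartialDiffeo (hκ : IsTwoFoldCover κ B) {p : M} (hp : κ p ∉ B.carrier) :
    ∃ e : OpenPartialHomeomorph M N, IsPartialDiffeo (𝓡 (m + 2)) (𝓡 (m + 2)) e ∧ p ∈ e.source ∧
      ∀ q ∈ e.source, e q = κ q := by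
  set φ := chartAt (EuclideanSpace ℝ (Fin (m + 2))) p with hφ
  set ψ := chartAt (EuclideanSpace ℝ (Fin (m + 2))) (κ p) with hψ
  have hpφ : p ∈ φ.source := mem_chart_source _ p
  have hpψ : κ p ∈ ψ.source := mem_chart_source _ (κ p)
  have hφd : IsPartialDiffeo (𝓡 (m + 2)) (𝓡 (m + 2)) φ :=
    (IsManifold.mem_maximalAtlas_iff_contMDiffOn φ).1 (IsManifold.chart_mem_maximalAtlas p)
  have hψd : IsPartialDiffeo (𝓡 (m + 2)) (𝓡 (m + 2)) ψ :=
    (IsManifold.mem_maximalAtlas_iff_contMDiffOn ψ).1 (IsManifold.chart_mem_maximalAtlas (κ p))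
  let O : Set (EuclideanSpace ℝ (Fin (m + 2))) := φ.target ∩ φ.symm ⁻¹' (κ ⁻¹' ψ.source)
  have hO : IsOpen O := φ.isOpen_inter_preimage_symm (ψ.open_source.preimage hκ.smooth.continuous)
  have hF : ContDiffOn ℝ ∞ (fun a => ψ (κ (φ.symm a))) O := by
    rw [← contMDiffOn_iff_contDiffOn]
    exact hψd.1.comp (hκ.smooth.comp_contMDiffOn (hφd.2.mono Set.inter_subset_left))
      fun a ha => ha.2
  obtain ⟨g, hg, hpg, hgO, hgF⟩ := exists_isPartialDiffeo_of_det_ne_zero hO hF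
    (x := φ p) ⟨φ.map_source hpφ, by simpa [φ.left_inv hpφ] using hpψ⟩ (hκ.orientation p hp).ne'
  refine ⟨(φ.trans g).trans ψ.symm, (hφd.trans hg).trans hψd.symm, ?_, fun q hq => ?_⟩
  · simp only [OpenPartialHomeomorph.trans_source, Set.mem_inter_iff, Set.mem_preimage,
      OpenPartialHomeomorph.symm_source, OpenPartialHomeomorph.coe_trans, Function.comp_apply, hgF]
    refine ⟨⟨hpφ, hpg⟩, ?_⟩
    rw [φ.left_inv hpφ]
    exact ψ.map_source hpψ
  · simp only [OpenPartialHomeomorph.trans_source, Set.mem_inter_iff, Set.mem_preimage] at hq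
    have h1 := (hgO hq.1.2).2
    simp only [Set.mem_preimage, φ.left_inv hq.1.1] at h1
    simp only [OpenPartialHomeomorph.coe_trans, Function.comp_apply, hgF, φ.left_inv hq.1.1,
      ψ.left_inv h1]

/-- Smooth local coordinates `Φ` of `M` and `Ψ` of `N` in which `κ` is `(z, w) ↦ (z², w)`. -/
structure IsFoldModel (κ : M → N)
    (Φ : OpenPartialHomeomorph M (ℂ × EuclideanSpace ℝ (Fin m)))
    (Ψ : OpenPartialHomeomorph N (ℂ × EuclideanSpace ℝ (Fin m))) : Prop where
  source_diffeo : IsPartialDiffeo (𝓡 (m + 2)) 𝓘(ℝ, ℂ × EuclideanSpace ℝ (Fin m)) Φ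
  target_diffeo : IsPartialDiffeo (𝓡 (m + 2)) 𝓘(ℝ, ℂ × EuclideanSpace ℝ (Fin m)) Ψ
  mapsTo : ∀ q ∈ Φ.source, κ q ∈ Ψ.source
  map_eq : ∀ q ∈ Φ.source, Ψ (κ q) = foldMap (Φ q)

omit [IsManifold (𝓡 (m + 2)) ∞ M] [IsManifold (𝓡 (m + 2)) ∞ N] in
theorem IsFoldModel.map_symm {Φ : OpenPartialHomeomorph M (ℂ × EuclideanSpace ℝ (Fin m))}
    {Ψ : OpenPartialHomeomorph N (ℂ × EuclideanSpace ℝ (Fin m))} (h : IsFoldModel κ Φ Ψ)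
    {a : ℂ × EuclideanSpace ℝ (Fin m)} (ha : a ∈ Φ.target) :
    foldMap a ∈ Ψ.target ∧ κ (Φ.symm a) = Ψ.symm (foldMap a) := by
  have h1 := h.mapsTo _ (Φ.map_target ha)
  have h2 := h.map_eq _ (Φ.map_target ha)
  rw [Φ.right_inv ha] at h2
  exact ⟨h2 ▸ Ψ.map_source h1, by rw [← h2, Ψ.left_inv h1]⟩

theorem exists_isFoldModel (hκ : IsTwoFoldCover κ B) {p : M} (hp : κ p ∈ B.carrier) :
    ∃ Φ Ψ, IsFoldModel (m := m) κ Φ Ψ ∧ p ∈ Φ.source := by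
  obtain ⟨φ, ψ, hφ, hψ, hpφ, h⟩ := hκ.localModel p hp
  refine ⟨φ.trans (splitCoord m).toHomeomorph.toOpenPartialHomeomorph,
    ψ.trans (splitCoord m).toHomeomorph.toOpenPartialHomeomorph,
    ⟨isPartialDiffeo_trans_splitCoord hφ.1, isPartialDiffeo_trans_splitCoord hψ.1,
      fun q hq => ?_, fun q hq => ?_⟩, by simpa using hpφ⟩
  · simpa using (h q (by simpa using hq)).1
  · obtain ⟨-, h0, h1, h2⟩ := h q (by simpa using hq)
    change splitCoord m (ψ (κ q)) = foldMap (splitCoord m (φ q))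
    simp only [splitCoord_apply, foldMap, h0, h1, h2]
    refine Prod.ext (Complex.ext ?_ ?_) rfl
    · simp [sq]
    · simp [sq]; ring

theorem isOpenMap (hκ : IsTwoFoldCover κ B) : IsOpenMap κ := by
  refine isOpenMap_iff_nhds_le.2 fun p => ?_
  by_cases hp : κ p ∈ B.carrier
  · obtain ⟨Φ, Ψ, h, hpΦ⟩ := hκ.exists_isFoldModel hp
    have h1 : Filter.map κ (𝓝 p) = Filter.map (fun q => Ψ.symm (foldMap (Φ q))) (𝓝 p) := by
      refine Filter.map_congr ?_
      filter_upwards [Φ.open_source.mem_nhds hpΦ] with q hq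
      rw [← h.map_eq q hq, Ψ.left_inv (h.mapsTo q hq)]
    have h2 : Filter.map (fun q => Ψ.symm (foldMap (Φ q))) (𝓝 p) =
        Filter.map Ψ.symm (Filter.map foldMap (Filter.map Φ (𝓝 p))) := rfl
    rw [h1, h2, Φ.map_nhds_eq hpΦ]
    calc 𝓝 (κ p) = Filter.map Ψ.symm (𝓝 (Ψ (κ p))) := by
          rw [Ψ.symm.map_nhds_eq (Ψ.map_source (h.mapsTo p hpΦ)), Ψ.left_inv (h.mapsTo p hpΦ)]
      _ ≤ _ := by
          rw [h.map_eq p hpΦ]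
          exact Filter.map_mono (isOpenMap_foldMap.nhds_le _)
  · obtain ⟨e, -, hpe, he⟩ := hκ.exists_isPartialDiffeo hp
    have h1 : Filter.map κ (𝓝 p) = Filter.map e (𝓝 p) := by
      refine Filter.map_congr ?_
      filter_upwards [e.open_source.mem_nhds hpe] with q hq using (he q hq).symm
    rw [h1, e.map_nhds_eq hpe, he p hpe]

omit [IsManifold (𝓡 (m + 2)) ∞ M] [IsManifold (𝓡 (m + 2)) ∞ N] in
/-- In a fold model, `z` vanishes at the critical points. -/
theorem IsFoldModel.fst_eq_zero {Φ : OpenPartialHomeomorph M (ℂ × EuclideanSpace ℝ (Fin m))}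
    {Ψ : OpenPartialHomeomorph N (ℂ × EuclideanSpace ℝ (Fin m))} (h : IsFoldModel κ Φ Ψ)
    (hκ : MDifferentiable (𝓡 (m + 2)) (𝓡 (m + 2)) κ) {p : M} (hp : p ∈ Φ.source)
    (hcrit : ¬ Function.Surjective (mfderiv (𝓡 (m + 2)) (𝓡 (m + 2)) κ p)) : (Φ p).1 = 0 := by
  by_contra hz
  apply hcrit
  have hd := hasFDerivAt_foldMap (Φ p)
  have hΦ := h.source_diffeo.mdifferentiable
  have hΨ := h.target_diffeo.mdifferentiable
  have e1 : HasMFDerivAt (𝓡 (m + 2)) 𝓘(ℝ, ℂ × EuclideanSpace ℝ (Fin m)) (foldMap ∘ Φ) p _ :=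
    hd.hasMFDerivAt.comp p (hΦ.mdifferentiableAt hp).hasMFDerivAt
  have e2 : HasMFDerivAt (𝓡 (m + 2)) 𝓘(ℝ, ℂ × EuclideanSpace ℝ (Fin m)) (Ψ ∘ κ) p _ :=
    (hΨ.mdifferentiableAt (h.mapsTo p hp)).hasMFDerivAt.comp p (hκ p).hasMFDerivAt
  have e3 : Ψ ∘ κ =ᶠ[𝓝 p] foldMap ∘ Φ := by
    filter_upwards [Φ.open_source.mem_nhds hp] with q hq using h.map_eq q hq
  have e4 := hasMFDerivAt_unique e2 (e1.congr_of_eventuallyEq e3)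
  intro v
  obtain ⟨u, hu⟩ := hΦ.mfderiv_surjective hp
    (((mfderiv (𝓡 (m + 2)) 𝓘(ℝ, ℂ × EuclideanSpace ℝ (Fin m)) Ψ (κ p) v).1 / (2 * (Φ p).1),
      (mfderiv (𝓡 (m + 2)) 𝓘(ℝ, ℂ × EuclideanSpace ℝ (Fin m)) Ψ (κ p) v).2) :
      ℂ × EuclideanSpace ℝ (Fin m))
  refine ⟨u, hΨ.mfderiv_injective (h.mapsTo p hp) ?_⟩
  have e5 := congrArg (fun L => L u) e4
  refine e5.trans ?_
  refine (congrArg (((2 * (Φ p).1) • ContinuousLinearMap.fst ℝ ℂ (EuclideanSpace ℝ (Fin m))).prod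
    (ContinuousLinearMap.snd ℝ ℂ _)) hu).trans ?_
  refine Prod.ext ?_ rfl
  change (2 * (Φ p).1) * (_ / (2 * (Φ p).1)) = _
  field_simp

/-- The fibres over the branch locus are single points. -/
theorem eq_of_mem_carrier [T2Space M] (hκ : IsTwoFoldCover κ B) {p q : M} (hp : κ p ∈ B.carrier)
    (hpq : κ q = κ p) : p = q := by
  -- otherwise a nearby regular value has two preimages near a critical point, and a third one
  suffices key : ∀ p q : M, κ p ∈ B.carrier → κ q = κ p →
      ¬ Function.Surjective (mfderiv (𝓡 (m + 2)) (𝓡 (m + 2)) κ p) → q = p by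
    obtain ⟨r, hr, hr'⟩ := (hκ.criticalValues _).1 hp
    rw [key r p (hr ▸ hp) hr.symm hr', key r q (hr ▸ hp) (hpq.trans hr.symm) hr']
  clear! p q
  intro p q hp hpq hcrit
  by_contra hne
  obtain ⟨Φ, Ψ, h, hpΦ⟩ := hκ.exists_isFoldModel hp
  have hz := h.fst_eq_zero (hκ.smooth.mdifferentiable (by simp)) hpΦ hcrit
  obtain ⟨O₂, O₁, hO₂, hO₁, hqO, hpO, hdisj⟩ := t2_separation hne
  have hopen := hκ.isOpenMap
  let neg : ℂ × EuclideanSpace ℝ (Fin m) → ℂ × EuclideanSpace ℝ (Fin m) := fun a => (-a.1, a.2)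
  have hneg : Continuous neg := by fun_prop
  have hneg0 : neg (Φ p) = Φ p := Prod.ext (by simp [neg, hz]) rfl
  have hev : ∀ᶠ a in 𝓝 (Φ p), a ∈ Φ.target ∧ Φ.symm a ∈ O₁ ∧ κ (Φ.symm a) ∈ κ '' O₂ := by
    refine (Φ.open_target.eventually_mem (Φ.map_source hpΦ)).and
      (((Φ.tendsto_symm hpΦ).eventually (hO₁.mem_nhds hpO)).and
      ((Φ.tendsto_symm hpΦ).eventually (p := fun x => κ x ∈ κ '' O₂) ?_))
    exact hκ.smooth.continuous.continuousAt.eventually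
      ((hopen O₂ hO₂).mem_nhds ⟨q, hqO, hpq⟩)
  have hev' := hev.and ((hneg.tendsto' _ _ hneg0).eventually hev)
  obtain ⟨A, hA, hAo, hpA⟩ := eventually_nhds_iff.1 hev'
  -- a point of `A` with `z ≠ 0` over a regular value
  have hA1 : IsOpen (A ∩ {a | a.1 ≠ 0}) :=
    hAo.inter (isOpen_ne_fun continuous_fst continuous_const)
  have hA2 : (A ∩ {a : ℂ × EuclideanSpace ℝ (Fin m) | a.1 ≠ 0}).Nonempty :=
    dense_setOf_fst_ne_zero.inter_open_nonempty A hAo ⟨_, hpA⟩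
  have hA3 : IsOpen (Φ.symm '' (A ∩ {a | a.1 ≠ 0})) :=
    Φ.symm.isOpen_image_of_subset_source hA1 fun a ha => (hA a ha.1).1.1
  obtain ⟨_, ⟨_, ⟨a, ⟨haA, ha0⟩, rfl⟩, rfl⟩, haB⟩ := B.dense_compl_carrier.inter_open_nonempty _
    (hopen _ hA3) ((hA2.image _).image _)
  obtain ⟨⟨haT, haO, ⟨r, hrO, hr⟩⟩, hnT, hnO, -⟩ := hA a haA
  have hne' : Φ.symm a ≠ Φ.symm (neg a) := fun heq => by
    have := congrArg Prod.fst (Φ.symm.injOn haT hnT heq)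
    exact ha0 (self_eq_neg.1 this)
  have hk : κ (Φ.symm (neg a)) = κ (Φ.symm a) := by
    rw [(h.map_symm haT).2, (h.map_symm hnT).2]
    simp [neg, foldMap]
  rcases hκ.eq_or_eq_of_ne haB hne' hk hr with rfl | rfl
  · exact Set.disjoint_left.1 hdisj hrO haO
  · exact Set.disjoint_left.1 hdisj hrO hnO

theorem isClosed_carrier [T2Space M] (hκ : IsTwoFoldCover κ B) : IsClosed B.carrier := by
  rw [← isOpen_compl_iff, isOpen_iff_mem_nhds]
  intro y hy
  obtain ⟨p, q, hpq, rfl, hq, -⟩ := hκ.exists_pair hy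
  obtain ⟨O₁, O₂, hO₁, hO₂, hpO, hqO, hdisj⟩ := t2_separation hpq
  filter_upwards [(hκ.isOpenMap O₁ hO₁).mem_nhds ⟨p, hpO, rfl⟩,
    (hκ.isOpenMap O₂ hO₂).mem_nhds ⟨q, hqO, hq⟩]
  rintro _ ⟨a, ha, rfl⟩ ⟨b, hb, hab⟩ haB
  exact Set.disjoint_left.1 hdisj ha (hκ.eq_of_mem_carrier haB hab ▸ hb)

omit [IsManifold (𝓡 (m + 2)) ∞ M] [IsManifold (𝓡 (m + 2)) ∞ N] in
theorem foldMap_neg (z : ℂ) (w : EuclideanSpace ℝ (Fin m)) : foldMap (-z, w) = foldMap (z, w) := by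
  simp [foldMap]

/-- The points `z = 0` of a fold model lie over the branch locus, because `κ` is not injective near
such a point. -/
theorem IsFoldModel.mem_carrier (hκ : IsTwoFoldCover κ B)
    {Φ : OpenPartialHomeomorph M (ℂ × EuclideanSpace ℝ (Fin m))}
    {Ψ : OpenPartialHomeomorph N (ℂ × EuclideanSpace ℝ (Fin m))} (h : IsFoldModel κ Φ Ψ) {q : M}
    (hq : q ∈ Φ.source) (hz : (Φ q).1 = 0) : κ q ∈ B.carrier := by
  by_contra hB
  obtain ⟨e, -, hqe, he⟩ := hκ.exists_isPartialDiffeo hB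
  have hc : Filter.Tendsto (fun z : ℂ => (z, (Φ q).2)) (𝓝 0) (𝓝 (Φ q)) :=
    Continuous.tendsto' (by fun_prop) _ _ (Prod.ext hz.symm rfl)
  have hev : ∀ᶠ z : ℂ in 𝓝 0, (z, (Φ q).2) ∈ Φ.target ∧ Φ.symm (z, (Φ q).2) ∈ e.source :=
    hc.eventually ((Φ.open_target.eventually_mem (Φ.map_source hq)).and
      ((Φ.tendsto_symm hq).eventually (e.open_source.mem_nhds hqe)))
  have hev' := hev.and ((continuous_neg.tendsto' (0 : ℂ) 0 neg_zero).eventually hev)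
  obtain ⟨z, ⟨⟨h1, h2⟩, h3, h4⟩, hz0⟩ :=
    ((hev'.filter_mono nhdsWithin_le_nhds).and (self_mem_nhdsWithin (s := {0}ᶜ))).exists
  have heq : e (Φ.symm (z, (Φ q).2)) = e (Φ.symm (-z, (Φ q).2)) := by
    rw [he _ h2, he _ h4, (h.map_symm h1).2, (h.map_symm h3).2, foldMap_neg]
  have := congrArg Prod.fst (Φ.symm.injOn h1 h3 (e.injOn h2 h4 heq))
  exact hz0 (self_eq_neg.1 this)

/-- A fold model over a neighbourhood in `N` whose whole preimage it describes, and in which the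
branch locus is `{ζ = 0}`. -/
structure IsBranchModel (κ : M → N) (B : OrientedCodimTwoSubmanifold m N)
    (Φ : OpenPartialHomeomorph M (ℂ × EuclideanSpace ℝ (Fin m)))
    (Ψ : OpenPartialHomeomorph N (ℂ × EuclideanSpace ℝ (Fin m))) : Prop
    extends IsFoldModel κ Φ Ψ where
  mem_source : ∀ q, κ q ∈ Ψ.source → q ∈ Φ.source
  mem_carrier : ∀ x ∈ Ψ.source, x ∈ B.carrier ↔ (Ψ x).1 = 0

/-- A fold model becomes a branch model over a small polydisc: every point over it is one of the two
points `(± √ζ, w)`, because there are no other preimages. -/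
theorem exists_isBranchModel [T2Space M] (hκ : IsTwoFoldCover κ B) {b : N} (hb : b ∈ B.carrier) :
    ∃ Φ Ψ, IsBranchModel κ B Φ Ψ ∧ b ∈ Ψ.source := by
  obtain ⟨p, rfl, hcrit⟩ := (hκ.criticalValues b).1 hb
  obtain ⟨Φ, Ψ, h, hpΦ⟩ := hκ.exists_isFoldModel hb
  have hz := h.fst_eq_zero (hκ.smooth.mdifferentiable (by simp)) hpΦ hcrit
  set w₀ := (Φ p).2 with hw₀
  have hp0 : Φ p = (0, w₀) := Prod.ext hz rfl
  obtain ⟨ε, hε, hεT⟩ := Metric.isOpen_iff.1 Φ.open_target (Φ p) (Φ.map_source hpΦ)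
  have hD : ∀ z : ℂ, ∀ w, ‖z‖ < ε → w ∈ Metric.ball w₀ ε → (z, w) ∈ Φ.target := by
    intro z w hz hw
    apply hεT
    rw [hp0, ← ball_prod_same]
    exact ⟨by simpa using hz, hw⟩
  let D : Set (ℂ × EuclideanSpace ℝ (Fin m)) := Metric.ball 0 ε ×ˢ Metric.ball w₀ ε
  let D' : Set (ℂ × EuclideanSpace ℝ (Fin m)) := Metric.ball 0 (ε ^ 2) ×ˢ Metric.ball w₀ ε
  have hDo : IsOpen D := Metric.isOpen_ball.prod Metric.isOpen_ball
  have hDo' : IsOpen D' := Metric.isOpen_ball.prod Metric.isOpen_ball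
  -- the points `(± √ζ, w)` over a point `(ζ, w)` of `D'`
  have hroot : ∀ x ∈ Ψ.source, Ψ x ∈ D' → ∃ z : ℂ, ∃ w, z ^ 2 = (Ψ x).1 ∧ w = (Ψ x).2 ∧
      (z, w) ∈ D ∧ (z, w) ∈ Φ.target ∧ (-z, w) ∈ D ∧ (-z, w) ∈ Φ.target ∧
      κ (Φ.symm (z, w)) = x ∧ κ (Φ.symm (-z, w)) = x := by
    intro x hx hxD
    obtain ⟨z, hz⟩ := IsAlgClosed.exists_pow_nat_eq (Ψ x).1 two_pos
    have hzn : ‖z‖ < ε := by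
      have h1 : ‖(Ψ x).1‖ < ε ^ 2 := by simpa using hxD.1
      rw [← hz, norm_pow] at h1
      exact lt_of_pow_lt_pow_left₀ 2 hε.le h1
    have h1 := hD z _ hzn hxD.2
    have h2 := hD (-z) _ (by rwa [norm_neg]) hxD.2
    have h3 : foldMap (z, (Ψ x).2) = Ψ x := Prod.ext hz rfl
    refine ⟨z, (Ψ x).2, hz, rfl, ⟨by simpa using hzn, hxD.2⟩, h1,
      ⟨by simpa using hzn, hxD.2⟩, h2, ?_, ?_⟩
    · rw [(h.map_symm h1).2, h3, Ψ.left_inv hx]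
    · rw [(h.map_symm h2).2, foldMap_neg, h3, Ψ.left_inv hx]
  have hDD : ∀ a ∈ D, foldMap a ∈ D' := fun a ha => ⟨by
    have : ‖a.1‖ < ε := by simpa using ha.1
    simpa using pow_lt_pow_left₀ this (norm_nonneg _) two_ne_zero, ha.2⟩
  have hcar : ∀ x ∈ Ψ.source, Ψ x ∈ D' → (x ∈ B.carrier ↔ (Ψ x).1 = 0) := by
    intro x hx hxD
    obtain ⟨z, w, hz, -, -, h1, -, h2, h3, h4⟩ := hroot x hx hxD
    constructor
    · intro hxB
      have heq := hκ.eq_of_mem_carrier (p := Φ.symm (z, w)) (h3 ▸ hxB) (h4.trans h3.symm)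
      have : z = -z := congrArg Prod.fst (Φ.symm.injOn h1 h2 heq)
      rw [← hz, self_eq_neg.1 this]
      simp
    · intro h0
      rw [← h3]
      refine h.mem_carrier hκ (Φ.map_target h1) ?_
      rw [Φ.right_inv h1]
      rw [h0] at hz
      exact pow_eq_zero_iff two_ne_zero |>.1 hz
  have hid : ∀ {s : Set (ℂ × EuclideanSpace ℝ (Fin m))} (hs : IsOpen s),
      IsPartialDiffeo 𝓘(ℝ, ℂ × EuclideanSpace ℝ (Fin m)) 𝓘(ℝ, ℂ × EuclideanSpace ℝ (Fin m))
        (OpenPartialHomeomorph.ofSet s hs) := fun hs => IsPartialDiffeo.ofSet hs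
  have hΦD : ∀ q, q ∈ (Φ.trans (OpenPartialHomeomorph.ofSet D hDo)).source ↔
      q ∈ Φ.source ∧ Φ q ∈ D := fun q => by simp
  have hΨD : ∀ q, q ∈ (Ψ.trans (OpenPartialHomeomorph.ofSet D' hDo')).source ↔
      q ∈ Ψ.source ∧ Ψ q ∈ D' := fun q => by simp
  refine ⟨Φ.trans (OpenPartialHomeomorph.ofSet D hDo),
    Ψ.trans (OpenPartialHomeomorph.ofSet D' hDo'),
    ⟨⟨h.source_diffeo.trans (hid hDo), h.target_diffeo.trans (hid hDo'), fun q hq => ?_,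
      fun q hq => h.map_eq q ((hΦD q).1 hq).1⟩, fun q hq => ?_,
      fun x hx => hcar x ((hΨD x).1 hx).1 ((hΨD x).1 hx).2⟩, ?_⟩
  · rw [hΦD] at hq
    exact (hΨD _).2 ⟨h.mapsTo q hq.1, h.map_eq q hq.1 ▸ hDD _ hq.2⟩
  · rw [hΨD] at hq
    obtain ⟨z, w, hz, -, h1D, h1, h2D, h2, h3, h4⟩ := hroot _ hq.1 hq.2
    rw [hΦD]
    have e1 : ∀ a ∈ Φ.target, a ∈ D → Φ.symm a ∈ Φ.source ∧ Φ (Φ.symm a) ∈ D :=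
      fun a ha haD => ⟨Φ.map_target ha, by rwa [Φ.right_inv ha]⟩
    by_cases hB : κ q ∈ B.carrier
    · rw [hκ.eq_of_mem_carrier hB h3]
      exact e1 _ h1 h1D
    · have hne : Φ.symm (z, w) ≠ Φ.symm (-z, w) := fun heq => by
        have : z = -z := congrArg Prod.fst (Φ.symm.injOn h1 h2 heq)
        rw [hcar _ hq.1 hq.2, ← hz, self_eq_neg.1 this] at hB
        simp at hB
      rcases hκ.eq_or_eq_of_ne (h3.symm ▸ hB) hne (h4.trans h3.symm) h3.symm with h5 | h5
      · rw [h5]; exact e1 _ h1 h1D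
      · rw [h5]; exact e1 _ h2 h2D
  · refine (hΨD _).2 ⟨h.mapsTo p hpΦ, ?_⟩
    rw [h.map_eq p hpΦ, hp0]
    exact hDD _ ⟨by simpa using hε, by simpa using hε⟩

omit [IsManifold (𝓡 (m + 2)) ∞ M] [IsManifold (𝓡 (m + 2)) ∞ N] in
/-- Complex conjugation of both `z` and `ζ = z²` turns a branch model into another one. -/
theorem IsBranchModel.conj {Φ : OpenPartialHomeomorph M (ℂ × EuclideanSpace ℝ (Fin m))}
    {Ψ : OpenPartialHomeomorph N (ℂ × EuclideanSpace ℝ (Fin m))} (h : IsBranchModel κ B Φ Ψ) :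
    let c := (Complex.conjCLE.prodCongr
      (ContinuousLinearEquiv.refl ℝ (EuclideanSpace ℝ (Fin m)))).toHomeomorph.toOpenPartialHomeomorph
    IsBranchModel κ B (Φ.trans c) (Ψ.trans c) := by
  intro c
  have hc := IsPartialDiffeo.of_continuousLinearEquiv (Complex.conjCLE.prodCongr
      (ContinuousLinearEquiv.refl ℝ (EuclideanSpace ℝ (Fin m))))
  refine ⟨⟨h.source_diffeo.trans hc, h.target_diffeo.trans hc, fun q hq => ?_, fun q hq => ?_⟩,
    fun q hq => ?_, fun x hx => ?_⟩
  · simpa [c] using h.mapsTo q (by simpa [c] using hq)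
  · have := h.map_eq q (by simpa [c] using hq)
    simp [c, this, foldMap]
  · simpa [c] using h.mem_source q (by simpa [c] using hq)
  · simpa [c] using h.mem_carrier x (by simpa [c] using hx)

/-- The branch model around a point of `B` can be chosen such that `ζ` is a positive normal
coordinate of `B` at this point, for either orientation of the normal bundle. -/
theorem exists_isBranchModel_normalJacobian_pos [T2Space M] (hκ : IsTwoFoldCover κ B) {b : N}
    (hb : b ∈ B.carrier) :
    ∃ Φ Ψ, IsBranchModel κ B Φ Ψ ∧ b ∈ Ψ.source ∧ ∀ᶠ x in 𝓝 b, x ∈ B.carrier →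
      ∀ ψ ∈ B.sliceCharts, x ∈ ψ.source → 0 < normalJacobian ψ (fun x => (Ψ x).1) x := by
  obtain ⟨Φ, Ψ, h, hbΨ⟩ := hκ.exists_isBranchModel hb
  obtain ⟨ψ, hψ, hbψ⟩ := B.cover b hb
  have key : ∀ Φ Ψ, IsBranchModel κ B Φ Ψ → b ∈ Ψ.source →
      0 < normalJacobian ψ (fun x => (Ψ x).1) b → ∀ᶠ x in 𝓝 b, x ∈ B.carrier →
      ∀ ψ ∈ B.sliceCharts, x ∈ ψ.source → 0 < normalJacobian ψ (fun x => (Ψ x).1) x := by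
    intro Φ Ψ h hbΨ hpos
    refine B.eventually_normalJacobian_pos hψ hbψ ?_ ?_ hpos
    · filter_upwards [Ψ.open_source.mem_nhds hbΨ] with x hx
      exact (contDiff_fst.contMDiff.contMDiffAt).comp x (h.target_diffeo.contMDiffAt hx)
    · filter_upwards [Ψ.open_source.mem_nhds hbΨ] with x hx using (h.mem_carrier x hx).1
  have hne := B.normalJacobian_fst_ne_zero h.target_diffeo h.mem_carrier hb hbΨ hψ hbψ
  rcases hne.lt_or_gt with hneg | hpos
  · have hb' : b ∈ (Ψ.trans (Complex.conjCLE.prodCongr (ContinuousLinearEquiv.refl ℝ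
      (EuclideanSpace ℝ (Fin m)))).toHomeomorph.toOpenPartialHomeomorph).source := by
      simpa using hbΨ
    refine ⟨_, _, h.conj, hb', key _ _ h.conj hb' ?_⟩
    have := normalJacobian_conj ψ (fun x => (Ψ x).1) b
    change 0 < normalJacobian ψ (fun x => (starRingEnd ℂ) (Ψ x).1) b
    rw [this]
    linarith
  · exact ⟨Φ, Ψ, h, hbΨ, key Φ Ψ h hbΨ hpos⟩

end IsTwoFoldCover

/-! ### Square roots on the covering manifold -/

section Roots

variable {m : ℕ} {M N : Type*} [TopologicalSpace M] [TopologicalSpace N]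
  [ChartedSpace (EuclideanSpace ℝ (Fin (m + 2))) M]
  [ChartedSpace (EuclideanSpace ℝ (Fin (m + 2))) N]
  {κ : M → N} {B : OrientedCodimTwoSubmanifold m N}

/-- A function `t` on the part of `M` over an open set `U ⊆ N` whose square descends to a function
`σ` on `U` with oriented zero locus `B`, and which separates the points of the fibres of `κ`. This
is what `M ≅ M_{L,s}` amounts to in a trivialization of `L` over `U`: the function `t` is the fibre
coordinate, and `σ` is the coordinate of `s`. -/
structure IsBranchRoot (κ : M → N) (B : OrientedCodimTwoSubmanifold m N) (U : Set N) (t : M → ℂ)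
    (σ : N → ℂ) : Prop where
  isOpen : IsOpen U
  smooth_root : ContMDiffOn (𝓡 (m + 2)) 𝓘(ℝ, ℂ) ∞ t (κ ⁻¹' U)
  smooth_sq : ContMDiffOn (𝓡 (m + 2)) 𝓘(ℝ, ℂ) ∞ σ U
  sq_eq : ∀ p, κ p ∈ U → σ (κ p) = t p ^ 2
  inj : ∀ p q, κ p ∈ U → κ q = κ p → t q = t p → q = p
  eq_zero_iff : ∀ x ∈ U, σ x = 0 ↔ x ∈ B.carrier
  normalJacobian_pos : ∀ x ∈ U, x ∈ B.carrier → ∀ ψ ∈ B.sliceCharts, x ∈ ψ.source →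
    0 < normalJacobian ψ σ x

theorem ContMDiffWithinAt.complex_mul {E H X : Type*} [NormedAddCommGroup E] [NormedSpace ℝ E]
    [TopologicalSpace H] [TopologicalSpace X] [ChartedSpace H X] {I : ModelWithCorners ℝ E H}
    {f g : X → ℂ} {s : Set X} {x : X} (hf : ContMDiffWithinAt I 𝓘(ℝ, ℂ) ∞ f s x)
    (hg : ContMDiffWithinAt I 𝓘(ℝ, ℂ) ∞ g s x) :
    ContMDiffWithinAt I 𝓘(ℝ, ℂ) ∞ (fun y => f y * g y) s x :=
  ContMDiffAt.comp_contMDiffWithinAt (g := fun p : ℂ × ℂ => p.1 * p.2) x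
    (contDiff_fst.mul contDiff_snd).contMDiff.contMDiffAt (hf.prodMk_space hg)

/-- Neighbourhoods of `(0, w₀)` contain the full preimage of a neighbourhood of `(0, w₀)`, so that
statements near `(0, w₀)` upstairs give statements about all points over a neighbourhood. -/
theorem tendsto_comap_foldMap {W : Type} [NormedAddCommGroup W] (w₀ : W) :
    Filter.comap foldMap (𝓝 ((0 : ℂ), w₀)) ≤ 𝓝 (0, w₀) := by
  rw [(Metric.nhds_basis_ball.comap foldMap).le_basis_iff Metric.nhds_basis_ball]
  intro δ hδ
  refine ⟨min δ (δ ^ 2), by positivity, fun a ha => ?_⟩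
  simp only [Set.mem_preimage, Metric.mem_ball, Prod.dist_eq, foldMap_fst, foldMap_snd,
    dist_zero_right, norm_pow, max_lt_iff, lt_min_iff] at ha ⊢
  exact ⟨lt_of_pow_lt_pow_left₀ 2 hδ.le ha.2.1, ha.1.2⟩

namespace IsBranchRoot

variable {U U' : Set N} {t t' : M → ℂ} {σ σ' : N → ℂ}

theorem ne_zero (h : IsBranchRoot κ B U t σ) {p : M} (hp : κ p ∈ U) (hpB : κ p ∉ B.carrier) :
    t p ≠ 0 := by
  intro h0
  exact hpB ((h.eq_zero_iff _ hp).1 (by rw [h.sq_eq p hp, h0]; ring))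

/-- A root takes opposite values at the two points of a fibre. -/
theorem eq_neg (h : IsBranchRoot κ B U t σ) {p q : M} (hp : κ p ∈ U) (hpq : κ q = κ p)
    (hne : q ≠ p) : t q = -t p := by
  have h1 : t q ^ 2 = t p ^ 2 := by rw [← h.sq_eq p hp, ← h.sq_eq q (hpq ▸ hp), hpq]
  exact (sq_eq_sq_iff_eq_or_eq_neg.1 h1).resolve_left fun h2 => hne (h.inj p q hp hpq h2)

variable [IsManifold (𝓡 (m + 2)) ∞ M] [IsManifold (𝓡 (m + 2)) ∞ N] [T2Space M]

omit [IsManifold (𝓡 (m + 2)) ∞ M] [T2Space M] in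
/-- Near the branch locus, every root is a nonvanishing smooth function on `N` times the coordinate
`z` of the branch model. -/
theorem exists_eq_fst_mul (h : IsBranchRoot κ B U t σ) (hκ : IsTwoFoldCover κ B) {b : N}
    (hb : b ∈ B.carrier) (hbU : b ∈ U)
    {Φ : OpenPartialHomeomorph M (ℂ × EuclideanSpace ℝ (Fin m))}
    {Ψ : OpenPartialHomeomorph N (ℂ × EuclideanSpace ℝ (Fin m))}
    (hΦ : IsTwoFoldCover.IsBranchModel κ B Φ Ψ) (hbΨ : b ∈ Ψ.source)
    (hpos : ∀ ψ ∈ B.sliceCharts, b ∈ ψ.source → 0 < normalJacobian ψ (fun x => (Ψ x).1) b) :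
    ∃ V, IsOpen V ∧ b ∈ V ∧ V ⊆ U ∧ ∃ ρ : N → ℂ, ContMDiffOn (𝓡 (m + 2)) 𝓘(ℝ, ℂ) ∞ ρ V ∧
      (∀ x ∈ V, ρ x ≠ 0) ∧ ∀ q, κ q ∈ V → t q = (Φ q).1 * ρ (κ q) := by
  obtain ⟨p, rfl⟩ := hκ.surjective b
  have hpΦ := hΦ.mem_source p hbΨ
  have hζ : (Ψ (κ p)).1 = 0 := (hΦ.mem_carrier _ hbΨ).1 hb
  set w₀ := (Φ p).2 with hw₀
  have hfold := hΦ.map_eq p hpΦ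
  have hz : (Φ p).1 = 0 := by
    rw [hfold] at hζ
    exact (pow_eq_zero_iff two_ne_zero).1 hζ
  have hp0 : Φ p = (0, w₀) := Prod.ext hz rfl
  have hΨ0 : Ψ (κ p) = (0, w₀) := by rw [hfold, hp0]; simp [foldMap]
  have ht0 : t p = 0 := by
    have := h.sq_eq p hbU
    rw [(h.eq_zero_iff _ hbU).2 hb] at this
    exact (pow_eq_zero_iff two_ne_zero).1 this.symm
  obtain ⟨ψ, hψ, hbψ⟩ := B.cover _ hb
  have hσb := h.smooth_sq.contMDiffAt (h.isOpen.mem_nhds hbU)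
  have hσ0 : ∀ᶠ x in 𝓝 (κ p), (Ψ x).1 = 0 → σ x = 0 := by
    filter_upwards [h.isOpen.mem_nhds hbU, Ψ.open_source.mem_nhds hbΨ] with x hxU hxΨ hx0
    exact (h.eq_zero_iff x hxU).2 ((hΦ.mem_carrier x hxΨ).2 hx0)
  have hjac := h.normalJacobian_pos _ hbU hb ψ hψ hbψ
  rw [normalJacobian_eq_mul hΦ.target_diffeo hbΨ hζ hσb hσ0 (B.smooth ψ hψ) hbψ] at hjac
  have hw : wirtinger (fun a => σ (Ψ.symm a)) (0, w₀) ≠ 0 := by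
    intro h0
    have h1 := pos_of_mul_pos_left hjac (hpos ψ hψ hbψ).le
    rw [hΨ0, h0, map_zero] at h1
    linarith [Complex.normSq_nonneg (wirtingerBar (fun a => σ (Ψ.symm a)) (0, w₀))]
  have hκc := hκ.smooth.continuous
  have hU' : IsOpen (Ψ.target ∩ Ψ.symm ⁻¹' U) := Ψ.isOpen_inter_preimage_symm h.isOpen
  have hO' : IsOpen (Φ.target ∩ Φ.symm ⁻¹' (κ ⁻¹' U)) :=
    Φ.isOpen_inter_preimage_symm (h.isOpen.preimage hκc)
  have hs : ContDiffOn ℝ ∞ (fun a => σ (Ψ.symm a)) (Ψ.target ∩ Ψ.symm ⁻¹' U) := by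
    rw [← contMDiffOn_iff_contDiffOn]
    exact h.smooth_sq.comp (hΦ.target_diffeo.2.mono Set.inter_subset_left) fun a ha => ha.2
  have hh : ContDiffOn ℝ ∞ (fun a => t (Φ.symm a)) (Φ.target ∩ Φ.symm ⁻¹' (κ ⁻¹' U)) := by
    rw [← contMDiffOn_iff_contDiffOn]
    exact h.smooth_root.comp (hΦ.source_diffeo.2.mono Set.inter_subset_left) fun a ha => ha.2
  obtain ⟨V, hV, hV0, ρ, hρ, hρ0, hρt⟩ := exists_eq_fst_mul_foldMap_of_sq (w₀ := w₀) hU' hO'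
    ⟨hp0 ▸ Φ.map_source hpΦ, by simpa [← hp0, Φ.left_inv hpΦ] using hbU⟩ hs hh
    (fun a ha => by
      have h1 := hΦ.map_symm ha.1
      have h2 : κ (Φ.symm a) ∈ U := ha.2
      refine ⟨⟨h1.1, by simpa [← h1.2] using h2⟩, ?_⟩
      simp only [← h1.2]
      exact h.sq_eq _ h2)
    (by simp [← hp0, Φ.left_inv hpΦ, ht0]) hw
  have hρt' : ∀ᶠ c in 𝓝 ((0 : ℂ), w₀), ∀ a, foldMap a = c →
      t (Φ.symm a) = a.1 * ρ (foldMap a) :=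
    Filter.eventually_comap.1 (tendsto_comap_foldMap w₀ hρt)
  obtain ⟨A, hA, hAo, hA0⟩ := eventually_nhds_iff.1 hρt'
  refine ⟨U ∩ (Ψ.source ∩ Ψ ⁻¹' (V ∩ A)), h.isOpen.inter (Ψ.isOpen_inter_preimage (hV.inter hAo)),
    ⟨hbU, hbΨ, by rw [Set.mem_preimage, hΨ0]; exact ⟨hV0, hA0⟩⟩, Set.inter_subset_left,
    fun x => ρ (Ψ x), ?_, fun x hx => hρ0 _ hx.2.2.1, fun q hq => ?_⟩
  · exact hρ.contMDiffOn.comp (hΦ.target_diffeo.1.mono fun x hx => hx.2.1) fun x hx => hx.2.2.1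
  · have hqΦ := hΦ.mem_source q hq.2.1
    have h1 := hA _ hq.2.2.2 (Φ q) (hΦ.map_eq q hqΦ).symm
    rwa [Φ.left_inv hqΦ, ← hΦ.map_eq q hqΦ] at h1

omit [IsManifold (𝓡 (m + 2)) ∞ M] [IsManifold (𝓡 (m + 2)) ∞ N] [T2Space M] in
/-- The ratio of two roots is determined by continuity, as the complement of `B` is dense. -/
theorem ratio_unique (h : IsBranchRoot κ B U t σ) (hκ : IsTwoFoldCover κ B) {x : N} (hx : x ∈ U)
    {r₁ r₂ : N → ℂ} (hr₁ : ContinuousAt r₁ x) (hr₂ : ContinuousAt r₂ x)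
    (h₁ : ∀ᶠ y in 𝓝 x, ∀ p, κ p = y → t' p = r₁ y * t p)
    (h₂ : ∀ᶠ y in 𝓝 x, ∀ p, κ p = y → t' p = r₂ y * t p) : r₁ x = r₂ x := by
  refine tendsto_nhds_unique_of_frequently_eq hr₁ hr₂ ?_
  have hfr : ∃ᶠ y in 𝓝 x, y ∉ B.carrier := mem_closure_iff_frequently.1 (B.dense_compl_carrier x)
  refine (hfr.and_eventually (h₁.and (h₂.and (h.isOpen.mem_nhds hx)))).mono ?_
  rintro y ⟨hyB, hy1, hy2, hyU⟩
  obtain ⟨p, rfl⟩ := hκ.surjective y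
  exact mul_right_cancel₀ (h.ne_zero hyU hyB) ((hy1 p rfl).symm.trans (hy2 p rfl))

theorem exists_local_ratio (h : IsBranchRoot κ B U t σ) (h' : IsBranchRoot κ B U' t' σ')
    (hκ : IsTwoFoldCover κ B) {x : N} (hx : x ∈ U ∩ U') :
    ∃ V, IsOpen V ∧ x ∈ V ∧ ∃ r : N → ℂ, ContMDiffOn (𝓡 (m + 2)) 𝓘(ℝ, ℂ) ∞ r V ∧
      (∀ y ∈ V, r y ≠ 0) ∧ ∀ p, κ p ∈ V → t' p = r (κ p) * t p := by
  have hdiv : ∀ {f g : N → ℂ} {V : Set N}, ContMDiffOn (𝓡 (m + 2)) 𝓘(ℝ, ℂ) ∞ f V →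
      ContMDiffOn (𝓡 (m + 2)) 𝓘(ℝ, ℂ) ∞ g V → (∀ y ∈ V, g y ≠ 0) →
      ContMDiffOn (𝓡 (m + 2)) 𝓘(ℝ, ℂ) ∞ (fun y => f y * (g y)⁻¹) V := by
    intro f g V hf hg hne y hy
    exact (hf y hy).complex_mul (ContMDiffAt.comp_contMDiffWithinAt (g := fun z : ℂ => z⁻¹) y
      (contDiffAt_inv ℝ (hne y hy)).contMDiffAt (hg y hy))
  by_cases hxB : x ∈ B.carrier
  · obtain ⟨Φ, Ψ, hΦ, hxΨ, hpos⟩ := hκ.exists_isBranchModel_normalJacobian_pos hxB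
    have hpos' := hpos.self_of_nhds hxB
    obtain ⟨V, hV, hxV, -, ρ, hρ, hρ0, hρt⟩ := h.exists_eq_fst_mul hκ hxB hx.1 hΦ hxΨ hpos'
    obtain ⟨V', hV', hxV', -, ρ', hρ', hρ0', hρt'⟩ := h'.exists_eq_fst_mul hκ hxB hx.2 hΦ hxΨ hpos'
    refine ⟨V ∩ V', hV.inter hV', ⟨hxV, hxV'⟩, fun y => ρ' y * (ρ y)⁻¹,
      hdiv (hρ'.mono Set.inter_subset_right) (hρ.mono Set.inter_subset_left) fun y hy => hρ0 y hy.1,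
      fun y hy => mul_ne_zero (hρ0' y hy.2) (inv_ne_zero (hρ0 y hy.1)), fun p hp => ?_⟩
    have := hρ0 _ hp.1
    rw [hρt p hp.1, hρt' p hp.2]
    field_simp
  · obtain ⟨p, rfl⟩ := hκ.surjective x
    obtain ⟨e, he, hpe, heκ⟩ := hκ.exists_isPartialDiffeo hxB
    have hV : IsOpen (e.target ∩ (U ∩ U' ∩ B.carrierᶜ)) :=
      e.open_target.inter ((h.isOpen.inter h'.isOpen).inter hκ.isClosed_carrier.isOpen_compl)
    have hκe : ∀ y ∈ e.target, κ (e.symm y) = y := fun y hy => by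
      rw [← heκ _ (e.map_target hy), e.right_inv hy]
    have hne : ∀ y ∈ e.target ∩ (U ∩ U' ∩ B.carrierᶜ), t (e.symm y) ≠ 0 := fun y hy =>
      h.ne_zero (by rw [hκe y hy.1]; exact hy.2.1.1) (by rw [hκe y hy.1]; exact hy.2.2)
    have hne' : ∀ y ∈ e.target ∩ (U ∩ U' ∩ B.carrierᶜ), t' (e.symm y) ≠ 0 := fun y hy =>
      h'.ne_zero (by rw [hκe y hy.1]; exact hy.2.1.2) (by rw [hκe y hy.1]; exact hy.2.2)
    refine ⟨_, hV, ⟨heκ p hpe ▸ e.map_source hpe, hx, hxB⟩,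
      fun y => t' (e.symm y) * (t (e.symm y))⁻¹, hdiv ?_ ?_ hne,
      fun y hy => mul_ne_zero (hne' y hy) (inv_ne_zero (hne y hy)), fun q hq => ?_⟩
    · refine h'.smooth_root.comp (he.2.mono Set.inter_subset_left) fun y hy => ?_
      rw [Set.mem_preimage, Set.mem_preimage, hκe y hy.1]
      exact hy.2.1.2
    · refine h.smooth_root.comp (he.2.mono Set.inter_subset_left) fun y hy => ?_
      rw [Set.mem_preimage, Set.mem_preimage, hκe y hy.1]
      exact hy.2.1.1
    · have h1 := hne _ hq
      have h2 := hκe _ hq.1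
      rcases eq_or_ne (e.symm (κ q)) q with h3 | h3
      · simp only [h3] at h1 ⊢
        field_simp
      · simp only [h.eq_neg hq.2.1.1 h2 h3, h'.eq_neg hq.2.1.2 h2 h3] at h1 ⊢
        have := neg_ne_zero.1 h1
        field_simp

/-- The ratio of two roots descends to a smooth nonvanishing function on `N`. -/
theorem exists_ratio (h : IsBranchRoot κ B U t σ) (h' : IsBranchRoot κ B U' t' σ')
    (hκ : IsTwoFoldCover κ B) :
    ∃ r : N → ℂ, ContMDiffOn (𝓡 (m + 2)) 𝓘(ℝ, ℂ) ∞ r (U ∩ U') ∧ (∀ y ∈ U ∩ U', r y ≠ 0) ∧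
      ∀ p, κ p ∈ U ∩ U' → t' p = r (κ p) * t p := by
  choose! V hV hxV r hr hr0 hrt using fun (x : N) (hx : x ∈ U ∩ U') =>
    h.exists_local_ratio h' hκ hx
  have hloc : ∀ x ∈ U ∩ U', ∀ y ∈ U ∩ U', y ∈ V x → r y y = r x y := by
    intro x hx y hy hyx
    refine h.ratio_unique (t' := t') hκ hy.1
      ((hr y hy).continuousOn.continuousAt ((hV y hy).mem_nhds (hxV y hy)))
      ((hr x hx).continuousOn.continuousAt ((hV x hx).mem_nhds hyx)) ?_ ?_
    · filter_upwards [(hV y hy).mem_nhds (hxV y hy)] with u hu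
      rintro p rfl
      exact hrt y hy p hu
    · filter_upwards [(hV x hx).mem_nhds hyx] with u hu
      rintro p rfl
      exact hrt x hx p hu
  refine ⟨fun x => r x x, fun x hx => ?_, fun x hx => hr0 x hx x (hxV x hx),
    fun p hp => hrt _ hp p (hxV _ hp)⟩
  refine (((hr x hx).contMDiffAt ((hV x hx).mem_nhds (hxV x hx))).congr_of_eventuallyEq
    ?_).contMDiffWithinAt
  filter_upwards [(hV x hx).mem_nhds (hxV x hx), (h.isOpen.inter h'.isOpen).mem_nhds hx] with
    y hy hy'
  exact hloc x hx y hy' hy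

end IsBranchRoot

end Roots

/-! ### Isomorphisms of line bundles -/

namespace ComplexLineBundle

section Trivializations

variable {n : ℕ} {N : Type u} [TopologicalSpace N] [ChartedSpace (EuclideanSpace ℝ (Fin n)) N]
  (L : ComplexLineBundle.{u, v} n N)

variable {L} in
theorem triv_smul (e : Trivialization ℂ (TotalSpace.proj : L.Total → N)) [MemTrivializationAtlas e]
    {x : N} (hx : x ∈ e.baseSet) (c : ℂ) (v : L.Fiber x) :
    (e ⟨x, c • v⟩).2 = c * (e ⟨x, v⟩).2 := by
  have h : ∀ v, e.linearMapAt ℂ x v = (e ⟨x, v⟩).2 := congrFun (e.coe_linearMapAt_of_mem hx)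
  rw [← h, ← h, map_smul, smul_eq_mul]

variable {L} in
theorem triv_injective (e : Trivialization ℂ (TotalSpace.proj : L.Total → N)) {x : N}
    (hx : x ∈ e.baseSet) {v v' : L.Fiber x} (h : (e ⟨x, v⟩).2 = (e ⟨x, v'⟩).2) : v = v' := by
  have h1 : (⟨x, v⟩ : L.Total) ∈ e.source := e.mem_source.2 hx
  have h2 : (⟨x, v'⟩ : L.Total) ∈ e.source := e.mem_source.2 hx
  have h3 := e.injOn h1 h2 (Prod.ext ((e.coe_fst h1).trans (e.coe_fst h2).symm) h)
  exact eq_of_heq (TotalSpace.mk.inj h3).2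

theorem sqCoord_tmul (e : Trivialization ℂ (TotalSpace.proj : L.Total → N))
    [MemTrivializationAtlas e] {x : N} (hx : x ∈ e.baseSet) (v v' : L.Fiber x) :
    L.sqCoord e x (v ⊗ₜ v') = (e ⟨x, v⟩).2 * (e ⟨x, v'⟩).2 := by
  simp [sqCoord, e.coe_linearMapAt_of_mem (R := ℂ) hx]

theorem triv_zero (e : Trivialization ℂ (TotalSpace.proj : L.Total → N)) [MemTrivializationAtlas e]
    {x : N} (hx : x ∈ e.baseSet) : (e ⟨x, (0 : L.Fiber x)⟩).2 = 0 := by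
  have := triv_smul e hx 0 0
  rwa [zero_smul, zero_mul] at this

/-- The coordinates in two trivializations differ by a continuous function. -/
theorem exists_triv_eq_mul (e e' : Trivialization ℂ (TotalSpace.proj : L.Total → N))
    [MemTrivializationAtlas e] [MemTrivializationAtlas e'] :
    ∃ c : N → ℂ, ContinuousOn c (e.baseSet ∩ e'.baseSet) ∧
      ∀ x ∈ e.baseSet ∩ e'.baseSet, ∀ v : L.Fiber x, (e' ⟨x, v⟩).2 = c x * (e ⟨x, v⟩).2 := by
  refine ⟨fun x => e.coordChangeL ℂ e' x 1,
    (continuousOn_coordChange ℂ e e').clm_apply continuousOn_const, fun x hx v => ?_⟩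
  have h1 : e.coordChangeL ℂ e' x ((e ⟨x, v⟩).2) = (e' ⟨x, v⟩).2 := by
    rw [e.coordChangeL_apply e' hx, e.symm_apply_apply_mk hx.1]
  rw [← h1]
  conv_lhs => rw [show (e ⟨x, v⟩).2 = (e ⟨x, v⟩).2 • (1 : ℂ) by simp, map_smul, smul_eq_mul]
  rw [mul_comm]

variable {L}

/-- Every vector in a fibre is a multiple of a nonzero vector of this fibre. -/
theorem exists_eq_smul {x : N} {v : L.Fiber x} (hv : v ≠ 0) (u : L.Fiber x) :
    ∃ c : ℂ, u = c • v := by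
  let e := trivializationAt ℂ L.Fiber x
  have hx : x ∈ e.baseSet := mem_baseSet_trivializationAt ℂ L.Fiber x
  have h0 : (e ⟨x, v⟩).2 ≠ 0 := fun h => hv (triv_injective e hx (h.trans (L.triv_zero e hx).symm))
  refine ⟨(e ⟨x, u⟩).2 / (e ⟨x, v⟩).2, triv_injective e hx ?_⟩
  rw [triv_smul e hx]
  field_simp

variable {L' : ComplexLineBundle.{u, w} n N}

/-- A family of linear isomorphisms that is given by smooth functions in local trivializations is
smooth. -/
theorem contMDiff_totalMap [IsManifold (𝓡 n) ∞ N] {Φ : ∀ x, L.Fiber x ≃ₗ[ℂ] L'.Fiber x}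
    (h : ∀ x₀ : N, ∃ r : N → ℂ, ContMDiffAt (𝓡 n) 𝓘(ℝ, ℂ) ∞ r x₀ ∧ ∀ᶠ x in 𝓝 x₀, ∀ v : L.Fiber x,
      (trivializationAt ℂ L'.Fiber x₀ ⟨x, Φ x v⟩).2 = r x * (trivializationAt ℂ L.Fiber x₀ ⟨x, v⟩).2) :
    ContMDiff ((𝓡 n).prod 𝓘(ℝ, ℂ)) ((𝓡 n).prod 𝓘(ℝ, ℂ)) ∞ (totalMap Φ) := by
  intro t
  obtain ⟨r, hr, hrt⟩ := h t.proj
  have hb := mem_baseSet_trivializationAt ℂ L.Fiber t.proj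
  have hb' := mem_baseSet_trivializationAt ℂ L'.Fiber t.proj
  have hp : ContMDiffAt ((𝓡 n).prod 𝓘(ℝ, ℂ)) (𝓡 n) ∞ (TotalSpace.proj : L.Total → N) t :=
    contMDiffAt_proj L.Fiber
  refine ((trivializationAt ℂ L'.Fiber t.proj).contMDiffAt_iff
    ((Trivialization.mem_source _).2 hb')).2 ⟨hp, ?_⟩
  have h1 : ContMDiffAt ((𝓡 n).prod 𝓘(ℝ, ℂ)) 𝓘(ℝ, ℂ) ∞
      (fun t' : L.Total => (trivializationAt ℂ L.Fiber t.proj t').2) t :=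
    (((trivializationAt ℂ L.Fiber t.proj).contMDiffAt_iff
      ((Trivialization.mem_source _).2 hb)).1 contMDiffAt_id).2
  have h2 : ContMDiffAt ((𝓡 n).prod 𝓘(ℝ, ℂ)) 𝓘(ℝ, ℂ) ∞ (fun t' : L.Total => r t'.proj) t :=
    hr.comp t hp
  have h3 : ContMDiffAt ((𝓡 n).prod 𝓘(ℝ, ℂ)) 𝓘(ℝ, ℂ) ∞ (fun t' : L.Total =>
      r t'.proj * (trivializationAt ℂ L.Fiber t.proj t').2) t :=
    ContMDiffWithinAt.complex_mul h2 h1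
  refine h3.congr_of_eventuallyEq ?_
  filter_upwards [hp.continuousAt.eventually hrt] with t' ht' using ht' t'.2

end Trivializations

section Cover

variable {m : ℕ} {M : Type*} {N : Type u} [TopologicalSpace M] [TopologicalSpace N]
  [ChartedSpace (EuclideanSpace ℝ (Fin (m + 2))) M]
  [ChartedSpace (EuclideanSpace ℝ (Fin (m + 2))) N]
  {κ : M → N} {B : OrientedCodimTwoSubmanifold m N}
  {L : ComplexLineBundle.{u, v} (m + 2) N} {s : ∀ x, L.SqFiber x} {f : M → L.Total}

theorem IsDiffeoOver.sq_eq (hf : L.IsDiffeoOver κ s f) (p : M) :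
    (f p).2 ⊗ₜ[ℂ] (f p).2 = s (f p).1 := by
  have : f p ∈ L.branchedCover s := hf.range_eq ▸ Set.mem_range_self p
  exact this

/-- In a trivialization of `L`, a diffeomorphism with `M_{L,s}` is a branch root. -/
theorem IsDiffeoOver.isBranchRoot (hf : L.IsDiffeoOver κ s f) (hκ : IsTwoFoldCover κ B)
    (hs : L.IsSmoothSqSection s) (hB : L.HasZeroLocus s B)
    (e : Trivialization ℂ (TotalSpace.proj : L.Total → N)) [MemTrivializationAtlas e]
    [IsManifold (𝓡 (m + 2)) ∞ N] :
    IsBranchRoot κ B e.baseSet (fun p => (e (f p)).2) (fun x => L.sqCoord e x (s x)) where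
  isOpen := e.open_baseSet
  smooth_root := by
    intro p hp
    have hp' : f p ∈ e.source := e.mem_source.2 (by rw [hf.proj_comp]; exact hp)
    exact ((e.contMDiffAt_iff hp').1 (hf.isSmoothEmbedding.contMDiff p)).2.contMDiffWithinAt
  smooth_sq := hs e
  sq_eq p hp := by
    rw [← hf.proj_comp p] at hp ⊢
    rw [← hf.sq_eq, L.sqCoord_tmul e hp, sq]
  inj p q hp hpq h := by
    have hp' : f p ∈ e.source := e.mem_source.2 (by rw [hf.proj_comp]; exact hp)
    have hq' : f q ∈ e.source := e.mem_source.2 (by rw [hf.proj_comp, hpq]; exact hp)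
    refine hf.isSmoothEmbedding.isEmbedding.injective (e.injOn hq' hp' (Prod.ext ?_ h))
    exact (e.coe_fst hq').trans (((hf.proj_comp q).trans (hpq.trans (hf.proj_comp p).symm)).trans
      (e.coe_fst hp').symm)
  eq_zero_iff x hx := by
    obtain ⟨p, rfl⟩ := hκ.surjective x
    rw [← hB.1]
    refine ⟨fun h => ?_, fun h => by rw [h, map_zero]⟩
    rw [← hf.proj_comp p] at hx h ⊢
    change L.sqCoord e _ (s (f p).1) = _ at h
    rw [← hf.sq_eq, L.sqCoord_tmul e hx, mul_self_eq_zero] at h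
    have h0 : (f p).2 = 0 := triv_injective e hx (h.trans (L.triv_zero e hx).symm)
    rw [← hf.sq_eq, h0, TensorProduct.tmul_zero]
  normalJacobian_pos x hx hxB ψ hψ hxψ := hB.2 e ψ hψ x hxB hxψ hx

theorem IsDiffeoOver.ne_zero (hf : L.IsDiffeoOver κ s f) (hB : L.HasZeroLocus s B) {p : M}
    (hp : κ p ∉ B.carrier) : (f p).2 ≠ 0 := by
  intro h0
  have h := hf.sq_eq p
  rw [h0, TensorProduct.tmul_zero] at h
  apply hp
  rw [← hf.proj_comp]
  exact (hB.1 _).1 h.symm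

variable {L' : ComplexLineBundle.{u, w} (m + 2) N} {s' : ∀ x, L'.SqFiber x} {f' : M → L'.Total}

/-- Two isomorphisms that are compatible with `f` and `f'` agree outside of the branch locus, where
`f` does not vanish, and by continuity everywhere. -/
theorem isomorphism_unique (hκ : IsTwoFoldCover κ B) (hB : L.HasZeroLocus s B)
    (hf : L.IsDiffeoOver κ s f) {Φ₁ Φ₂ : ∀ x, L.Fiber x ≃ₗ[ℂ] L'.Fiber x}
    (h₁ : Continuous (totalMap Φ₁)) (h₂ : Continuous (totalMap Φ₂))
    (h : ∀ p, totalMap Φ₁ (f p) = totalMap Φ₂ (f p)) : Φ₁ = Φ₂ := by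
  have key : ∀ y ∉ B.carrier, ∀ v, Φ₁ y v = Φ₂ y v := by
    intro y hy
    obtain ⟨p, rfl⟩ := hκ.surjective y
    have hne := hf.ne_zero hB hy
    rw [← hf.proj_comp p]
    intro v
    obtain ⟨c, rfl⟩ := exists_eq_smul hne v
    have h1 : Φ₁ _ (f p).2 = Φ₂ _ (f p).2 := eq_of_heq (TotalSpace.mk.inj (h p)).2
    change Φ₁ (f p).1 (c • (f p).2) = Φ₂ (f p).1 (c • (f p).2)
    rw [map_smul, map_smul, h1]
  funext x
  refine LinearEquiv.ext fun v => ?_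
  set e := trivializationAt ℂ L.Fiber x with he
  set e' := trivializationAt ℂ L'.Fiber x with he'
  have hx : x ∈ e.baseSet := mem_baseSet_trivializationAt ℂ L.Fiber x
  have hx' : x ∈ e'.baseSet := mem_baseSet_trivializationAt ℂ L'.Fiber x
  -- a continuous extension of `v` to a local section
  let σ : N → L.Total := fun y => e.toOpenPartialHomeomorph.symm (y, (e ⟨x, v⟩).2)
  have hσx : σ x = ⟨x, v⟩ := by
    have h1 : (⟨x, v⟩ : L.Total) ∈ e.source := e.mem_source.2 hx
    have h2 : e ⟨x, v⟩ = (x, (e ⟨x, v⟩).2) := Prod.ext (e.coe_fst h1) rfl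
    simp only [σ, ← h2]
    exact e.toOpenPartialHomeomorph.left_inv h1
  have hσ : ContinuousAt σ x := by
    have h1 : (x, (e ⟨x, v⟩).2) ∈ e.target := e.mem_target.2 hx
    exact ContinuousAt.comp (g := e.toOpenPartialHomeomorph.symm)
      (f := fun y => (y, (e ⟨x, v⟩).2)) (e.toOpenPartialHomeomorph.continuousAt_symm h1)
      (by fun_prop)
  have hg : ∀ {Φ : ∀ x, L.Fiber x ≃ₗ[ℂ] L'.Fiber x}, Continuous (totalMap Φ) →
      ContinuousAt (fun y => (e' (totalMap Φ (σ y))).2) x := by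
    intro Φ hΦ
    have h1 : totalMap Φ (σ x) ∈ e'.source := by
      rw [hσx]
      exact e'.mem_source.2 hx'
    exact (ContinuousAt.comp (g := e') (f := fun y => totalMap Φ (σ y))
      (e'.continuousOn.continuousAt (e'.open_source.mem_nhds h1))
      (hΦ.continuousAt.comp hσ)).snd
  have heq := tendsto_nhds_unique_of_frequently_eq (hg h₁) (hg h₂) (by
    have hfr : ∃ᶠ y in 𝓝 x, y ∉ B.carrier :=
      mem_closure_iff_frequently.1 (B.dense_compl_carrier x)
    refine (hfr.and_eventually (e.open_baseSet.mem_nhds hx)).mono ?_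
    rintro y ⟨hyB, hye⟩
    have h1 : (σ y).1 = y := e.proj_symm_apply (e.mem_target.2 hye)
    have h2 : totalMap Φ₁ (σ y) = totalMap Φ₂ (σ y) := by
      simp only [totalMap]
      rw [key _ (by rwa [h1])]
    rw [h2])
  simp only [hσx] at heq
  exact triv_injective e' hx' heq

variable [IsManifold (𝓡 (m + 2)) ∞ M] [IsManifold (𝓡 (m + 2)) ∞ N] [T2Space M]

/-- In local trivializations, the isomorphism is multiplication by the ratio of two branch roots. -/
theorem exists_isomorphism (hκ : IsTwoFoldCover κ B) (hs : L.IsSmoothSqSection s)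
    (hB : L.HasZeroLocus s B) (hf : L.IsDiffeoOver κ s f) (hs' : L'.IsSmoothSqSection s')
    (hB' : L'.HasZeroLocus s' B) (hf' : L'.IsDiffeoOver κ s' f') :
    ∃ Φ : ∀ x, L.Fiber x ≃ₗ[ℂ] L'.Fiber x, IsSmoothIso Φ ∧ ∀ p, totalMap Φ (f p) = f' p := by
  have hroot := fun x => hf.isBranchRoot hκ hs hB (trivializationAt ℂ L.Fiber x)
  have hroot' := fun x => hf'.isBranchRoot hκ hs' hB' (trivializationAt ℂ L'.Fiber x)
  choose r hr hr0 hrt using fun x => (hroot x).exists_ratio (hroot' x) hκ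
  have hx := fun x : N => mem_baseSet_trivializationAt ℂ L.Fiber x
  have hx' := fun x : N => mem_baseSet_trivializationAt ℂ L'.Fiber x
  have hopen := fun x => ((hroot x).isOpen.inter (hroot' x).isOpen)
  let Φ : ∀ x, L.Fiber x ≃ₗ[ℂ] L'.Fiber x := fun x =>
    (((trivializationAt ℂ L.Fiber x).linearEquivAt ℂ x (hx x)).trans
      (LinearEquiv.smulOfNeZero ℂ ℂ (r x x) (hr0 x x ⟨hx x, hx' x⟩))).trans
      ((trivializationAt ℂ L'.Fiber x).linearEquivAt ℂ x (hx' x)).symm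
  have hΦ0 : ∀ x (v : L.Fiber x), (trivializationAt ℂ L'.Fiber x ⟨x, Φ x v⟩).2 =
      r x x * (trivializationAt ℂ L.Fiber x ⟨x, v⟩).2 := by
    intro x v
    rw [← Trivialization.linearEquivAt_apply (R := ℂ) _ _ (hx' x),
      ← Trivialization.linearEquivAt_apply (R := ℂ) _ _ (hx x)]
    simp only [Φ, LinearEquiv.trans_apply, LinearEquiv.apply_symm_apply]
    rfl
  have hΦ : ∀ x₀, ∀ x ∈ (trivializationAt ℂ L.Fiber x₀).baseSet ∩
      (trivializationAt ℂ L'.Fiber x₀).baseSet, ∀ v : L.Fiber x,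
      (trivializationAt ℂ L'.Fiber x₀ ⟨x, Φ x v⟩).2 =
        r x₀ x * (trivializationAt ℂ L.Fiber x₀ ⟨x, v⟩).2 := by
    intro x₀ x hx₀ v
    obtain ⟨c, hc, hce⟩ := L.exists_triv_eq_mul (trivializationAt ℂ L.Fiber x)
      (trivializationAt ℂ L.Fiber x₀)
    obtain ⟨c', hc', hce'⟩ := L'.exists_triv_eq_mul (trivializationAt ℂ L'.Fiber x)
      (trivializationAt ℂ L'.Fiber x₀)
    have hU := ((hroot x).isOpen.inter (hroot x₀).isOpen).mem_nhds ⟨hx x, hx₀.1⟩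
    have hU' := ((hroot' x).isOpen.inter (hroot' x₀).isOpen).mem_nhds ⟨hx' x, hx₀.2⟩
    -- both sides are the ratio of the roots of `L'` at `x₀` and of `L` at `x`
    have key := (hroot x).ratio_unique (t' := fun p => (trivializationAt ℂ L'.Fiber x₀ (f' p)).2) hκ
      (hx x) (r₁ := fun y => c' y * r x y) (r₂ := fun y => r x₀ y * c y)
      ((hc'.continuousAt hU').mul ((hr x).continuousOn.continuousAt
        ((hopen x).mem_nhds ⟨hx x, hx' x⟩)))
      (((hr x₀).continuousOn.continuousAt ((hopen x₀).mem_nhds hx₀)).mul (hc.continuousAt hU))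
      (by
        filter_upwards [hU, hU'] with y hy hy'
        rintro p rfl
        rw [mul_assoc, ← hrt x p ⟨hy.1, hy'.1⟩, ← hf'.proj_comp p]
        exact hce' (f' p).1 (by rw [hf'.proj_comp]; exact hy') (f' p).2)
      (by
        filter_upwards [hU, hU'] with y hy hy'
        rintro p rfl
        rw [hrt x₀ p ⟨hy.2, hy'.2⟩, mul_assoc]
        refine congrArg _ ?_
        rw [← hf.proj_comp p]
        exact hce (f p).1 (by rw [hf.proj_comp]; exact hy) (f p).2)
    rw [hce' x ⟨hx' x, hx₀.2⟩, hΦ0, hce x ⟨hx x, hx₀.1⟩, ← mul_assoc, ← mul_assoc, key]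
  refine ⟨Φ, ⟨contMDiff_totalMap fun x₀ => ⟨r x₀, ?_, ?_⟩,
    contMDiff_totalMap fun x₀ => ⟨fun x => (r x₀ x)⁻¹, ?_, ?_⟩⟩, fun p => ?_⟩
  · exact (hr x₀).contMDiffAt ((hopen x₀).mem_nhds ⟨hx x₀, hx' x₀⟩)
  · filter_upwards [(hopen x₀).mem_nhds ⟨hx x₀, hx' x₀⟩] with x hxx using hΦ x₀ x hxx
  · exact ContMDiffAt.comp (g := fun z : ℂ => z⁻¹) x₀
      (contDiffAt_inv ℝ (hr0 x₀ x₀ ⟨hx x₀, hx' x₀⟩)).contMDiffAt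
      ((hr x₀).contMDiffAt ((hopen x₀).mem_nhds ⟨hx x₀, hx' x₀⟩))
  · filter_upwards [(hopen x₀).mem_nhds ⟨hx x₀, hx' x₀⟩] with x hxx v
    have h1 := hΦ x₀ x hxx ((Φ x).symm v)
    rw [LinearEquiv.apply_symm_apply] at h1
    have := hr0 x₀ x hxx
    rw [h1]
    field_simp
  · have hfp := hf.proj_comp p
    have hfp' := hf'.proj_comp p
    have h1 : totalMap Φ (f p) ∈ (trivializationAt ℂ L'.Fiber (κ p)).source := by
      refine (Trivialization.mem_source _).2 ?_
      change (f p).proj ∈ _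
      rw [hfp]
      exact hx' _
    have h2 : f' p ∈ (trivializationAt ℂ L'.Fiber (κ p)).source := by
      refine (Trivialization.mem_source _).2 ?_
      rw [hfp']
      exact hx' _
    refine (trivializationAt ℂ L'.Fiber (κ p)).injOn h1 h2 (Prod.ext ?_ ?_)
    · exact (Trivialization.coe_fst _ h1).trans ((hfp.trans hfp'.symm).trans
        (Trivialization.coe_fst _ h2).symm)
    · have h3 := hrt (κ p) p ⟨hx _, hx' _⟩
      have h4 := hΦ (κ p) (f p).1 (by rw [hfp]; exact ⟨hx _, hx' _⟩) (f p).2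
      exact h4.trans ((congrArg (fun y => r (κ p) y * _) hfp).trans h3.symm)

/-- The pair `(L, s)` is unique up to unique isomorphism. -/
theorem existsUnique_isomorphism (hκ : IsTwoFoldCover κ B) (hs : L.IsSmoothSqSection s)
    (hB : L.HasZeroLocus s B) (hf : L.IsDiffeoOver κ s f) (hs' : L'.IsSmoothSqSection s')
    (hB' : L'.HasZeroLocus s' B) (hf' : L'.IsDiffeoOver κ s' f') :
    ∃! Φ : ∀ x, L.Fiber x ≃ₗ[ℂ] L'.Fiber x, IsSmoothIso Φ ∧
      (∀ x, TensorProduct.map (Φ x).toLinearMap (Φ x).toLinearMap (s x) = s' x) ∧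
      ∀ p, totalMap Φ (f p) = f' p := by
  obtain ⟨Φ, hΦ, hΦf⟩ := exists_isomorphism hκ hs hB hf hs' hB' hf'
  refine ⟨Φ, ⟨hΦ, fun x => ?_, hΦf⟩, fun Φ' hΦ' => ?_⟩
  · obtain ⟨p, rfl⟩ := hκ.surjective x
    rw [← hf.proj_comp p]
    have h1 := hf'.sq_eq p
    rw [← hΦf p] at h1
    change TensorProduct.map _ _ (s (f p).1) = s' (f p).1
    rw [← hf.sq_eq p, TensorProduct.map_tmul]
    exact h1
  · exact isomorphism_unique hκ hB hf hΦ'.1.1.continuous hΦ.1.continuous fun p => by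
      rw [hΦ'.2.2, hΦf]

end Cover

end ComplexLineBundle

/-! ### Embeddings given by local slices -/

section Slices

variable {M X : Type*} [TopologicalSpace M] [TopologicalSpace X]

/-- The image of `f` is a slice near `f p`: there are charts `Φ` of `M` around `p` and `Θ` of `X`
around `f p` in which `f` is the inclusion `a ↦ (a, 0)`, and only the points of the domain of `Φ`
are mapped to the domain of `Θ`. -/
def HasSliceChartAt (n : ℕ) [ChartedSpace (EuclideanSpace ℝ (Fin n)) M]
    [ChartedSpace (ModelProd (EuclideanSpace ℝ (Fin n)) ℂ) X] (f : M → X) (p : M) : Prop :=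
  ∃ (Φ : OpenPartialHomeomorph M (EuclideanSpace ℝ (Fin n)))
    (Θ : OpenPartialHomeomorph X (EuclideanSpace ℝ (Fin n) × ℂ)),
    IsPartialDiffeo (𝓡 n) (𝓡 n) Φ ∧
    IsPartialDiffeo ((𝓡 n).prod 𝓘(ℝ, ℂ)) 𝓘(ℝ, EuclideanSpace ℝ (Fin n) × ℂ) Θ ∧
    p ∈ Φ.source ∧ f p ∈ Θ.source ∧ ∀ q, f q ∈ Θ.source → q ∈ Φ.source ∧ Θ (f q) = (Φ q, 0)

theorem isSmoothEmbedding_of_hasSliceChartAt {n : ℕ}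
    [ChartedSpace (EuclideanSpace ℝ (Fin n)) M]
    [ChartedSpace (ModelProd (EuclideanSpace ℝ (Fin n)) ℂ) X] [IsManifold (𝓡 n) ∞ M]
    [IsManifold ((𝓡 n).prod 𝓘(ℝ, ℂ)) ∞ X] {f : M → X} (hf : Continuous f)
    (h : ∀ p, HasSliceChartAt n f p) : IsSmoothEmbedding (𝓡 n) ((𝓡 n).prod 𝓘(ℝ, ℂ)) ∞ f := by
  refine ⟨⟨ℂ, inferInstance, inferInstance, fun p => ?_⟩, ⟨⟨?_⟩, fun p q hpq => ?_⟩⟩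
  · obtain ⟨Φ, Θ, hΦ, hΘ, hp, hfp, hslice⟩ := h p
    have hO : IsOpen (f ⁻¹' Θ.source) := Θ.open_source.preimage hf
    have hΦ' := hΦ.restrOpen hO
    rw [modelWithCornersSelf_prod] at hΘ
    refine IsImmersionAtOfComplement.mk_of_continuousAt hf.continuousAt
      (ContinuousLinearEquiv.refl ℝ _) (Φ.restrOpen _ hO) Θ ⟨hp, hfp⟩ hfp
      (OpenPartialHomeomorph.mem_maximalAtlas_of_contMDiffOn _ hΦ'.1 hΦ'.2)
      (OpenPartialHomeomorph.mem_maximalAtlas_of_contMDiffOn _ hΘ.1 hΘ.2) ?_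
    intro a ha
    have ha' : a ∈ (Φ.restrOpen _ hO).target := by simpa using ha
    have h1 := (Φ.restrOpen _ hO).map_target ha'
    have h2 := (Φ.restrOpen _ hO).right_inv ha'
    have h3 := (hslice _ h1.2).2
    exact h3.trans (Prod.ext h2 rfl)
  · refine le_antisymm (continuous_iff_le_induced.1 hf) ?_
    refine le_of_nhds_le_nhds fun p => ?_
    rw [nhds_induced]
    obtain ⟨Φ, Θ, -, -, hp, hfp, hslice⟩ := h p
    have hΘp := (hslice p hfp).2
    -- `Φ.symm ∘ fst ∘ Θ` is a continuous left inverse of `f` near `f p`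
    have hg : Filter.Tendsto (fun x => Φ.symm (Θ x).1) (𝓝 (f p)) (𝓝 p) := by
      have h1 : Filter.Tendsto (fun x => (Θ x).1) (𝓝 (f p)) (𝓝 (Φ p)) := by
        have := (Θ.continuousAt hfp).fst
        rwa [ContinuousAt, hΘp] at this
      exact (Φ.tendsto_symm hp).comp h1
    intro V hV
    refine ⟨_, Filter.inter_mem (hg hV) (Θ.open_source.mem_nhds hfp), fun q hq => ?_⟩
    obtain ⟨h1, h2⟩ := hslice q hq.2
    have h3 : Φ.symm (Θ (f q)).1 ∈ V := hq.1
    rwa [h2, Φ.left_inv h1] at h3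
  · obtain ⟨Φ, Θ, -, -, hp, hfp, hslice⟩ := h p
    obtain ⟨h1, h2⟩ := hslice q (hpq ▸ hfp)
    refine Φ.injOn hp h1 (congrArg Prod.fst (?_ : (Φ p, (0 : ℂ)) = (Φ q, 0)))
    rw [← (hslice p hfp).2, ← h2, hpq]

end Slices

section Shear

variable {n : ℕ} {N E : Type*} [TopologicalSpace N] [ChartedSpace (EuclideanSpace ℝ (Fin n)) N]
  [NormedAddCommGroup E] [NormedSpace ℝ E]

/-- The chart `(y, τ) ↦ (g y, τ - a y)` of `N × ℂ` given by a chart `g` of `N` and a function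
`a`. -/
def shearChart (g : OpenPartialHomeomorph N E) (a : N → ℂ) (ha : ContinuousOn a g.source) :
    OpenPartialHomeomorph (N × ℂ) (E × ℂ) where
  toFun x := (g x.1, x.2 - a x.1)
  invFun x := (g.symm x.1, x.2 + a (g.symm x.1))
  source := g.source ×ˢ Set.univ
  target := g.target ×ˢ Set.univ
  map_source' x hx := ⟨g.map_source hx.1, trivial⟩
  map_target' x hx := ⟨g.map_target hx.1, trivial⟩
  left_inv' x hx := by simp [g.left_inv hx.1]
  right_inv' x hx := by simp [g.right_inv hx.1]
  open_source := g.open_source.prod isOpen_univ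
  open_target := g.open_target.prod isOpen_univ
  continuousOn_toFun := (g.continuousOn.comp continuousOn_fst fun x hx => hx.1).prodMk
    (continuousOn_snd.sub (ha.comp continuousOn_fst fun x hx => hx.1))
  continuousOn_invFun := by
    have h : ContinuousOn (fun x : E × ℂ => g.symm x.1) (g.target ×ˢ Set.univ) :=
      g.continuousOn_symm.comp continuousOn_fst fun x hx => hx.1
    exact h.prodMk (continuousOn_snd.add (ha.comp h fun x hx => g.map_target hx.1))

theorem isPartialDiffeo_shearChart {g : OpenPartialHomeomorph N E}
    (hg : IsPartialDiffeo (𝓡 n) 𝓘(ℝ, E) g) {a : N → ℂ}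
    (ha : ContMDiffOn (𝓡 n) 𝓘(ℝ, ℂ) ∞ a g.source) :
    IsPartialDiffeo ((𝓡 n).prod 𝓘(ℝ, ℂ)) 𝓘(ℝ, E × ℂ) (shearChart g a ha.continuousOn) := by
  constructor
  · exact (hg.1.comp contMDiffOn_fst fun x hx => hx.1).prodMk_space
      (contMDiffOn_snd.sub (ha.comp contMDiffOn_fst fun x hx => hx.1))
  · have h : ContMDiffOn 𝓘(ℝ, E × ℂ) (𝓡 n) ∞ (fun x : E × ℂ => g.symm x.1)
        (g.target ×ˢ Set.univ) :=
      hg.2.comp contDiff_fst.contMDiff.contMDiffOn fun x hx => hx.1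
    exact h.prodMk (contDiff_snd.contMDiff.contMDiffOn.add
      (ha.comp h fun x hx => g.map_target hx.1))

end Shear

/-! ### Existence of local square roots -/

section LocalRoots

variable {m : ℕ} {M N : Type*} [TopologicalSpace M] [TopologicalSpace N]
  [ChartedSpace (EuclideanSpace ℝ (Fin (m + 2))) M]
  [ChartedSpace (EuclideanSpace ℝ (Fin (m + 2))) N]
  [IsManifold (𝓡 (m + 2)) ∞ M] [IsManifold (𝓡 (m + 2)) ∞ N]
  {κ : M → N} {B : OrientedCodimTwoSubmanifold m N}

/-- Outside of the branch locus, `(κ, t)` is locally the graph of the function `t` on one of the two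
sheets; the other sheet is where `t` has the opposite sign. -/
theorem IsBranchRoot.hasSliceChartAt {U : Set N} {t : M → ℂ} {σ : N → ℂ}
    (h : IsBranchRoot κ B U t σ) (hκ : IsTwoFoldCover κ B) {p : M} (hp : κ p ∈ U)
    (hpB : κ p ∉ B.carrier) : HasSliceChartAt (m + 2) (fun q => (κ q, t q)) p := by
  obtain ⟨e, he, hpe, heκ⟩ := hκ.exists_isPartialDiffeo hpB
  have hκe : ∀ y ∈ e.target, κ (e.symm y) = y := fun y hy => by
    rw [← heκ _ (e.map_target hy), e.right_inv hy]
  have hsymm : e.symm (κ p) = p := by rw [← heκ p hpe, e.left_inv hpe]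
  have hχ : IsPartialDiffeo (𝓡 (m + 2)) (𝓡 (m + 2))
      (chartAt (EuclideanSpace ℝ (Fin (m + 2))) p) :=
    (IsManifold.mem_maximalAtlas_iff_contMDiffOn _).1 (IsManifold.chart_mem_maximalAtlas p)
  set χ := chartAt (EuclideanSpace ℝ (Fin (m + 2))) p
  let g := (e.symm.trans χ).restrOpen U h.isOpen
  have hg : IsPartialDiffeo (𝓡 (m + 2)) (𝓡 (m + 2)) g := (he.symm.trans hχ).restrOpen h.isOpen
  have hgs : ∀ y, y ∈ g.source ↔ (y ∈ e.target ∧ e.symm y ∈ χ.source) ∧ y ∈ U := fun y => by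
    simp [g]
  have ha : ContMDiffOn (𝓡 (m + 2)) 𝓘(ℝ, ℂ) ∞ (fun y => t (e.symm y)) g.source := by
    refine h.smooth_root.comp (he.2.mono fun y hy => ((hgs y).1 hy).1.1) fun y hy => ?_
    rw [Set.mem_preimage, Set.mem_preimage, hκe y ((hgs y).1 hy).1.1]
    exact ((hgs y).1 hy).2
  have hO : IsOpen (g.source ×ˢ Set.univ ∩ (fun x : N × ℂ => x.2 + t (e.symm x.1)) ⁻¹' {0}ᶜ) :=
    (continuousOn_snd.add (ha.continuousOn.comp continuousOn_fst fun x hx =>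
      hx.1)).isOpen_inter_preimage (g.open_source.prod isOpen_univ) isOpen_compl_singleton
  refine ⟨χ, (shearChart g _ ha.continuousOn).restrOpen _ hO, hχ,
    (isPartialDiffeo_shearChart hg ha).restrOpen hO, mem_chart_source _ p, ?_, fun q hq => ?_⟩
  · have hpg : κ p ∈ g.source := (hgs _).2
      ⟨⟨heκ p hpe ▸ e.map_source hpe, by rw [hsymm]; exact mem_chart_source _ p⟩, hp⟩
    refine ⟨⟨hpg, trivial⟩, ⟨hpg, trivial⟩, ?_⟩
    have := h.ne_zero hp hpB
    simpa [hsymm, ← two_mul] using this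
  · have hqg : κ q ∈ g.source := hq.1.1
    have hne : t q + t (e.symm (κ q)) ≠ 0 := hq.2.2
    obtain ⟨⟨h1, h2⟩, h3⟩ := (hgs _).1 hqg
    have h4 : e.symm (κ q) = q := by
      by_contra h5
      exact hne (by rw [h.eq_neg h3 (hκe _ h1) h5, add_neg_cancel])
    refine ⟨h4 ▸ h2, ?_⟩
    change (χ (e.symm (κ q)), t q - t (e.symm (κ q))) = _
    rw [h4, sub_self]

/-- The coordinate change `((ζ, w), τ) ↦ ((τ, w), ζ - τ²)`, which straightens the parabola
`ζ = τ²`. -/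
noncomputable def parabolaHomeomorph (m : ℕ) :
    (ℂ × EuclideanSpace ℝ (Fin m)) × ℂ ≃ₜ EuclideanSpace ℝ (Fin (m + 2)) × ℂ where
  toFun x := ((splitCoord m).symm (x.2, x.1.2), x.1.1 - x.2 ^ 2)
  invFun x := ((x.2 + (splitCoord m x.1).1 ^ 2, (splitCoord m x.1).2), (splitCoord m x.1).1)
  left_inv x := by simp
  right_inv x := by simp
  continuous_toFun := by fun_prop
  continuous_invFun := by
    generalize splitCoord m = e
    fun_prop

theorem isPartialDiffeo_parabolaHomeomorph (m : ℕ) :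
    IsPartialDiffeo 𝓘(ℝ, (ℂ × EuclideanSpace ℝ (Fin m)) × ℂ)
      𝓘(ℝ, EuclideanSpace ℝ (Fin (m + 2)) × ℂ) (parabolaHomeomorph m).toOpenPartialHomeomorph := by
  refine IsPartialDiffeo.of_homeomorph ?_ ?_
  · change ContDiff ℝ ∞ fun x : (ℂ × EuclideanSpace ℝ (Fin m)) × ℂ =>
      ((splitCoord m).symm (x.2, x.1.2), x.1.1 - x.2 ^ 2)
    fun_prop
  · change ContDiff ℝ ∞ fun x : EuclideanSpace ℝ (Fin (m + 2)) × ℂ =>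
      ((x.2 + (splitCoord m x.1).1 ^ 2, (splitCoord m x.1).2), (splitCoord m x.1).1)
    generalize splitCoord m = e
    fun_prop

variable [T2Space M]

/-- Around every point of `N` there is a branch root `t` such that the image of `(κ, t)` is
a submanifold: at branch points the coordinate `z` of a branch model, and elsewhere `± 1`, with
different signs on the two sheets. -/
theorem exists_isBranchRoot (hκ : IsTwoFoldCover κ B) (x : N) :
    ∃ U t σ, x ∈ U ∧ IsBranchRoot κ B U t σ ∧
      ∀ p, κ p ∈ U → HasSliceChartAt (m + 2) (fun q => (κ q, t q)) p := by
  by_cases hx : x ∈ B.carrier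
  · obtain ⟨Φ, Ψ, h, hxΨ, hpos⟩ := hκ.exists_isBranchModel_normalJacobian_pos hx
    obtain ⟨V, hV, hVo, hxV⟩ := eventually_nhds_iff.1 hpos
    have hζ : ∀ q, κ q ∈ Ψ.source → (Ψ (κ q)).1 = (Φ q).1 ^ 2 ∧ (Ψ (κ q)).2 = (Φ q).2 :=
      fun q hq => by rw [h.map_eq q (h.mem_source q hq)]; exact ⟨rfl, rfl⟩
    refine ⟨Ψ.source ∩ V, fun q => (Φ q).1, fun y => (Ψ y).1, ⟨hxΨ, hxV⟩, ?_, fun p hp => ?_⟩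
    · exact {
        isOpen := Ψ.open_source.inter hVo
        smooth_root := contDiff_fst.contMDiff.comp_contMDiffOn
          (h.source_diffeo.1.mono fun q hq => h.mem_source q hq.1)
        smooth_sq := contDiff_fst.contMDiff.comp_contMDiffOn
          (h.target_diffeo.1.mono Set.inter_subset_left)
        sq_eq := fun q hq => (hζ q hq.1).1
        inj := fun p q hp hpq hz => Φ.injOn (h.mem_source q (hpq ▸ hp.1)) (h.mem_source p hp.1)
          (Prod.ext hz (by rw [← (hζ q (hpq ▸ hp.1)).2, ← (hζ p hp.1).2, hpq]))
        eq_zero_iff := fun y hy => (h.mem_carrier y hy.1).symm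
        normalJacobian_pos := fun y hy => hV y hy.2 }
    · have ha : ContMDiffOn (𝓡 (m + 2)) 𝓘(ℝ, ℂ) ∞ (fun _ : N => (0 : ℂ)) Ψ.source :=
        contMDiffOn_const
      refine ⟨Φ.trans (splitCoord m).symm.toHomeomorph.toOpenPartialHomeomorph,
        (shearChart Ψ _ ha.continuousOn).trans (parabolaHomeomorph m).toOpenPartialHomeomorph,
        h.source_diffeo.trans (IsPartialDiffeo.of_continuousLinearEquiv (splitCoord m).symm),
        (isPartialDiffeo_shearChart h.target_diffeo ha).trans (isPartialDiffeo_parabolaHomeomorph m),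
        by simpa using h.mem_source p hp.1, ⟨⟨hp.1, trivial⟩, trivial⟩, fun q hq => ?_⟩
      have hq' : κ q ∈ Ψ.source := hq.1.1
      refine ⟨by simpa using h.mem_source q hq', ?_⟩
      change ((splitCoord m).symm ((Φ q).1 - 0, (Ψ (κ q)).2), (Ψ (κ q)).1 - ((Φ q).1 - 0) ^ 2) =
        ((splitCoord m).symm (Φ q), 0)
      rw [sub_zero, (hζ q hq').1, (hζ q hq').2, sub_self]
  · obtain ⟨p, q, hpq, hp, hq, -⟩ := hκ.exists_pair hx
    obtain ⟨O₁, O₂, hO₁, hO₂, hpO, hqO, hdisj⟩ := t2_separation hpq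
    have hd : ∀ c, c ∈ O₁ → c ∉ O₂ := fun c hc => Set.disjoint_left.1 hdisj hc
    let U : Set N := κ '' O₁ ∩ κ '' O₂ ∩ B.carrierᶜ
    have hxU : x ∈ U := ⟨⟨⟨p, hpO, hp⟩, q, hqO, hq⟩, hx⟩
    have hU : IsOpen U := ((hκ.isOpenMap O₁ hO₁).inter (hκ.isOpenMap O₂ hO₂)).inter
      hκ.isClosed_carrier.isOpen_compl
    -- a point over `U` lies on exactly one of the sheets `O₁` and `O₂`
    have hsheet : ∀ r, κ r ∈ U → (r ∈ O₁ ∧ r ∉ O₂) ∨ (r ∉ O₁ ∧ r ∈ O₂) := by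
      rintro r ⟨⟨⟨a, ha, har⟩, b, hb, hbr⟩, hrB⟩
      have hab : a ≠ b := fun hab => hd a ha (hab ▸ hb)
      rcases hκ.eq_or_eq_of_ne (har ▸ hrB) hab (hbr.trans har.symm) har.symm with rfl | rfl
      · exact Or.inl ⟨ha, hd _ ha⟩
      · exact Or.inr ⟨fun h => hd _ h hb, hb⟩
    have hinj : ∀ r r', κ r ∈ U → κ r' = κ r → (r' ∈ O₁ ↔ r ∈ O₁) → r' = r := by
      rintro r r' hr hrr hiff
      obtain ⟨⟨⟨a, ha, har⟩, b, hb, hbr⟩, hrB⟩ := id hr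
      have hab : a ≠ b := fun hab => hd a ha (hab ▸ hb)
      have hb1 : b ∉ O₁ := fun h => hd _ h hb
      rcases hκ.eq_or_eq_of_ne (har ▸ hrB) hab (hbr.trans har.symm) har.symm with rfl | rfl <;>
        rcases hκ.eq_or_eq_of_ne (har ▸ hrB) hab (hbr.trans har.symm) (hrr.trans har.symm) with
          rfl | rfl
      · rfl
      · exact absurd (hiff.2 ha) hb1
      · exact absurd (hiff.1 ha) hb1
      · rfl
    classical
    have hroot : IsBranchRoot κ B U (fun r => if r ∈ O₁ then 1 else -1) (fun _ => 1) := {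
      isOpen := hU
      smooth_root := by
        intro r hr
        refine ContMDiffAt.contMDiffWithinAt ?_
        rcases hsheet r hr with h | h
        · refine (contMDiffAt_const (c := (1 : ℂ))).congr_of_eventuallyEq ?_
          filter_upwards [hO₁.mem_nhds h.1] with a ha using if_pos ha
        · refine (contMDiffAt_const (c := (-1 : ℂ))).congr_of_eventuallyEq ?_
          filter_upwards [hO₂.mem_nhds h.2] with a ha
          exact if_neg fun ha' => hd a ha' ha
      smooth_sq := contMDiffOn_const
      sq_eq := fun r _ => by split_ifs <;> norm_num
      inj := by
        intro r r' hr hrr h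
        refine hinj r r' hr hrr ?_
        have h2 : (1 : ℂ) ≠ -1 := by norm_num
        by_cases h1 : r ∈ O₁ <;> by_cases h3 : r' ∈ O₁ <;> simp_all [eq_comm]
      eq_zero_iff := fun y hy => ⟨fun h => absurd h one_ne_zero, fun h => absurd h hy.2⟩
      normalJacobian_pos := fun y hy hyB => absurd hyB hy.2 }
    exact ⟨U, _, _, hxU, hroot, fun p hp => hroot.hasSliceChartAt hκ hp hp.2⟩

end LocalRoots

/-! ### The line bundle of a two-fold cover -/

theorem exists_smul_add_smul_eq {a c : ℂ} (h : (conj a * c).im ≠ 0) (z : ℂ) :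
    ∃ α β : ℝ, α • a + β • c = z := by
  -- Cramer's rule
  refine ⟨-(conj c * z).im / (conj a * c).im, (conj a * z).im / (conj a * c).im, ?_⟩
  simp only [Complex.mul_im, Complex.conj_re, Complex.conj_im, neg_mul,
    ← sub_eq_add_neg] at h ⊢
  apply Complex.ext
  · simp only [Complex.add_re, Complex.real_smul, Complex.re_ofReal_mul]
    rw [div_mul_eq_mul_div, div_mul_eq_mul_div, ← add_div, div_eq_iff h]
    ring
  · simp only [Complex.add_im, Complex.real_smul, Complex.im_ofReal_mul]
    rw [div_mul_eq_mul_div, div_mul_eq_mul_div, ← add_div, div_eq_iff h]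
    ring

section Transversality

variable {m : ℕ} {N : Type*} [TopologicalSpace N] [ChartedSpace (EuclideanSpace ℝ (Fin (m + 2))) N]
  [IsManifold (𝓡 (m + 2)) ∞ N]

/-- A function with nonzero normal Jacobian is a submersion, as the images of the two normal vectors
span `ℂ`. -/
theorem surjective_mfderiv_of_normalJacobian_ne_zero
    {ψ : OpenPartialHomeomorph N (EuclideanSpace ℝ (Fin (m + 2)))}
    (hψ : ψ ∈ IsManifold.maximalAtlas (𝓡 (m + 2)) ∞ N) {b : N} (hb : b ∈ ψ.source) {g : N → ℂ}
    (hg : ContMDiffAt (𝓡 (m + 2)) 𝓘(ℝ, ℂ) ∞ g b) (h : normalJacobian ψ g b ≠ 0) :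
    Function.Surjective (mfderiv (𝓡 (m + 2)) 𝓘(ℝ, ℂ) g b) := by
  have hψ' : IsPartialDiffeo (𝓡 (m + 2)) (𝓡 (m + 2)) ψ :=
    (IsManifold.mem_maximalAtlas_iff_contMDiffOn ψ).1 hψ
  have hleft := ψ.left_inv hb
  have hcomp : mfderiv (𝓡 (m + 2)) 𝓘(ℝ, ℂ) (g ∘ ψ.symm) (ψ b) =
      (mfderiv (𝓡 (m + 2)) 𝓘(ℝ, ℂ) g (ψ.symm (ψ b))).comp
        (mfderiv (𝓡 (m + 2)) (𝓡 (m + 2)) ψ.symm (ψ b)) :=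
    mfderiv_comp _ (by rw [hleft]; exact hg.mdifferentiableAt (by simp))
      ((hψ'.symm.contMDiffAt (ψ.map_source hb)).mdifferentiableAt (by simp))
  rw [hleft] at hcomp
  set D := fderiv ℝ (fun a => g (ψ.symm a)) (ψ b) with hD
  have hfd : mfderiv (𝓡 (m + 2)) 𝓘(ℝ, ℂ) (g ∘ ψ.symm) (ψ b) = D := mfderiv_eq_fderiv
  intro z
  have hd : (conj (D (EuclideanSpace.single 0 1)) * D (EuclideanSpace.single 1 1)).im ≠ 0 := h
  obtain ⟨α, β, hαβ⟩ := exists_smul_add_smul_eq hd z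
  obtain ⟨v, hv⟩ : ∃ v, D v = z :=
    ⟨α • EuclideanSpace.single 0 1 + β • EuclideanSpace.single 1 1, by
      rw [map_add, map_smul, map_smul]
      exact hαβ⟩
  refine ⟨mfderiv (𝓡 (m + 2)) (𝓡 (m + 2)) ψ.symm (ψ b) v, ?_⟩
  have := congrArg (fun A => A v) (hcomp.symm.trans hfd)
  exact this.trans hv

end Transversality

section RealBundle

variable {X : Type*} [TopologicalSpace X] {E : X → Type*} [∀ x, AddCommGroup (E x)]
  [∀ x, Module ℂ (E x)] [∀ x, TopologicalSpace (E x)] [TopologicalSpace (TotalSpace ℂ E)]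
  [FiberBundle ℂ E] [VectorBundle ℂ ℂ E]

/-- A complex line bundle is a real vector bundle. -/
theorem vectorBundle_real_of_complex : VectorBundle ℝ ℂ E := by
  have hlin : ∀ (e : Trivialization ℂ (TotalSpace.proj : TotalSpace ℂ E → X))
      [MemTrivializationAtlas e], e.IsLinear ℝ := fun e _ =>
    ⟨fun x hx => ⟨(e.linear ℂ hx).map_add, fun c v => (e.linear ℂ hx).map_smul (c : ℂ) v⟩⟩
  refine ⟨hlin, fun e e' _ _ => ?_⟩
  refine ((ContinuousLinearMap.restrictScalarsL ℂ ℂ ℂ ℝ ℝ).continuous.comp_continuousOn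
    (continuousOn_coordChange ℂ e e')).congr fun x hx => ?_
  have := hlin e
  have := hlin e'
  refine ContinuousLinearMap.ext fun v => ?_
  change e.coordChangeL ℝ e' x v = e.coordChangeL ℂ e' x v
  rw [e.coordChangeL_apply e' hx, e.coordChangeL_apply e' hx]

end RealBundle

/-- Branch roots `t x` on neighbourhoods `U x` of all the points `x` of `N`, with their squares
`σ x` and their ratios `r x y = t y / t x`. -/
structure BranchRootAtlas {m : ℕ} {M : Type*} {N : Type*} [TopologicalSpace M] [TopologicalSpace N]
    [ChartedSpace (EuclideanSpace ℝ (Fin (m + 2))) M]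
    [ChartedSpace (EuclideanSpace ℝ (Fin (m + 2))) N]
    (κ : M → N) (B : OrientedCodimTwoSubmanifold m N) where
  U : N → Set N
  t : N → M → ℂ
  σ : N → N → ℂ
  r : N → N → N → ℂ
  mem : ∀ x, x ∈ U x
  root : ∀ x, IsBranchRoot κ B (U x) (t x) (σ x)
  slice : ∀ x p, κ p ∈ U x → HasSliceChartAt (m + 2) (fun q => (κ q, t x q)) p
  smooth_ratio : ∀ x y, ContMDiffOn (𝓡 (m + 2)) 𝓘(ℝ, ℂ) ∞ (r x y) (U x ∩ U y)
  ratio_mul : ∀ x y p, κ p ∈ U x ∩ U y → t y p = r x y (κ p) * t x p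

namespace BranchRootAtlas

variable {m : ℕ} {M : Type*} {N : Type u} [TopologicalSpace M] [TopologicalSpace N]
  [ChartedSpace (EuclideanSpace ℝ (Fin (m + 2))) M]
  [ChartedSpace (EuclideanSpace ℝ (Fin (m + 2))) N]
  {κ : M → N} {B : OrientedCodimTwoSubmanifold m N}

theorem nonempty_of_isTwoFoldCover [IsManifold (𝓡 (m + 2)) ∞ M] [IsManifold (𝓡 (m + 2)) ∞ N]
    [T2Space M] (hκ : IsTwoFoldCover κ B) : Nonempty (BranchRootAtlas κ B) := by
  choose U t σ hx hroot hslice using exists_isBranchRoot hκ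
  choose r hr _ hrt using fun x y => (hroot x).exists_ratio (hroot y) hκ
  exact ⟨⟨U, t, σ, r, hx, hroot, hslice, hr, hrt⟩⟩

variable (A : BranchRootAtlas κ B)

theorem isOpen_inter (x y : N) : IsOpen (A.U x ∩ A.U y) := (A.root x).isOpen.inter (A.root y).isOpen

theorem continuousAt_ratio {x y z : N} (h : z ∈ A.U x ∩ A.U y) : ContinuousAt (A.r x y) z :=
  (A.smooth_ratio x y).continuousOn.continuousAt ((A.isOpen_inter x y).mem_nhds h)

theorem ratio_self (hκ : IsTwoFoldCover κ B) {x y : N} (hy : y ∈ A.U x) : A.r x x y = 1 := by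
  refine (A.root x).ratio_unique (t' := A.t x) (r₂ := fun _ => 1) hκ hy
    (A.continuousAt_ratio ⟨hy, hy⟩) continuousAt_const ?_ (.of_forall fun z p _ => (one_mul _).symm)
  filter_upwards [(A.root x).isOpen.mem_nhds hy] with z hz
  rintro p rfl
  exact A.ratio_mul x x p ⟨hz, hz⟩

/-- The cocycle condition. -/
theorem ratio_mul_ratio (hκ : IsTwoFoldCover κ B) {x y z a : N}
    (ha : a ∈ A.U x ∩ A.U y ∩ A.U z) : A.r y z a * A.r x y a = A.r x z a := by
  refine (A.root x).ratio_unique (t' := A.t z) (r₁ := fun a => A.r y z a * A.r x y a) hκ ha.1.1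
    ((A.continuousAt_ratio ⟨ha.1.2, ha.2⟩).mul (A.continuousAt_ratio ha.1))
    (A.continuousAt_ratio ⟨ha.1.1, ha.2⟩) ?_ ?_
  · filter_upwards [((A.isOpen_inter x y).inter (A.root z).isOpen).mem_nhds ha] with b hb
    rintro p rfl
    rw [mul_assoc, ← A.ratio_mul x y p hb.1, ← A.ratio_mul y z p ⟨hb.1.2, hb.2⟩]
  · filter_upwards [((A.isOpen_inter x y).inter (A.root z).isOpen).mem_nhds ha] with b hb
    rintro p rfl
    exact A.ratio_mul x z p ⟨hb.1.1, hb.2⟩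

/-- The ratios of the roots are the transition functions of a line bundle. -/
noncomputable def core (hκ : IsTwoFoldCover κ B) : VectorBundleCore ℂ N ℂ N where
  baseSet := A.U
  isOpen_baseSet x := (A.root x).isOpen
  indexAt x := x
  mem_baseSet_at := A.mem
  coordChange x y a := ContinuousLinearMap.mul ℂ ℂ (A.r x y a)
  coordChange_self x y hy v := by simp [A.ratio_self hκ hy]
  continuousOn_coordChange x y :=
    (ContinuousLinearMap.mul ℂ ℂ).continuous.comp_continuousOn (A.smooth_ratio x y).continuousOn
  coordChange_comp x y z a ha v := by simp [← A.ratio_mul_ratio hκ ha, mul_assoc]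

theorem contMDiffVectorBundle_core (hκ : IsTwoFoldCover κ B)
    [VectorBundle ℝ ℂ (A.core hκ).Fiber] :
    ContMDiffVectorBundle ∞ ℂ (A.core hκ).Fiber (𝓡 (m + 2)) where
  contMDiffOn_coordChangeL := by
    rintro _ _ ⟨x, rfl⟩ ⟨y, rfl⟩
    refine ((ContinuousLinearMap.mul ℝ ℂ).contDiff.contMDiff.comp_contMDiffOn
      (A.smooth_ratio x y)).congr fun a ha => ?_
    refine ContinuousLinearMap.ext fun v => ?_
    have h := (A.core hκ).localTriv_coordChange_eq x y ha v
    rw [Trivialization.coordChangeL_apply _ _ ha] at h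
    have hx : MemTrivializationAtlas ((A.core hκ).localTriv x) := ⟨⟨x, rfl⟩⟩
    have hy : MemTrivializationAtlas ((A.core hκ).localTriv y) := ⟨⟨y, rfl⟩⟩
    exact (Trivialization.coordChangeL_apply (R := ℝ) ((A.core hκ).localTriv x)
      ((A.core hκ).localTriv y) ha v).trans h

/-- The line bundle with the transition functions `r x y`. -/
noncomputable def lineBundle (hκ : IsTwoFoldCover κ B) : ComplexLineBundle.{u, 0} (m + 2) N :=
  have : VectorBundle ℝ ℂ (A.core hκ).Fiber := vectorBundle_real_of_complex
  have := A.contMDiffVectorBundle_core hκ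
  { Fiber := (A.core hκ).Fiber }

/-- The trivialization over `U x`. -/
noncomputable def triv (hκ : IsTwoFoldCover κ B) (x : N) :
    Trivialization ℂ (TotalSpace.proj : (A.lineBundle hκ).Total → N) := (A.core hκ).localTriv x

instance (hκ : IsTwoFoldCover κ B) (x : N) : MemTrivializationAtlas (A.triv hκ x) :=
  ⟨⟨x, rfl⟩⟩

theorem exists_eq_triv (hκ : IsTwoFoldCover κ B)
    (e : Trivialization ℂ (TotalSpace.proj : (A.lineBundle hκ).Total → N))
    [he : MemTrivializationAtlas e] : ∃ x, e = A.triv hκ x := by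
  obtain ⟨⟨x, hx⟩⟩ := he
  exact ⟨x, hx.symm⟩

/-- The vector in the fibre at `x` with coordinate `c` in the trivialization over `U x`. -/
def vec (hκ : IsTwoFoldCover κ B) (x : N) (c : ℂ) : (A.lineBundle hκ).Fiber x := c

theorem triv_vec (hκ : IsTwoFoldCover κ B) (x y : N) (c : ℂ) :
    (A.triv hκ x ⟨y, A.vec hκ y c⟩).2 = A.r y x y * c := rfl

theorem vec_tmul_vec (hκ : IsTwoFoldCover κ B) (x : N) (c : ℂ) :
    A.vec hκ x c ⊗ₜ[ℂ] A.vec hκ x c = c ^ 2 • (A.vec hκ x 1 ⊗ₜ[ℂ] A.vec hκ x 1) := by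
  have h : A.vec hκ x c = c • A.vec hκ x 1 := (mul_one c).symm
  rw [h, TensorProduct.smul_tmul_smul, sq]

/-- The section of `L ⊗ L` with coordinate `σ x` in the trivialization over `U x`. -/
noncomputable def sqSection (hκ : IsTwoFoldCover κ B) (x : N) : (A.lineBundle hκ).SqFiber x :=
  A.σ x x • (A.vec hκ x 1 ⊗ₜ A.vec hκ x 1)

/-- The map from `M` to `L` over `N` with fibre coordinate `t x` in the trivialization over
`U x`. -/
noncomputable def embedding (hκ : IsTwoFoldCover κ B) (p : M) : (A.lineBundle hκ).Total :=
  ⟨κ p, A.vec hκ (κ p) (A.t (κ p) p)⟩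

theorem triv_embedding (hκ : IsTwoFoldCover κ B) {x : N} {p : M} (hp : κ p ∈ A.U x) :
    A.triv hκ x (A.embedding hκ p) = (κ p, A.t x p) :=
  Prod.ext rfl (A.ratio_mul (κ p) x p ⟨A.mem _, hp⟩).symm

theorem sqCoord_sqSection (hκ : IsTwoFoldCover κ B) {x y : N} (hy : y ∈ A.U x) :
    (A.lineBundle hκ).sqCoord (A.triv hκ x) y (A.sqSection hκ y) = A.σ x y := by
  rw [sqSection, map_smul, ComplexLineBundle.sqCoord_tmul _ _ hy, triv_vec]
  obtain ⟨p, rfl⟩ := hκ.surjective y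
  rw [(A.root x).sq_eq p hy, (A.root (κ p)).sq_eq p (A.mem _), A.ratio_mul (κ p) x p ⟨A.mem _, hy⟩,
    smul_eq_mul]
  ring

theorem sqSection_eq_zero_iff (hκ : IsTwoFoldCover κ B) (x : N) :
    A.sqSection hκ x = 0 ↔ x ∈ B.carrier := by
  rw [← (A.root x).eq_zero_iff x (A.mem x)]
  refine ⟨fun h => ?_, fun h => by rw [sqSection, h, zero_smul]⟩
  rw [← A.sqCoord_sqSection hκ (A.mem x), h, map_zero]

theorem isSmoothSqSection (hκ : IsTwoFoldCover κ B) :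
    (A.lineBundle hκ).IsSmoothSqSection (A.sqSection hκ) := by
  intro e _
  obtain ⟨x, rfl⟩ := A.exists_eq_triv hκ e
  exact (A.root x).smooth_sq.congr fun y hy => A.sqCoord_sqSection hκ hy

theorem hasZeroLocus (hκ : IsTwoFoldCover κ B) :
    (A.lineBundle hκ).HasZeroLocus (A.sqSection hκ) B := by
  refine ⟨A.sqSection_eq_zero_iff hκ, fun e _ ψ hψ b hb hbψ hbe => ?_⟩
  obtain ⟨x, rfl⟩ := A.exists_eq_triv hκ e
  have h := (A.root x).normalJacobian_pos b hbe hb ψ hψ hbψ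
  have heq : (fun a => A.σ x (ψ.symm a)) =ᶠ[𝓝 (ψ b)] fun a =>
      (A.lineBundle hκ).sqCoord (A.triv hκ x) (ψ.symm a) (A.sqSection hκ (ψ.symm a)) := by
    filter_upwards [(ψ.tendsto_symm hbψ).eventually ((A.root x).isOpen.mem_nhds hbe)] with a ha
    exact (A.sqCoord_sqSection hκ ha).symm
  rwa [normalJacobian, heq.fderiv_eq] at h

theorem isTransverseSqSection [IsManifold (𝓡 (m + 2)) ∞ N] (hκ : IsTwoFoldCover κ B) :
    (A.lineBundle hκ).IsTransverseSqSection (A.sqSection hκ) := by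
  refine ⟨A.isSmoothSqSection hκ, fun e _ b hbe hb => ?_⟩
  rw [sqSection_eq_zero_iff] at hb
  obtain ⟨ψ, hψ, hbψ⟩ := B.cover b hb
  exact surjective_mfderiv_of_normalJacobian_ne_zero (B.smooth ψ hψ) hbψ
    ((A.isSmoothSqSection hκ e).contMDiffAt (e.open_baseSet.mem_nhds hbe))
    ((A.hasZeroLocus hκ).2 e ψ hψ b hb hbψ hbe).ne'

theorem range_embedding (hκ : IsTwoFoldCover κ B) :
    Set.range (A.embedding hκ) = (A.lineBundle hκ).branchedCover (A.sqSection hκ) := by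
  refine Set.Subset.antisymm ?_ ?_
  · rintro _ ⟨p, rfl⟩
    change A.vec hκ (κ p) (A.t (κ p) p) ⊗ₜ[ℂ] A.vec hκ (κ p) (A.t (κ p) p) = A.sqSection hκ (κ p)
    rw [vec_tmul_vec, sqSection, (A.root (κ p)).sq_eq p (A.mem _)]
  · suffices h : ∀ (y : N) (c : ℂ), (⟨y, A.vec hκ y c⟩ : (A.lineBundle hκ).Total) ∈
        (A.lineBundle hκ).branchedCover (A.sqSection hκ) →
        (⟨y, A.vec hκ y c⟩ : (A.lineBundle hκ).Total) ∈ Set.range (A.embedding hκ) from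
      fun v hv => h v.1 v.2 hv
    intro y c hc
    obtain ⟨p, rfl⟩ := hκ.surjective y
    have hroot := A.root (κ p)
    have hp := A.mem (κ p)
    have h1 : A.vec hκ (κ p) c ⊗ₜ[ℂ] A.vec hκ (κ p) c = A.sqSection hκ (κ p) := hc
    have h2 := congrArg ((A.lineBundle hκ).sqCoord (A.triv hκ (κ p)) (κ p)) h1
    rw [ComplexLineBundle.sqCoord_tmul _ _ hp, A.sqCoord_sqSection hκ hp, triv_vec,
      A.ratio_self hκ hp, hroot.sq_eq p hp, one_mul, ← sq] at h2
    have key : ∃ q, κ q = κ p ∧ A.t (κ p) q = c := by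
      rcases sq_eq_sq_iff_eq_or_eq_neg.1 h2 with h3 | h3
      · exact ⟨p, rfl, h3.symm⟩
      · by_cases hB : κ p ∈ B.carrier
        · have h0 := hroot.sq_eq p hp
          rw [(hroot.eq_zero_iff _ hp).2 hB] at h0
          have h4 : A.t (κ p) p = 0 := (pow_eq_zero_iff two_ne_zero).1 h0.symm
          exact ⟨p, rfl, by rw [h4, h3, h4, neg_zero]⟩
        · obtain ⟨q, hqp, hq⟩ : ∃ q, q ≠ p ∧ κ q = κ p := by
            obtain ⟨a, b, hab, ha, hb, -⟩ := hκ.exists_pair hB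
            rcases eq_or_ne a p with rfl | hap
            · exact ⟨b, hab.symm, hb⟩
            · exact ⟨a, hap, ha⟩
          exact ⟨q, hq, by rw [hroot.eq_neg hp hq hqp, h3]⟩
    obtain ⟨q, hq, rfl⟩ := key
    refine ⟨q, ?_⟩
    rw [embedding, hq]

theorem continuous_embedding (hκ : IsTwoFoldCover κ B) : Continuous (A.embedding hκ) := by
  refine continuous_iff_continuousAt.2 fun p => ?_
  have hU : κ ⁻¹' A.U (κ p) ∈ 𝓝 p :=
    ((A.root (κ p)).isOpen.preimage hκ.smooth.continuous).mem_nhds (A.mem _)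
  set e := A.triv hκ (κ p) with he
  have h1 : ContinuousAt (fun q => e.toOpenPartialHomeomorph.symm (κ q, A.t (κ p) q)) p := by
    refine ContinuousAt.comp (g := e.toOpenPartialHomeomorph.symm)
      (f := fun q => (κ q, A.t (κ p) q)) (e.toOpenPartialHomeomorph.continuousAt_symm
        (e.mem_target.2 (A.mem (κ p)))) ?_
    exact hκ.smooth.continuous.continuousAt.prodMk
      ((A.root (κ p)).smooth_root.continuousOn.continuousAt hU)
  refine h1.congr ?_
  filter_upwards [hU] with q hq
  rw [← A.triv_embedding hκ hq]
  exact e.toOpenPartialHomeomorph.left_inv (e.mem_source.2 hq)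

theorem isDiffeoOver [IsManifold (𝓡 (m + 2)) ∞ M] [IsManifold (𝓡 (m + 2)) ∞ N]
    (hκ : IsTwoFoldCover κ B) :
    (A.lineBundle hκ).IsDiffeoOver κ (A.sqSection hκ) (A.embedding hκ) where
  isSmoothEmbedding := by
    refine isSmoothEmbedding_of_hasSliceChartAt (A.continuous_embedding hκ) fun p => ?_
    obtain ⟨Φ, Θ, hΦ, hΘ, hp, hpΘ, hslice⟩ := A.slice (κ p) p (A.mem _)
    have hs : ∀ {q}, κ q ∈ A.U (κ p) → A.embedding hκ q ∈ (A.triv hκ (κ p)).source := fun hq =>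
      (A.triv hκ (κ p)).mem_source.2 hq
    have he : IsPartialDiffeo ((𝓡 (m + 2)).prod 𝓘(ℝ, ℂ)) ((𝓡 (m + 2)).prod 𝓘(ℝ, ℂ))
        (A.triv hκ (κ p)).toOpenPartialHomeomorph :=
      ⟨(A.triv hκ (κ p)).contMDiffOn, (A.triv hκ (κ p)).contMDiffOn_symm⟩
    refine ⟨Φ, (A.triv hκ (κ p)).toOpenPartialHomeomorph.trans Θ, hΦ, he.trans hΘ, hp,
      ⟨hs (A.mem _), ?_⟩, fun q hq => ?_⟩
    · change A.triv hκ (κ p) (A.embedding hκ p) ∈ Θ.source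
      rwa [A.triv_embedding hκ (A.mem _)]
    · have hqU : κ q ∈ A.U (κ p) := (A.triv hκ (κ p)).mem_source.1 hq.1
      have hqΘ : A.triv hκ (κ p) (A.embedding hκ q) ∈ Θ.source := hq.2
      change q ∈ Φ.source ∧ Θ (A.triv hκ (κ p) (A.embedding hκ q)) = (Φ q, 0)
      rw [A.triv_embedding hκ hqU] at hqΘ ⊢
      exact hslice q hqΘ
  range_eq := A.range_embedding hκ
  proj_comp p := rfl

end BranchRootAtlas

theorem mainTheorem9 {m : ℕ} {M : Type*} {N : Type u}
    [TopologicalSpace M] [T2Space M] [SecondCountableTopology M]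
    [ChartedSpace (EuclideanSpace ℝ (Fin (m + 2))) M] [IsOrientedManifold (m + 2) M]
    [TopologicalSpace N] [T2Space N] [SecondCountableTopology N]
    [ChartedSpace (EuclideanSpace ℝ (Fin (m + 2))) N] [IsOrientedManifold (m + 2) N]
    (B : OrientedCodimTwoSubmanifold m N) (κ : M → N) (hκ : IsTwoFoldCover κ B) :
    (∃ (L : ComplexLineBundle.{u, 0} (m + 2) N) (s : ∀ x, L.SqFiber x) (f : M → L.Total),
      L.IsTransverseSqSection s ∧ L.HasZeroLocus s B ∧ L.IsDiffeoOver κ s f) ∧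
    (∀ (L : ComplexLineBundle.{u, v} (m + 2) N) (s : ∀ x, L.SqFiber x) (f : M → L.Total)
      (L' : ComplexLineBundle.{u, w} (m + 2) N) (s' : ∀ x, L'.SqFiber x) (f' : M → L'.Total),
      L.IsTransverseSqSection s → L.HasZeroLocus s B → L.IsDiffeoOver κ s f →
      L'.IsTransverseSqSection s' → L'.HasZeroLocus s' B → L'.IsDiffeoOver κ s' f' →
      ∃! Φ : ∀ x, L.Fiber x ≃ₗ[ℂ] L'.Fiber x,
        ComplexLineBundle.IsSmoothIso Φ ∧
        (∀ x, TensorProduct.map (Φ x).toLinearMap (Φ x).toLinearMap (s x) = s' x) ∧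
        ∀ p, ComplexLineBundle.totalMap Φ (f p) = f' p) := by
  obtain ⟨A⟩ := BranchRootAtlas.nonempty_of_isTwoFoldCover hκ
  refine ⟨⟨A.lineBundle hκ, A.sqSection hκ, A.embedding hκ, A.isTransverseSqSection hκ,
    A.hasZeroLocus hκ, A.isDiffeoOver hκ⟩, ?_⟩
  intro L s f L' s' f' hs hB hf hs' hB' hf'
  exact ComplexLineBundle.existsUnique_isomorphism hκ hs.1 hB hf hs'.1 hB' hf'
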